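/- Let $\mathbf K$ be an algebraically closed field, $n\ge 2$, and let $\mathcal U=\mathcal U_{\mathbf Z}\otimes_{\mathbf Z}\mathbf K$ be the hyperalgebra of type $A_{n-1}$, where $\mathcal U_{\mathbf Z}$ is the subring of the universal enveloping algebra of $\mathfrak{sl}_n(\mathbf C)$ generated by all $E_{r,s}^m/m!$ ($r\ne s$, $m\ge 0$). Put $E_{r,s}^{(m)}=(E_{r,s}^m/m!)\otimes 1$ and $H_{l}=E_{l,l}-E_{l+1,l+1}$. For a matrix $N$ of nonnegative integers put $F^{(N)}=\prod_{1\le c<d\le n}E_{d,c}^{(N_{c,d})}$, the factors being ordered by increasing $d$ and, for equal $d$, by increasing $c$. Let $\mathcal U^{-,0}$ be the $\mathbf K$-span of the products $F^{(N)}\prod_{l}\bigl(\binom{H_l}{m_l}\otimes 1\bigr)$, $m_l\ge 0$. These products, for $N$ strictly upper triangular, form a basis of $\mathcal U^{-,0}$. Let $\theta_{\omega_i}$ be the linear operator on $\mathcal U^{-,0}$ that replaces $\binom{H_i}{m_i}$ with $\binom{H_i+1}{m_i}$ in every such product. For $1\le l<n$ let $\eta_l$ be the linear operator on $\mathcal U^{-,0}$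 such that $E_{l,l+1}F-\eta_l(F)$ lies, for all $F\in\mathcal U^{-,0}$, in the left ideal of $\mathcal U$ generated by all $E_{r,s}^{(k)}$ with $r<s$, $k>0$. For $i_1,\dots,i_k\in\{1,\dots,n-1\}$ put $[\![i_1,\dots,i_k]\!]_i=[\eta_{i_1},[\eta_{i_2},\dots,[\eta_{i_k},\theta_{\omega_i}]\dots]]$, where $[x,y]=xy-yx$. Fix integers $q\ge 0$, $1\le i<n$ and $1\le a_1<\dots<a_q\le i<b_q<\dots<b_1\le n$. For each $j$ choose a sequence $w_j$ obtained by inserting $a_j,a_j+1,\dots,i-1$ and $b_j-1,b_j-2,\dots,i+1$ into one another, preserving the order in either of them. The operator $[\![w_q,i,w_{q-1},i,\dots,w_1,i]\!]_i$ does not depend on the choice of the $w_j$; denote it by $\xi_i(a;b)$. A *flow* with sources $a_1,\dots,a_q$ and sinks $b_1,\dots,b_q$ is a directed graph $\Gamma$ on $\mathbf Z$ with finitely many edges, all of the form $(s,t)$ with $s<t$, such that exactly one edge begins and no edge ends at each source, exactly one edge ends and no edge begins at each sink, and at every other vertex either no edge begins or ends, or exactly one edge begins and exactly one edge ends; in the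 last case the vertex is a *transit point*. Let $\mathcal F_i(a;b)$ be the set of these flows that have no transit point greater than $i$. For $\Gamma\in\mathcal F_i(a;b)$ let $\sigma$ be the permutation such that $a_j$ and $b_{\sigma(j)}$ lie in the same connected component of $\Gamma$, and put $\operatorname{sgn}_i(\Gamma)=\operatorname{sgn}\sigma\cdot(-1)^{\sum_{j}(b_j-i)+\tau}$, where $\tau$ is the number of transit points. For $\Gamma\neq\Gamma'$ in $\mathcal F_i(a;b)$ list the edges of each in the order of decreasing ends; at the first place where the lists differ the edges are $(s,t)$ and $(s',t)$ with the same end $t$, and $\Gamma<\Gamma'$ means $s>s'$. Let $\lambda=(\lambda_1,\dots,\lambda_n)$ be a sequence of nonnegative integers. A *regular row standard* $\lambda$-tableau $T$ is a filling of the diagram with rows of lengths $\lambda_1,\dots,\lambda_n$ by elements of $\{1,\dots,n\}$ such that the rows weakly increase and all entries of row $r$ are at least $r$. Put $F_T=F^{(\mathrm{Mat}_T)}$, where the $(r,c)$-entry of $\mathrm{Mat}_T$, $r<c$, is the number of entries $c$ in row $r$ of $T$ and the other entries of $\mathrm{Mat}_T$ are zero. Let $T[m]$ be the part of $T$ with entries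 at most $m$. For two such tableaux $T<S$ means that, for some $m$, the shape of $T[m]$ is strictly smaller than the shape of $S[m]$ in the dominance order (given by $\mu\le\mu'$ iff $\mu_1+\dots+\mu_k\le\mu'_1+\dots+\mu'_k$ for all $k$), and $T[m']$ and $S[m']$ have the same shape for all $m'>m$. For $\Gamma\in\mathcal F_i(a;b)$ the tableau $\sigma_{\Gamma,i}(T)$ is *well-defined* if row $s$ of $T$ contains $t$ for every edge $(s,t)$ of $\Gamma$; it is then obtained from $T$ by replacing one $t$ with $s$ in row $s$ for each edge $(s,t)$, adding one $k$ to each row $k>i$, and sorting the rows. It is a regular row standard $\lambda^+$-tableau, where $\lambda^+=(\lambda_1,\dots,\lambda_i,\lambda_{i+1}+1,\dots,\lambda_n+1)$. (1) For every regular row standard $\lambda$-tableau $T$, $$\xi_i(a;b)(F_T)=\sum_{\Gamma}\operatorname{sgn}_i(\Gamma)\,F_{\sigma_{\Gamma,i}(T)},$$ where the sum is over all $\Gamma\in\mathcal F_i(a;b)$ such that $\sigma_{\Gamma,i}(T)$ is well-defined. (2) Let $F=\sum_{S\in X}\alpha_SF_S$, where $X$ is a nonempty set of regular row standard $\lambda$-tableaux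 and $\alpha_S\in\mathbf K\setminus\{0\}$. Let $T$ be a minimal element of $X$ and $\Gamma$ the smallest element of $\mathcal F_i(a;b)$. If $\sigma_{\Gamma,i}(T)$ is well-defined, then $\xi_i(a;b)(F)=\sum_{P\in Y}\beta_PF_P$, where $Y$ is a set of regular row standard $\lambda^+$-tableaux, $\beta_P\in\mathbf K\setminus\{0\}$, and $\sigma_{\Gamma,i}(T)$ is a minimal element of $Y$. -/

import Mathlib

open scoped TensorProduct

namespace TypeA

noncomputable section

/-! ## The hyperalgebra of type `A_ℓ`

Rows, columns and vertices are numbered `0, …, ℓ` (elements of `Fin (ℓ + 1)`, where `ℓ + 1 = n`)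
and simple roots and fundamental weights `0, …, ℓ - 1` (elements of `Fin ℓ`), that is, every index
is the usual one minus one. The simple root with index `l` belongs to the position
`(l.castSucc, l.succ)`. -/

/-- The universal enveloping algebra of `sl_{ℓ+1}(ℂ)`. -/
abbrev UC (ℓ : ℕ) : Type :=
  UniversalEnvelopingAlgebra ℂ (LieAlgebra.SpecialLinear.sl (Fin (ℓ + 1)) ℂ)

/-- The image of the matrix unit `E_{a,b}` (`a ≠ b`) in the universal enveloping algebra. -/
def unitE {ℓ : ℕ} (a b : Fin (ℓ + 1)) (h : a ≠ b) : UC ℓ :=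
  UniversalEnvelopingAlgebra.ι ℂ (LieAlgebra.SpecialLinear.single a b h (1 : ℂ))

/-- The image of `H_{α_l} = E_{l,l} - E_{l+1,l+1}` in the universal enveloping algebra. -/
def cartanH {ℓ : ℕ} (l : Fin ℓ) : UC ℓ :=
  UniversalEnvelopingAlgebra.ι ℂ
    (LieAlgebra.SpecialLinear.singleSubSingle l.castSucc l.succ (1 : ℂ))

section Binomial

variable {A : Type*} [Ring A] [Algebra ℂ A]

/-- The divided power `x ^ m / m!`. -/
def divPow (x : A) (m : ℕ) : A := ((m.factorial : ℂ)⁻¹) • x ^ m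

/-- The binomial coefficient `x (x - 1) ⋯ (x - m + 1) / m!`. -/
def binom (x : A) (m : ℕ) : A :=
  ((m.factorial : ℂ)⁻¹) • ((List.range m).map (fun k : ℕ => x - (k : A))).prod

theorem divPow_zero (x : A) : divPow x 0 = 1 := by simp [divPow]

theorem binom_zero (x : A) : binom x 0 = 1 := by simp [binom]

theorem fact_inv_succ (m : ℕ) :
    ((m : ℂ) + 1) * (((m + 1).factorial : ℂ)⁻¹) = ((m.factorial : ℂ)⁻¹) := by
  have h : (m.factorial : ℂ) ≠ 0 := by exact_mod_cast m.factorial_ne_zero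
  have h' : (m : ℂ) + 1 ≠ 0 := by exact_mod_cast m.succ_ne_zero
  rw [Nat.factorial_succ]; push_cast; field_simp

theorem divPow_succ (x : A) (m : ℕ) : ((m : ℂ) + 1) • divPow x (m + 1) = x * divPow x m := by
  rw [divPow, smul_smul, fact_inv_succ, pow_succ', divPow, mul_smul_comm]

theorem divPow_succ' (x : A) (m : ℕ) : ((m : ℂ) + 1) • divPow x (m + 1) = divPow x m * x := by
  rw [divPow, smul_smul, fact_inv_succ, pow_succ, divPow, smul_mul_assoc]

theorem binom_succ (x : A) (m : ℕ) :
    ((m : ℂ) + 1) • binom x (m + 1) = binom x m * (x - m) := by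
  rw [binom, smul_smul, fact_inv_succ, List.range_succ, List.map_append, List.prod_append, binom]
  simp

theorem commute_binom (x y : A) (h : Commute y x) (m : ℕ) : Commute y (binom x m) := by
  induction m with
  | zero => simp [binom_zero]
  | succ m ih =>
    have h0 : ((m : ℂ) + 1) ≠ 0 := by exact_mod_cast m.succ_ne_zero
    have : binom x (m + 1) = ((m : ℂ) + 1)⁻¹ • (binom x m * (x - m)) := by
      rw [← binom_succ, smul_smul, inv_mul_cancel₀ h0, one_smul]
    rw [this]
    exact (ih.mul_right (h.sub_right (Nat.commute_cast y m))).smul_right _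

theorem binom_pascal (x : A) (m : ℕ) :
    binom (x + 1) (m + 1) = binom x (m + 1) + binom x m := by
  induction m with
  | zero => simp [binom]
  | succ m ih =>
    have h0 : ((m : ℂ) + 1 + 1) ≠ 0 := by exact_mod_cast (m + 1).succ_ne_zero
    have e1 := binom_succ (x + 1) (m + 1)
    have e2 := binom_succ x (m + 1)
    have e3 := binom_succ x m
    push_cast at e1 e2
    have key : ((m : ℂ) + 1 + 1) • binom (x + 1) (m + 1 + 1) =
        ((m : ℂ) + 1 + 1) • (binom x (m + 1 + 1) + binom x (m + 1)) := by
      rw [e1, ih, smul_add, e2, add_mul,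
        show x + 1 - ((m : A) + 1) = x - m by abel, ← e3, add_smul, one_smul]
      have : binom x (m + 1) * (x - m) = binom x (m + 1) * (x - ((m : A) + 1))
          + binom x (m + 1) := by noncomm_ring
      rw [this]; module
    exact smul_right_injective A h0 key

theorem e_mul_divPow {e f h : A} (hef : e * f = f * e + h) (hhf : h * f = f * (h - 2)) (c : ℕ) :
    e * divPow f (c + 1) = divPow f (c + 1) * e + divPow f c * (h - c) := by
  induction c with
  | zero => simp [divPow, hef]
  | succ c ih =>
    have h0 : ((c : ℂ) + 1 + 1) ≠ 0 := by exact_mod_cast (c + 1).succ_ne_zero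
    have e1 := divPow_succ' f (c + 1)
    have e3 := divPow_succ' f c
    push_cast at e1
    refine smul_right_injective A h0 ?_
    show ((c : ℂ) + 1 + 1) • (e * divPow f (c + 1 + 1)) =
      ((c : ℂ) + 1 + 1) • (divPow f (c + 1 + 1) * e + divPow f (c + 1) * (h - ((c + 1 : ℕ) : A)))
    rw [← mul_smul_comm, e1, ← mul_assoc, ih, smul_add, ← smul_mul_assoc, e1, add_mul]
    have a1 : divPow f c * (h - c) * f = ((c : ℂ) + 1) • (divPow f (c + 1) * (h - 2 - c)) := by
      rw [← smul_mul_assoc, e3, mul_assoc, sub_mul, hhf, (Nat.cast_commute c f).eq, ← mul_sub,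
        mul_assoc]
    rw [a1, mul_assoc, hef, mul_add, add_assoc, mul_assoc]
    congr 1
    have a2 : ((c : ℂ) + 1) • (divPow f (c + 1) * (h - 2 - c)) =
        divPow f (c + 1) * ((c + 1 : ℕ) * (h - 2 - c)) := by
      rw [← mul_smul_comm]; congr 1
      rw [show ((c : ℂ) + 1) = ((c + 1 : ℕ) : ℂ) by push_cast; rfl, Nat.cast_smul_eq_nsmul,
        nsmul_eq_mul]
    have a3 : ((c : ℂ) + 1 + 1) • (divPow f (c + 1) * (h - ((c + 1 : ℕ) : A))) =
        divPow f (c + 1) * ((c + 1 + 1 : ℕ) * (h - ((c + 1 : ℕ) : A))) := by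
      rw [← mul_smul_comm]; congr 1
      rw [show ((c : ℂ) + 1 + 1) = ((c + 1 + 1 : ℕ) : ℂ) by push_cast; rfl,
        Nat.cast_smul_eq_nsmul, nsmul_eq_mul]
    rw [a2, a3, ← mul_add]
    congr 1
    push_cast
    noncomm_ring

theorem e_mul_binom {e h : A} (hhe : e * h = (h - 2) * e) (s : ℤ) (k : ℕ) :
    e * binom (h + s) k = binom (h + ((s - 2 : ℤ) : A)) k * e := by
  induction k with
  | zero => simp [binom_zero]
  | succ k ih =>
    have h0 : ((k : ℂ) + 1) ≠ 0 := by exact_mod_cast k.succ_ne_zero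
    refine smul_right_injective A h0 ?_
    show ((k : ℂ) + 1) • (e * binom (h + s) (k + 1)) =
      ((k : ℂ) + 1) • (binom (h + ((s - 2 : ℤ) : A)) (k + 1) * e)
    rw [← mul_smul_comm, ← smul_mul_assoc, binom_succ, binom_succ, ← mul_assoc, ih, mul_assoc,
      mul_assoc]
    congr 1
    rw [mul_sub, mul_add, hhe, ← (Int.cast_commute s e).eq, ← (Nat.cast_commute k e).eq]
    push_cast
    noncomm_ring

theorem divPow_mul_divPow {e f h : A} (hef : e * f = f * e + h) (hhf : h * f = f * (h - 2))
    (hhe : e * h = (h - 2) * e) (m : ℕ) : ∀ j : ℕ,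
    divPow e m * divPow f (m + j) = ∑ p ∈ Finset.range (m + 1),
      divPow f (j + p) * binom (h + ((-(j : ℤ) - 2 * p : ℤ) : A)) (m - p) * divPow e p := by
  induction m with
  | zero => intro j; simp [divPow_zero, binom_zero]
  | succ m ih =>
    intro j
    have h0 : ((m : ℂ) + 1) ≠ 0 := by exact_mod_cast m.succ_ne_zero
    refine smul_right_injective A h0 ?_
    show ((m : ℂ) + 1) • (divPow e (m + 1) * divPow f (m + 1 + j)) = ((m : ℂ) + 1) • _
    rw [← smul_mul_assoc, divPow_succ, mul_assoc, show m + 1 + j = m + (j + 1) by ring, ih,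
      Finset.mul_sum, Finset.smul_sum]
    set G : ℕ → A := fun p => (p : ℂ) •
      (divPow f (j + p) * binom (h + ((-(j : ℤ) - 1 - 2 * p : ℤ) : A)) (m + 1 - p) * divPow e p)
      with hG
    set L : ℕ → A := fun p => divPow f (j + p) *
      ((h - ((j + p : ℕ) : A)) * binom (h + ((-(j : ℤ) - 1 - 2 * p : ℤ) : A)) (m - p)) * divPow e p
      with hL
    have step : ∀ p ∈ Finset.range (m + 1),
        e * (divPow f (j + 1 + p) *
          binom (h + ((-((j + 1 : ℕ) : ℤ) - 2 * p : ℤ) : A)) (m - p) * divPow e p) =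
        G (p + 1) + L p := by
      intro p _
      have e1 := e_mul_divPow hef hhf (j + p)
      rw [show j + 1 + p = j + p + 1 by ring, ← mul_assoc, ← mul_assoc, e1, add_mul, add_mul]
      congr 1
      · rw [mul_assoc (divPow f _) e, e_mul_binom hhe, hG]
        dsimp only
        rw [← mul_smul_comm]
        rw [show ((p + 1 : ℕ) : ℂ) = (p : ℂ) + 1 by push_cast; rfl, divPow_succ, show m + 1 - (p + 1) = m - p by omega,
          show j + (p + 1) = j + p + 1 by ring, mul_assoc, mul_assoc, mul_assoc]
        congr 3
        congr 2
        push_cast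
        ring
      · rw [hL]
        dsimp only
        rw [mul_assoc (divPow f _)]
        congr 4
        push_cast
        noncomm_ring
    rw [Finset.sum_congr rfl step, Finset.sum_add_distrib]
    have hG0 : G 0 = 0 := by simp [hG]
    have hs : ∑ p ∈ Finset.range (m + 1), G (p + 1) = ∑ p ∈ Finset.range (m + 1 + 1), G p := by
      rw [Finset.sum_range_succ' G, hG0, add_zero]
    rw [hs, Finset.sum_range_succ, Finset.sum_range_succ _ (m + 1), add_right_comm,
      ← Finset.sum_add_distrib]
    congr 1
    · refine Finset.sum_congr rfl fun p hp => ?_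
      have hpm : p ≤ m := by simpa [Nat.lt_succ_iff] using hp
      obtain ⟨k, rfl⟩ := Nat.exists_eq_add_of_le hpm
      simp only [hG, hL]
      rw [show p + k + 1 - p = k + 1 by omega, show p + k - p = k by omega]
      set y : A := h + ((-(j : ℤ) - 1 - 2 * p : ℤ) : A) with hy
      have y1 : h + ((-(j : ℤ) - 2 * p : ℤ) : A) = y + 1 := by
        rw [hy]; push_cast; abel
      have y2 : h - ((j + p : ℕ) : A) = y + 1 + p := by
        rw [hy]; push_cast; noncomm_ring
      rw [y1, y2, binom_pascal]
      have b1 := binom_succ y k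
      have b2 : (y + 1 + p) * binom y k = binom y k * (y - k) + ((k : ℂ) + 1 + p) • binom y k := by
        have c1 : Commute (y + 1 + p : A) (binom y k) :=
          commute_binom _ _ (((Commute.refl y).add_left (Commute.one_left y)).add_left
            (Nat.cast_commute p y)) k
        rw [c1.eq, add_smul, add_smul, one_smul, Nat.cast_smul_eq_nsmul, Nat.cast_smul_eq_nsmul,
          nsmul_eq_mul', nsmul_eq_mul']
        noncomm_ring
      have b3 : (p : ℂ) • binom y (k + 1) + (y + 1 + p) * binom y k =
          (((p + k : ℕ) : ℂ) + 1) • (binom y (k + 1) + binom y k) := by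
        rw [b2, ← b1]
        push_cast
        module
      rw [← smul_mul_assoc, ← mul_smul_comm, ← add_mul, ← mul_add, b3, mul_smul_comm,
        smul_mul_assoc]
    · simp only [hG]
      simp [binom_zero]

theorem binom_shift_mem {S : Subring A} {x : A} {m : ℕ} (hx : ∀ k ≤ m, binom x k ∈ S) (r : ℤ) :
    ∀ k ≤ m, binom (x + (r : A)) k ∈ S := by
  induction r using Int.induction_on with
  | zero => simpa using hx
  | succ r ih =>
    intro k hk
    cases k with
    | zero => rw [binom_zero]; exact S.one_mem
    | succ k =>
      have : x + ((r + 1 : ℤ) : A) = x + ((r : ℤ) : A) + 1 := by push_cast; abel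
      rw [this, binom_pascal]
      exact S.add_mem (ih _ hk) (ih _ (by omega))
  | pred r ih =>
    intro k
    induction k with
    | zero => intro _; rw [binom_zero]; exact S.one_mem
    | succ k ihk =>
      intro hk
      have h1 : x + ((-(r : ℤ) : ℤ) : A) = x + ((-(r : ℤ) - 1 : ℤ) : A) + 1 := by
        push_cast; abel
      have h2 := ih (k + 1) hk
      rw [h1, binom_pascal] at h2
      simpa using S.sub_mem h2 (ihk (by omega))

theorem binom_mem {S : Subring A} {e f h : A} (hef : e * f = f * e + h)
    (hhf : h * f = f * (h - 2)) (hhe : e * h = (h - 2) * e)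
    (he : ∀ m, divPow e m ∈ S) (hf : ∀ m, divPow f m ∈ S) (m : ℕ) : binom h m ∈ S := by
  induction m using Nat.strong_induction_on with
  | _ m ih =>
    cases m with
    | zero => rw [binom_zero]; exact S.one_mem
    | succ m =>
      have key := divPow_mul_divPow hef hhf hhe (m + 1) 0
      rw [Finset.sum_range_succ'] at key
      have hs : ∑ p ∈ Finset.range (m + 1), divPow f (0 + (p + 1)) *
          binom (h + ((-((0 : ℕ) : ℤ) - 2 * ((p + 1 : ℕ) : ℤ) : ℤ) : A)) (m + 1 - (p + 1)) *
          divPow e (p + 1) ∈ S := by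
        refine S.sum_mem fun p hp => S.mul_mem (S.mul_mem (hf _) ?_) (he _)
        exact binom_shift_mem (fun k hk => ih k (by omega)) _ _ le_rfl
      have := S.sub_mem (S.mul_mem (he (m + 1)) (hf (m + 1 + 0))) hs
      rw [key] at this
      simpa [divPow_zero] using this

end Binomial

/-- Kostant's form: the subring of the universal enveloping algebra generated by all
`X_α ^ m / m!`, where `α` is a root. -/
def kostant (ℓ : ℕ) : Subring (UC ℓ) :=
  Subring.closure
    {x | ∃ (a b : Fin (ℓ + 1)) (h : a ≠ b) (m : ℕ), x = divPow (unitE a b h) m}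

theorem divPow_mem_kostant {ℓ : ℕ} (a b : Fin (ℓ + 1)) (h : a ≠ b) (m : ℕ) :
    divPow (unitE a b h) m ∈ kostant ℓ :=
  Subring.subset_closure ⟨a, b, h, m, rfl⟩

section Relations

attribute [local instance] LieRing.ofAssociativeRing

theorem iota_mul {ℓ : ℕ} (x y z : LieAlgebra.SpecialLinear.sl (Fin (ℓ + 1)) ℂ)
    (h : x.val * y.val - y.val * x.val = z.val) :
    UniversalEnvelopingAlgebra.ι ℂ x * UniversalEnvelopingAlgebra.ι ℂ y =
      UniversalEnvelopingAlgebra.ι ℂ y * UniversalEnvelopingAlgebra.ι ℂ x +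
        UniversalEnvelopingAlgebra.ι ℂ z := by
  have hz : z = ⁅x, y⁆ := by
    ext1; rw [LieAlgebra.SpecialLinear.sl_bracket, h]
  rw [hz, LieHom.map_lie, Ring.lie_def]
  abel

end Relations

theorem binom_mem_kostant {ℓ : ℕ} (l : Fin ℓ) (r : ℤ) (m : ℕ) :
    binom (cartanH l + (r : UC ℓ)) m ∈ kostant ℓ := by
  have hne : l.castSucc ≠ l.succ := Fin.castSucc_lt_succ.ne
  have h1 : unitE l.castSucc l.succ hne * unitE l.succ l.castSucc hne.symm =
      unitE l.succ l.castSucc hne.symm * unitE l.castSucc l.succ hne + cartanH l := by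
    apply iota_mul
    simp
  have h2 : cartanH l * unitE l.succ l.castSucc hne.symm =
      unitE l.succ l.castSucc hne.symm * (cartanH l - 2) := by
    have := iota_mul (LieAlgebra.SpecialLinear.singleSubSingle l.castSucc l.succ (1 : ℂ))
      (LieAlgebra.SpecialLinear.single l.succ l.castSucc hne.symm (1 : ℂ))
      ((-2 : ℤ) • LieAlgebra.SpecialLinear.single l.succ l.castSucc hne.symm (1 : ℂ))
      (by simp [sub_mul, mul_sub, hne, neg_smul, two_smul]; abel)
    rw [map_zsmul] at this
    rw [cartanH, unitE, this]
    noncomm_ring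
  have h3 : unitE l.castSucc l.succ hne * cartanH l =
      (cartanH l - 2) * unitE l.castSucc l.succ hne := by
    have := iota_mul (LieAlgebra.SpecialLinear.single l.castSucc l.succ hne (1 : ℂ))
      (LieAlgebra.SpecialLinear.singleSubSingle l.castSucc l.succ (1 : ℂ))
      ((-2 : ℤ) • LieAlgebra.SpecialLinear.single l.castSucc l.succ hne (1 : ℂ))
      (by simp [sub_mul, mul_sub, hne.symm, neg_smul, two_smul]; abel)
    rw [map_zsmul] at this
    rw [cartanH, unitE, this]
    noncomm_ring
  exact binom_shift_mem (fun k _ => binom_mem h1 h2 h3 (divPow_mem_kostant _ _ _)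
    (divPow_mem_kostant _ _ _) k) r m le_rfl

section Hyperalgebra

variable (K : Type*) [Field K]

/-- The hyperalgebra `𝒰 = K ⊗ 𝒰_ℤ` of type `A_ℓ`. -/
abbrev Hyper (ℓ : ℕ) : Type _ := K ⊗[ℤ] (kostant ℓ)

variable {ℓ : ℕ}

/-- The divided power `E_{a,b}^{(m)}` in the hyperalgebra; it is used for `a ≠ b` only. -/
def Ediv (a b : Fin (ℓ + 1)) (m : ℕ) : Hyper K ℓ :=
  if h : a ≠ b then 1 ⊗ₜ[ℤ] ⟨divPow (unitE a b h) m, divPow_mem_kostant a b h m⟩ else 0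

/-- The element `binom (H_{α_l} + r) m ⊗ 1` of the hyperalgebra; for `r = 0` this is
`H_{α_l, m}`. -/
def Hbin (l : Fin ℓ) (r : ℤ) (m : ℕ) : Hyper K ℓ :=
  1 ⊗ₜ[ℤ] ⟨binom (cartanH l + (r : UC ℓ)) m, binom_mem_kostant l r m⟩

/-- `F^{(N)}`: the product of the `E_{d,c}^{(N_{c,d})}` over `c < d`, ordered by increasing `d` and,
for equal `d`, by increasing `c`. Only the entries of `N` above the diagonal matter. -/
def negMon (N : Matrix (Fin (ℓ + 1)) (Fin (ℓ + 1)) ℕ) : Hyper K ℓ :=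
  ((List.finRange (ℓ + 1)).flatMap fun d =>
    ((List.finRange (ℓ + 1)).filter (fun c => c < d)).map fun c => Ediv K d c (N c d)).prod

/-- The product over all `l` of `binom (H_{α_l} + δ_l) m_l ⊗ 1`. -/
def cartMon (δ : Fin ℓ → ℤ) (m : Fin ℓ → ℕ) : Hyper K ℓ :=
  ((List.finRange ℓ).map fun l => Hbin K l (δ l) (m l)).prod

variable (ℓ) in
/-- The subspace `𝒰^{-,0}`: the span of the basis elements with trivial positive part. -/
def Um0 : Submodule K (Hyper K ℓ) :=
  Submodule.span K
    {x | ∃ (N : Matrix (Fin (ℓ + 1)) (Fin (ℓ + 1)) ℕ) (m : Fin ℓ → ℕ),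
      x = negMon K N * cartMon K 0 m}

theorem mem_Um0 (N : Matrix (Fin (ℓ + 1)) (Fin (ℓ + 1)) ℕ) (m : Fin ℓ → ℕ) :
    negMon K N * cartMon K 0 m ∈ Um0 K ℓ :=
  Submodule.subset_span ⟨N, m, rfl⟩

theorem negMon_mem (N : Matrix (Fin (ℓ + 1)) (Fin (ℓ + 1)) ℕ) : negMon K N ∈ Um0 K ℓ := by
  have h : cartMon K (0 : Fin ℓ → ℤ) 0 = 1 := by
    refine List.prod_eq_one fun x hx => ?_
    obtain ⟨l, -, rfl⟩ := List.mem_map.1 hx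
    simp only [Hbin, Pi.zero_apply, binom_zero]
    rfl
  simpa [h] using mem_Um0 K N 0

variable (ℓ) in
/-- The left ideal of the hyperalgebra generated by all `X_{β,k}` with `β > 0` and `k > 0`. -/
def posIdeal : Ideal (Hyper K ℓ) :=
  Ideal.span {x | ∃ (a b : Fin (ℓ + 1)) (k : ℕ), a < b ∧ 0 < k ∧ x = Ediv K a b k}

/-- The twisting operator `θ_δ` on `𝒰^{-,0}`, where `δ l` is the value of the weight `δ` at
`H_{α_l}`: the unique `K`-linear map with the given values on the basis. -/
def theta (δ : Fin ℓ → ℤ) : Module.End K (Um0 K ℓ) :=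
  Classical.epsilon fun f => ∀ (N : Matrix (Fin (ℓ + 1)) (Fin (ℓ + 1)) ℕ) (m : Fin ℓ → ℕ),
    (f ⟨negMon K N * cartMon K 0 m, mem_Um0 K N m⟩ : Hyper K ℓ) = negMon K N * cartMon K δ m

/-- The operator `η_{α,m}` on `𝒰^{-,0}` for the positive root `α` of the position `(a, b)`: the
unique `K`-linear map that sends `F` to the element `P` of `𝒰^{-,0}` with `X_{α,m} F = P + E`, where
`E` is in the left ideal generated by the elements `X_{β,k}` with `β > 0` and `k > 0`. -/
def eta (a b : Fin (ℓ + 1)) (m : ℕ) : Module.End K (Um0 K ℓ) :=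
  Classical.epsilon fun f => ∀ F : Um0 K ℓ,
    Ediv K a b m * (F : Hyper K ℓ) - (f F : Hyper K ℓ) ∈ posIdeal K ℓ

/-- The right-normed commutator `[η_{i₁}, …, η_{i_k}, θ_{ω_i}]` for a word `w = i₁ … i_k`, where
`η_l = η_{α_l,1}`, `[x, y] = x y - y x` and `ω_i` is the fundamental weight. -/
def bracket (i : Fin ℓ) (w : List (Fin ℓ)) : Module.End K (Um0 K ℓ) :=
  w.foldr (fun l x => eta K l.castSucc l.succ 1 * x - x * eta K l.castSucc l.succ 1)
    (theta K (Pi.single i 1))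

end Hyperalgebra

section Words

variable {ℓ q : ℕ}

/-- `w` is obtained by inserting `u` and `v` into one another, preserving the order in both. -/
inductive IsShuffle {α : Type*} : List α → List α → List α → Prop
  | nil : IsShuffle [] [] []
  | left {u v w : List α} (x : α) : IsShuffle u v w → IsShuffle (x :: u) v (x :: w)
  | right {u v w : List α} (x : α) : IsShuffle u v w → IsShuffle u (x :: v) (x :: w)

/-- The sequence `a, a + 1, …, i - 1` of simple roots. -/
def ascSeq (i : Fin ℓ) (a : Fin (ℓ + 1)) : List (Fin ℓ) :=
  (List.finRange ℓ).filter fun l => a ≤ l.castSucc ∧ l < i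

/-- The sequence `b - 1, b - 2, …, i + 1` of simple roots. -/
def descSeq (i : Fin ℓ) (b : Fin (ℓ + 1)) : List (Fin ℓ) :=
  ((List.finRange ℓ).filter fun l => i < l ∧ l.castSucc < b).reverse

/-- The concatenation `w_q, i, w_{q-1}, i, …, w_1, i`. -/
def fullWord (i : Fin ℓ) (w : Fin q → List (Fin ℓ)) : List (Fin ℓ) :=
  (List.finRange q).reverse.flatMap fun j => w j ++ [i]

/-- The operator `ξ_i(a_1, …, a_q; b_1, …, b_q)`, obtained from the shuffles in which the ascending
part comes first. -/
def xi (K : Type*) [Field K] (i : Fin ℓ) (a b : Fin q → Fin (ℓ + 1)) :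
    Module.End K (Um0 K ℓ) :=
  bracket K i (fullWord i fun j => ascSeq i (a j) ++ descSeq i (b j))

end Words

/-! ## Flows -/

section Flows

variable {V : Type*} [LinearOrder V] {q : ℕ}

/-- The finite set `Γ` of edges is a flow with sources `a_j` and sinks `b_j`: no edge ends at a
source, no edge begins at a sink, and the other vertices are isolated or transit points. -/
structure IsFlow (Γ : Finset (V × V)) (a b : Fin q → V) : Prop where
  lt : ∀ s t, (s, t) ∈ Γ → s < t
  source : ∀ j, (∃! t, (a j, t) ∈ Γ) ∧ ∀ s, (s, a j) ∉ Γ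
  sink : ∀ j, (∃! s, (s, b j) ∈ Γ) ∧ ∀ t, (b j, t) ∉ Γ
  other : ∀ r, r ∉ Set.range a → r ∉ Set.range b →
    ((∀ s, (s, r) ∉ Γ) ∧ ∀ t, (r, t) ∉ Γ) ∨ ((∃! s, (s, r) ∈ Γ) ∧ ∃! t, (r, t) ∈ Γ)

/-- All edges of a flow, on the vertex set `ℤ` for example, lie between the smallest source and the
largest sink. Hence nothing is lost below by taking `Fin (ℓ + 1)` as the vertex set. -/
theorem IsFlow.bounds {Γ : Finset (V × V)} {a b : Fin q → V} (h : IsFlow Γ a b) {lo hi : V}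
    (ha : ∀ j, lo ≤ a j) (hb : ∀ j, b j ≤ hi) {s t : V} (hst : (s, t) ∈ Γ) :
    lo ≤ s ∧ t ≤ hi := by
  constructor
  · obtain ⟨⟨s₀, t₀⟩, h₀, hmin⟩ := Γ.exists_min_image Prod.fst ⟨_, hst⟩
    refine le_trans ?_ (hmin _ hst)
    by_cases h1 : s₀ ∈ Set.range a
    · obtain ⟨j, rfl⟩ := h1; exact ha j
    by_cases h2 : s₀ ∈ Set.range b
    · obtain ⟨j, rfl⟩ := h2; exact absurd h₀ ((h.sink j).2 _)
    rcases h.other s₀ h1 h2 with h3 | ⟨⟨s', hs', -⟩, -⟩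
    · exact absurd h₀ (h3.2 _)
    · exact absurd (hmin _ hs') (not_le.2 (h.lt _ _ hs'))
  · obtain ⟨⟨s₀, t₀⟩, h₀, hmax⟩ := Γ.exists_max_image Prod.snd ⟨_, hst⟩
    refine le_trans (hmax _ hst) ?_
    by_cases h2 : t₀ ∈ Set.range b
    · obtain ⟨j, rfl⟩ := h2; exact hb j
    by_cases h1 : t₀ ∈ Set.range a
    · obtain ⟨j, rfl⟩ := h1; exact absurd h₀ ((h.source j).2 _)
    rcases h.other t₀ h1 h2 with h3 | ⟨-, ⟨t', ht', -⟩⟩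
    · exact absurd h₀ (h3.1 _)
    · exact absurd (hmax _ ht') (not_le.2 (h.lt _ _ ht'))

/-- `r` is a transit point of the flow `Γ` with sources `a_j` and sinks `b_j`. -/
def IsTransit (Γ : Finset (V × V)) (a b : Fin q → V) (r : V) : Prop :=
  r ∉ Set.range a ∧ r ∉ Set.range b ∧ (∃! s, (s, r) ∈ Γ) ∧ ∃! t, (r, t) ∈ Γ

/-- `u` and `v` lie in the same connected component of `Γ`. -/
def Linked (Γ : Finset (V × V)) (u v : V) : Prop :=
  Relation.EqvGen (fun s t => (s, t) ∈ Γ) u v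

/-- The linking permutation of a flow: `a_j` and `b_{σ(j)}` are linked for all `j`. -/
def linkPerm (Γ : Finset (V × V)) (a b : Fin q → V) : Equiv.Perm (Fin q) :=
  Classical.epsilon fun σ => ∀ j, Linked Γ (a j) (b (σ j))

/-- The order on the flows with given sources and sinks: list the edges of both flows by decreasing
ends; at the first place where the lists differ, where the ends are equal to `t`, the beginning in
`Γ` is greater than that in `Γ'`. -/
def FlowLT (Γ Γ' : Finset (V × V)) : Prop :=
  ∃ s s' t, (s, t) ∈ Γ ∧ (s', t) ∈ Γ' ∧ s' < s ∧ ∀ u v, t < v → ((u, v) ∈ Γ ↔ (u, v) ∈ Γ')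

variable {ℓ : ℕ}

open Classical in
/-- The set `ℱ_i(a_1, …, a_q; b_1, …, b_q)` of the flows with sources `a_j` and sinks `b_j` that have
no transit point greater than `i`. -/
def flows (i : Fin ℓ) (a b : Fin q → Fin (ℓ + 1)) :
    Finset (Finset (Fin (ℓ + 1) × Fin (ℓ + 1))) :=
  Finset.univ.filter fun Γ => IsFlow Γ a b ∧ ∀ r, i.castSucc < r → ¬ IsTransit Γ a b r

open Classical in
/-- The `i`-sign of a flow. -/
def sgn (i : Fin ℓ) (a b : Fin q → Fin (ℓ + 1)) (Γ : Finset (Fin (ℓ + 1) × Fin (ℓ + 1))) : ℤˣ :=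
  Equiv.Perm.sign (linkPerm Γ a b) *
    (-1) ^ ((∑ j, (((b j : ℕ) : ℤ) - ((i : ℕ) : ℤ))) +
      ((Finset.univ.filter fun r => IsTransit Γ a b r).card : ℤ))

end Flows

/-! ## Tableaux -/

section Tableaux

variable {ℓ : ℕ}

/-- Regular row standard `λ`-tableaux: the entries weakly increase along the rows, and every entry
of row `r` is at least `r`. -/
@[ext]
structure RegTab (lam : Fin (ℓ + 1) → ℕ) where
  entry : ∀ r, Fin (lam r) → Fin (ℓ + 1)
  mono : ∀ r, Monotone (entry r)
  reg : ∀ r j, r ≤ entry r j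

variable {lam : Fin (ℓ + 1) → ℕ}

/-- The matrix whose `(r, c)`-entry, `r < c`, is the number of entries `c` in row `r`. -/
def RegTab.mat (T : RegTab lam) : Matrix (Fin (ℓ + 1)) (Fin (ℓ + 1)) ℕ := fun r c =>
  if r < c then (Finset.univ.filter fun j => T.entry r j = c).card else 0

/-- The element `F_T` of `𝒰^-`, as an element of `𝒰^{-,0}`. -/
def FTab (K : Type*) [Field K] (T : RegTab lam) : Um0 K ℓ :=
  ⟨negMon K T.mat, negMon_mem K T.mat⟩

/-- The shape of the tableau that is obtained from `T` by removing all nodes with entry greater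
than `m`. -/
def RegTab.shape (T : RegTab lam) (m : Fin (ℓ + 1)) : Fin (ℓ + 1) → ℕ := fun r =>
  (Finset.univ.filter fun j => T.entry r j ≤ m).card

/-- The dominance order on compositions. -/
def DomLE (x y : Fin (ℓ + 1) → ℕ) : Prop :=
  ∀ k, ∑ r ∈ Finset.Iic k, x r ≤ ∑ r ∈ Finset.Iic k, y r

/-- The strict order on tableaux: the antilexicographic order, with the dominance order on
components, of the sequences of the shapes of `T[m]`. -/
def RegTab.LT (T S : RegTab lam) : Prop :=
  ∃ m, (DomLE (T.shape m) (S.shape m) ∧ T.shape m ≠ S.shape m) ∧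
    ∀ m', m < m' → T.shape m' = S.shape m'

/-- `T` is a minimal element of `X`. -/
def IsMinimal (X : Finset (RegTab lam)) (T : RegTab lam) : Prop :=
  T ∈ X ∧ ∀ S ∈ X, ¬ S.LT T

/-- `σ_{Γ,i}(T)` is well-defined: for every edge `(s, t)` of `Γ`, row `s` of `T` contains `t`. -/
def SigmaDefined (T : RegTab lam) (Γ : Finset (Fin (ℓ + 1) × Fin (ℓ + 1))) : Prop :=
  ∀ e ∈ Γ, ∃ j, T.entry e.1 j = e.2

instance (T : RegTab lam) (Γ : Finset (Fin (ℓ + 1) × Fin (ℓ + 1))) :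
    Decidable (SigmaDefined T Γ) := by
  unfold SigmaDefined; infer_instance

/-- The shape `(λ_1, …, λ_i, λ_{i+1} + 1, …, λ_n + 1)`. -/
def newShape (i : Fin ℓ) (lam : Fin (ℓ + 1) → ℕ) : Fin (ℓ + 1) → ℕ := fun r =>
  lam r + if i.castSucc < r then 1 else 0

/-- The multiset of the entries of row `r`. -/
def RegTab.row (T : RegTab lam) (r : Fin (ℓ + 1)) : Multiset (Fin (ℓ + 1)) :=
  Finset.univ.val.map (T.entry r)

/-- The ends of the edges of `Γ` that begin at `r`. -/
def ends (Γ : Finset (Fin (ℓ + 1) × Fin (ℓ + 1))) (r : Fin (ℓ + 1)) : Finset (Fin (ℓ + 1)) :=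
  Finset.univ.filter fun t => (r, t) ∈ Γ

/-- Row `r` of `σ_{Γ,i}(T)` as a multiset: for every edge `(r, t)` of `Γ` one entry `t` is replaced
with `r`, and one entry `r` is added if `r > i`. -/
def sigmaRow (i : Fin ℓ) (T : RegTab lam) (Γ : Finset (Fin (ℓ + 1) × Fin (ℓ + 1)))
    (r : Fin (ℓ + 1)) : Multiset (Fin (ℓ + 1)) :=
  T.row r - (ends Γ r).val + Multiset.replicate (ends Γ r).card r +
    (if i.castSucc < r then {r} else 0)

theorem card_sigmaRow (i : Fin ℓ) (T : RegTab lam) (Γ : Finset (Fin (ℓ + 1) × Fin (ℓ + 1)))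
    (h : SigmaDefined T Γ) (r : Fin (ℓ + 1)) : (sigmaRow i T Γ r).card = newShape i lam r := by
  have hle : (ends Γ r).val ≤ T.row r := by
    rw [Multiset.le_iff_subset (ends Γ r).nodup]
    intro t ht
    obtain ⟨j, hj⟩ := h (r, t) (by simpa [ends] using ht)
    exact Multiset.mem_map.2 ⟨j, Finset.mem_univ j, hj⟩
  have hc := Multiset.card_le_card hle
  have hr : (T.row r).card = lam r := by simp [RegTab.row]
  rw [Finset.card_val] at hc
  rw [sigmaRow, Multiset.card_add, Multiset.card_add, Multiset.card_sub hle,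
    Multiset.card_replicate, Finset.card_val, hr, newShape]
  rw [hr] at hc
  split_ifs <;> simp <;> omega

theorem le_of_mem_sigmaRow (i : Fin ℓ) (T : RegTab lam)
    (Γ : Finset (Fin (ℓ + 1) × Fin (ℓ + 1))) (r x : Fin (ℓ + 1)) (hx : x ∈ sigmaRow i T Γ r) :
    r ≤ x := by
  rw [sigmaRow, Multiset.mem_add, Multiset.mem_add] at hx
  rcases hx with (hx | hx) | hx
  · obtain ⟨j, -, rfl⟩ := Multiset.mem_map.1 (Multiset.mem_of_le (Multiset.sub_le_self _ _) hx)
    exact T.reg r j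
  · exact (Multiset.eq_of_mem_replicate hx).ge
  · split_ifs at hx
    · exact (Multiset.mem_singleton.1 hx).ge
    · simp at hx

/-- The tableau `σ_{Γ,i}(T)`: its rows are the sorted rows described by `sigmaRow`. -/
def sigma (i : Fin ℓ) (T : RegTab lam) (Γ : Finset (Fin (ℓ + 1) × Fin (ℓ + 1)))
    (h : SigmaDefined T Γ) : RegTab (newShape i lam) where
  entry r j := ((sigmaRow i T Γ r).sort (· ≤ ·)).get
    (j.cast (((sigmaRow i T Γ r).length_sort (r := (· ≤ ·))).trans (card_sigmaRow i T Γ h r)).symm)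
  mono r _ _ hj := (Multiset.pairwise_sort (sigmaRow i T Γ r) (· ≤ ·)).rel_get_of_le hj
  reg r _ := le_of_mem_sigmaRow i T Γ r _ ((Multiset.mem_sort _).1 (List.get_mem _ _))

end Tableaux

end

end TypeA

/-!
The proof turns the iterated commutators of the operators `η_l` with `θ_{ω_i}` into polynomials in
commuting operators that lower exponents, recognizes these polynomials as minors of a generic
unitriangular matrix, and reads off the flows from the Leibniz formula.

**The operators are well defined.** The enveloping algebra acts on the polynomial functions of a
matrix by right translations (`rep`), and Kostant's form preserves the functions with integral
coefficients. Hence every integral function `f` gives a functional `u ↦ (u f)(1)` on the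
hyperalgebra over `K` (`coeffK`). If `f` is a product of the minors with the first columns, then `f`
is annihilated by the positive root vectors, so the functional kills the left ideal generated by
the positive part; on a basis element of `𝒰^{-,0}` it picks out the exponent of the negative part
and a product of binomial coefficients of the weight of `f` (`coeffK_minorProd`). The weight can be
increased freely, so the basis elements are linearly independent even modulo that left ideal
(`linearCombination_basisElt_eq_zero`). This yields the characterizations of `θ_{ω_i}` and `η_l`
(`theta_spec`, `eta_spec`, `eta_eq_of_mem`).

**Commutators are polynomials.** On the space `NegSpace` with basis the exponents of the monomials
`F^{(N)}`, let `lower p` decrease the exponent at `p` by one, and let `raise p` be the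
multiplication of divided powers by the variable at `p`. Moving `E_{l,l+1}` to the right past a
monomial (`Ediv_mul_toHyper`) expresses `η_l` by these operators and by the multiplication by `H_l`
on the Cartan part. The only effect of `θ_{ω_i}` on the latter is the shift of `H_i` by one, so an
iterated commutator acts on the negative part by a polynomial `wordPoly` in the operators `lower p`
(`bracket_apply`). A further commutator with `η_l` replaces a polynomial `y` with `etaDer l y`, where
`etaDer l` is a derivation, and, if `l = i`, subtracts the product of `y` and the variable at
`(i, i + 1)`.

**The polynomials are minors.** Let `U` be the upper unitriangular matrix of the variables. The
derivation `etaDer l` acts on `U` by a row operation and by replacing column `l` with `-1` times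
column `l + 1` and the other columns with zero. In a minor with the rows up to `i`, the row
operation contributes its trace, which is compensated exactly by the subtracted product. So every
letter `l` of the word replaces a column `l` of the minor with `l + 1` and changes the sign
(`etaDer_colMinor`), and a block `w_j, i` replaces the column `a_j` with `b_j`, whatever the shuffle
`w_j` is (`wordPoly_block`, `wordPoly_fullWord`). The inequalities between the `a_j` and between the
`b_j` ensure that at each moment only one column can be moved.

**Minors are sums over flows.** A permutation with a nonzero term in the Leibniz formula of this
minor is the same as a flow without transit points greater than `i`; the term is the product of the
variables of its edges. The linking permutation of the flow is the permutation induced by first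
returns to the sources, and every transit point that is left out changes the sign
(`exists_perm_firstReturn`, `sgn_permEdges`, `sum_flows_eq_colMinor`). The product of the lowering
operators over the edges of `Γ` sends `F_T` to `F_{σ_Γ(T)}` if this tableau is well-defined, and to
zero otherwise, which is the formula for `ξ_i(a; b)(F_T)` (`bracket_fullWord_FTab`).

**Minimal elements.** If `Γ < Γ'`, and the first difference is in the edges that end at `t`, then
the shapes of the truncations of `σ_Γ(T)` and `σ_{Γ'}(S)` at `m ≥ t` differ from those of `T` and `S`
in the same way, whereas at `m = t - 1` the flow `Γ` adds a node to a lower row than `Γ'` does. So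
`σ_{Γ'}(S) ≤ σ_Γ(T)` implies `S < T` (`RegTab.lt_of_sigma_le_of_flowLT`). For minimal `T` and `Γ` it
follows that `σ_Γ(T)` is produced by the pair `(T, Γ)` only, and that no other tableau in the sum is
smaller (`eq_of_sigma_le`, `exists_isMinimal_of_sum`).
-/

open scoped TensorProduct

namespace TypeA

noncomputable section

/-! ### Derivations and determinants -/

theorem derivation_prod {R S ι : Type*} [CommRing R] [CommRing S] [Algebra R S] [DecidableEq ι]
    (D : Derivation R S S) (s : Finset ι) (f : ι → S) :
    D (∏ i ∈ s, f i) = ∑ i ∈ s, (∏ j ∈ s.erase i, f j) * D (f i) := by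
  induction s using Finset.induction_on with
  | empty => simp
  | insert a s ha ih =>
    rw [Finset.prod_insert ha, D.leibniz, ih, Finset.sum_insert ha, Finset.erase_insert ha,
      add_comm (f a • _), smul_eq_mul, smul_eq_mul, Finset.mul_sum]
    congr 1
    refine Finset.sum_congr rfl fun i hi => ?_
    have hne : a ≠ i := fun h => ha (h ▸ hi)
    rw [Finset.erase_insert_of_ne hne, Finset.prod_insert (fun h => ha (Finset.mem_of_mem_erase h)),
      mul_assoc]

/-- Jacobi's formula for the derivative of a determinant. -/
theorem derivation_det {R S n : Type*} [CommRing R] [CommRing S] [Algebra R S] [Fintype n]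
    [DecidableEq n] (D : Derivation R S S) (M : Matrix n n S) :
    D M.det = (M.adjugate * M.map D).trace := by
  have h : ∀ j, (M.adjugate * M.map D) j j = (M.updateCol j fun r => D (M r j)).det := by
    intro j
    rw [← Matrix.cramer_apply, Matrix.cramer_eq_adjugate_mulVec, Matrix.mul_apply, Matrix.mulVec,
      dotProduct]
    rfl
  rw [Matrix.trace]
  simp only [Matrix.diag_apply, h]
  simp only [Matrix.det_apply', map_sum]
  rw [Finset.sum_comm]
  refine Finset.sum_congr rfl fun σ _ => ?_
  rw [D.leibniz, Derivation.map_intCast, smul_zero, add_zero, derivation_prod, smul_eq_mul,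
    Finset.mul_sum]
  refine Finset.sum_congr rfl fun j _ => ?_
  congr 1
  rw [← Finset.mul_prod_erase Finset.univ _ (Finset.mem_univ j), Matrix.updateCol_self, mul_comm]
  congr 1
  refine Finset.prod_congr rfl fun k hk => ?_
  rw [Matrix.updateCol_ne (Finset.ne_of_mem_erase hk)]

/-! ### The regular representation on functions of a matrix -/

/-- The divided powers of a derivation satisfy the divided Leibniz rule. -/
theorem divPow_derivation_mul {S : Type*} [CommRing S] [Algebra ℂ S] (D : Derivation ℂ S S)
    (m : ℕ) (f g : S) :
    divPow (A := Module.End ℂ S) D m (f * g) = ∑ p ∈ Finset.HasAntidiagonal.antidiagonal m,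
      divPow (A := Module.End ℂ S) D p.1 f * divPow (A := Module.End ℂ S) D p.2 g := by
  induction m with
  | zero => simp [divPow_zero]
  | succ m ih =>
    have h0 : ((m : ℂ) + 1) ≠ 0 := by exact_mod_cast m.succ_ne_zero
    have hrec : ∀ (k : ℕ) (x : S), ((k : ℂ) + 1) • divPow (A := Module.End ℂ S) D (k + 1) x =
        D (divPow (A := Module.End ℂ S) D k x) := fun k x => by
      rw [← LinearMap.smul_apply, divPow_succ]; rfl
    refine smul_right_injective S h0 ?_
    show ((m : ℂ) + 1) • _ = ((m : ℂ) + 1) • _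
    rw [hrec, ih, map_sum]
    have e : ∀ p ∈ Finset.HasAntidiagonal.antidiagonal (m + 1), ((m : ℂ) + 1) •
        (divPow (A := Module.End ℂ S) D p.1 f * divPow (A := Module.End ℂ S) D p.2 g) =
        ((p.1 : ℂ) • divPow (A := Module.End ℂ S) D p.1 f) *
          divPow (A := Module.End ℂ S) D p.2 g +
        divPow (A := Module.End ℂ S) D p.1 f *
          ((p.2 : ℂ) • divPow (A := Module.End ℂ S) D p.2 g) := by
      intro p hp
      have : (m : ℂ) + 1 = p.1 + p.2 := by
        rw [Finset.HasAntidiagonal.mem_antidiagonal] at hp; exact_mod_cast hp.symm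
      rw [this, add_smul, smul_mul_assoc, mul_smul_comm]
    rw [Finset.smul_sum, Finset.sum_congr rfl e, Finset.sum_add_distrib,
      Finset.Nat.sum_antidiagonal_succ]
    rw [Finset.Nat.sum_antidiagonal_succ' (f := fun p : ℕ × ℕ =>
      divPow (A := Module.End ℂ S) D p.1 f *
        ((p.2 : ℂ) • divPow (A := Module.End ℂ S) D p.2 g))]
    simp only [Nat.cast_zero, zero_smul, zero_mul, mul_zero, zero_add, Nat.cast_add,
      Nat.cast_one, hrec]
    rw [← Finset.sum_add_distrib]
    refine Finset.sum_congr rfl fun p _ => ?_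
    rw [D.leibniz, smul_eq_mul, smul_eq_mul, add_comm, mul_comm (D _)]

/-- The polynomial functions of a matrix of size `ℓ + 1`; the variable `(k, s)` is its entry in
row `k` and column `s`. -/
abbrev MatFun (ℓ : ℕ) : Type := MvPolynomial (Fin (ℓ + 1) × Fin (ℓ + 1)) ℂ

/-- The derivative of the action of `GL` on functions of a matrix `x` by `x ↦ x g`: the derivation
that sends the generic matrix `x` to `x A`. -/
def colDer {ℓ : ℕ} (A : Matrix (Fin (ℓ + 1)) (Fin (ℓ + 1)) ℂ) :
    Derivation ℂ (MatFun ℓ) (MatFun ℓ) :=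
  MvPolynomial.mkDerivation ℂ fun p => ∑ r, A r p.2 • MvPolynomial.X (p.1, r)

theorem colDer_X {ℓ : ℕ} (A : Matrix (Fin (ℓ + 1)) (Fin (ℓ + 1)) ℂ) (k s : Fin (ℓ + 1)) :
    colDer A (MvPolynomial.X (k, s)) = ∑ r, A r s • MvPolynomial.X (k, r) :=
  MvPolynomial.mkDerivation_X _ _ _

theorem colDer_commutator {ℓ : ℕ} (A B : Matrix (Fin (ℓ + 1)) (Fin (ℓ + 1)) ℂ) (f : MatFun ℓ) :
    colDer (A * B - B * A) f = colDer A (colDer B f) - colDer B (colDer A f) := by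
  have h : colDer (A * B - B * A) = ⁅colDer A, colDer B⁆ := by
    refine MvPolynomial.derivation_ext fun p => ?_
    obtain ⟨k, s⟩ := p
    have key : ∀ A B : Matrix (Fin (ℓ + 1)) (Fin (ℓ + 1)) ℂ,
        colDer A (colDer B (MvPolynomial.X (k, s))) =
          ∑ r, (A * B) r s • (MvPolynomial.X (k, r) : MatFun ℓ) := by
      intro A B
      rw [colDer_X, map_sum]
      simp only [Derivation.map_smul, colDer_X, Finset.smul_sum, smul_smul, Matrix.mul_apply,
        Finset.sum_smul]
      rw [Finset.sum_comm]
      simp only [mul_comm]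
    rw [Derivation.commutator_apply, key, key, colDer_X, ← Finset.sum_sub_distrib]
    simp only [Matrix.sub_apply, sub_smul]
  rw [h, Derivation.commutator_apply]

attribute [local instance] LieRing.ofAssociativeRing

/-- `colDer` as a representation of `sl`. -/
def repLie (ℓ : ℕ) :
    LieAlgebra.SpecialLinear.sl (Fin (ℓ + 1)) ℂ →ₗ⁅ℂ⁆ Module.End ℂ (MatFun ℓ) where
  toFun A := (colDer A.val : MatFun ℓ →ₗ[ℂ] MatFun ℓ)
  map_add' A B := by
    have : colDer (A.val + B.val) = colDer A.val + colDer B.val := by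
      refine MvPolynomial.derivation_ext fun p => ?_
      rw [Derivation.add_apply, colDer_X, colDer_X, colDer_X, ← Finset.sum_add_distrib]
      simp only [Matrix.add_apply, add_smul]
    exact LinearMap.ext fun f => congrArg (· f) (congrArg DFunLike.coe this)
  map_smul' c A := by
    have : colDer (c • A.val) = c • colDer A.val := by
      refine MvPolynomial.derivation_ext fun p => ?_
      rw [Derivation.smul_apply, colDer_X, colDer_X, Finset.smul_sum]
      simp only [Matrix.smul_apply, smul_smul, smul_eq_mul]
    exact LinearMap.ext fun f => congrArg (· f) (congrArg DFunLike.coe this)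
  map_lie' {A B} := by
    refine LinearMap.ext fun f => ?_
    rw [Ring.lie_def, LinearMap.sub_apply]
    exact (congrArg (colDer · f) (LieAlgebra.SpecialLinear.sl_bracket _ _ A B)).trans
      (colDer_commutator A.val B.val f)

theorem repLie_apply {ℓ : ℕ} (A : LieAlgebra.SpecialLinear.sl (Fin (ℓ + 1)) ℂ) :
    repLie ℓ A = (colDer A.val : MatFun ℓ →ₗ[ℂ] MatFun ℓ) := rfl

/-- The representation of the universal enveloping algebra on functions of a matrix by right
translations. -/
def rep (ℓ : ℕ) : UC ℓ →ₐ[ℂ] Module.End ℂ (MatFun ℓ) :=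
  UniversalEnvelopingAlgebra.lift ℂ (repLie ℓ)

theorem rep_unitE {ℓ : ℕ} (a b : Fin (ℓ + 1)) (h : a ≠ b) :
    rep ℓ (unitE a b h) = (colDer (Matrix.single a b 1) : MatFun ℓ →ₗ[ℂ] MatFun ℓ) := by
  rw [rep, unitE, UniversalEnvelopingAlgebra.lift_ι_apply, repLie_apply,
    LieAlgebra.SpecialLinear.val_single]

theorem rep_cartanH {ℓ : ℕ} (l : Fin ℓ) :
    rep ℓ (cartanH l) = (colDer (Matrix.single l.castSucc l.castSucc 1 -
      Matrix.single l.succ l.succ 1) : MatFun ℓ →ₗ[ℂ] MatFun ℓ) := by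
  rw [rep, cartanH, UniversalEnvelopingAlgebra.lift_ι_apply, repLie_apply,
    LieAlgebra.SpecialLinear.val_singleSubSingle]

theorem map_divPow {A B : Type*} [Ring A] [Algebra ℂ A] [Ring B] [Algebra ℂ B] (f : A →ₐ[ℂ] B)
    (x : A) (m : ℕ) : f (divPow x m) = divPow (f x) m := by
  rw [divPow, divPow, map_smul, map_pow]

/-- The polynomial functions with integral coefficients. -/
def intFun (ℓ : ℕ) : Subring (MatFun ℓ) :=
  (MvPolynomial.map (σ := Fin (ℓ + 1) × Fin (ℓ + 1)) (Int.castRingHom ℂ)).range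

theorem X_mem_intFun {ℓ : ℕ} (p : Fin (ℓ + 1) × Fin (ℓ + 1)) :
    (MvPolynomial.X p : MatFun ℓ) ∈ intFun ℓ :=
  ⟨MvPolynomial.X p, MvPolynomial.map_X _ _⟩

theorem eval_intFun {ℓ : ℕ} (f : MatFun ℓ) (hf : f ∈ intFun ℓ)
    (x : Fin (ℓ + 1) × Fin (ℓ + 1) → ℤ) :
    ∃ z : ℤ, MvPolynomial.eval (fun p => (x p : ℂ)) f = z := by
  obtain ⟨g, rfl⟩ := hf
  refine ⟨MvPolynomial.eval x g, ?_⟩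
  rw [MvPolynomial.eval_map]
  exact (MvPolynomial.eval₂_comp (Int.castRingHom ℂ) x g).symm

theorem colDer_single_X {ℓ : ℕ} (a b k s : Fin (ℓ + 1)) :
    colDer (Matrix.single a b 1) (MvPolynomial.X (k, s)) =
      if b = s then (MvPolynomial.X (k, a) : MatFun ℓ) else 0 := by
  rw [colDer_X]
  by_cases h : b = s
  · subst h
    rw [if_pos rfl, Finset.sum_eq_single a]
    · simp
    · intro r _ hr
      simp [hr.symm]
    · simp
  · rw [if_neg h]
    refine Finset.sum_eq_zero fun r _ => ?_
    simp [h]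

/-- The divided powers of the root vectors preserve the integral form. -/
theorem rep_divPow_mem {ℓ : ℕ} (a b : Fin (ℓ + 1)) (h : a ≠ b) (f : MatFun ℓ)
    (hf : f ∈ intFun ℓ) : ∀ m : ℕ, rep ℓ (divPow (unitE a b h) m) f ∈ intFun ℓ := by
  simp only [map_divPow, rep_unitE]
  set D := colDer (ℓ := ℓ) (Matrix.single a b 1) with hD
  obtain ⟨g, rfl⟩ := hf
  induction g using MvPolynomial.induction_on with
  | C z =>
    intro m
    cases m with
    | zero => rw [divPow_zero]; exact ⟨MvPolynomial.C z, rfl⟩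
    | succ m =>
      have : D (MvPolynomial.map (Int.castRingHom ℂ) (MvPolynomial.C z)) = 0 := by simp
      rw [divPow, pow_succ]
      simp only [LinearMap.smul_apply, Module.End.mul_apply, Derivation.coeFn_coe, this, map_zero,
        smul_zero]
      exact (intFun ℓ).zero_mem
  | add p q hp hq =>
    intro m
    rw [map_add, map_add]
    exact (intFun ℓ).add_mem (hp m) (hq m)
  | mul_X p i hp =>
    intro m
    rw [map_mul, MvPolynomial.map_X, divPow_derivation_mul]
    refine (intFun ℓ).sum_mem fun x _ => (intFun ℓ).mul_mem (hp _) ?_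
    obtain ⟨k, s⟩ := i
    -- the square of the root vector kills the variables
    have h1 : D (MvPolynomial.X (k, s)) =
      if b = s then (MvPolynomial.X (k, a) : MatFun ℓ) else 0 := colDer_single_X a b k s
    have h2 : D (D (MvPolynomial.X (k, s))) = 0 := by
      rw [h1]
      split_ifs
      · rw [hD, colDer_single_X, if_neg h.symm]
      · exact map_zero _
    rcases x.2 with _ | _ | m
    · rw [divPow_zero]; exact X_mem_intFun _
    · have : divPow (A := Module.End ℂ (MatFun ℓ)) D (0 + 1) (MvPolynomial.X (k, s)) =
          D (MvPolynomial.X (k, s)) := by simp [divPow]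
      rw [this, h1]
      split_ifs
      · exact X_mem_intFun _
      · exact (intFun ℓ).zero_mem
    · rw [divPow, pow_succ, pow_succ]
      simp only [LinearMap.smul_apply, Module.End.mul_apply, Derivation.coeFn_coe, h2, map_zero,
        smul_zero]
      exact (intFun ℓ).zero_mem

theorem rep_kostant_mem {ℓ : ℕ} (u : UC ℓ) (hu : u ∈ kostant ℓ) :
    ∀ f ∈ intFun ℓ, rep ℓ u f ∈ intFun ℓ := by
  induction hu using Subring.closure_induction with
  | mem x hx =>
    obtain ⟨a, b, h, m, rfl⟩ := hx
    exact fun f hf => rep_divPow_mem a b h f hf m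
  | zero => intro f _; simp
  | one => intro f hf; simpa using hf
  | add x y _ _ hx hy => intro f hf; rw [map_add]; exact (intFun ℓ).add_mem (hx f hf) (hy f hf)
  | neg x _ hx => intro f hf; rw [map_neg]; exact (intFun ℓ).neg_mem (hx f hf)
  | mul x y _ _ hx hy => intro f hf; rw [map_mul]; exact hx _ (hy f hf)

/-- The value at the identity matrix. -/
def evalOne (ℓ : ℕ) : MatFun ℓ →ₐ[ℂ] ℂ :=
  MvPolynomial.aeval fun p => if p.1 = p.2 then 1 else 0

theorem evalOne_mem {ℓ : ℕ} (f : MatFun ℓ) (hf : f ∈ intFun ℓ) :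
    evalOne ℓ f ∈ (Int.castAddHom ℂ).range := by
  obtain ⟨z, hz⟩ := eval_intFun f hf fun p => if p.1 = p.2 then 1 else 0
  refine ⟨z, ?_⟩
  show (z : ℂ) = _
  rw [← hz, evalOne, MvPolynomial.aeval_def, MvPolynomial.eval,
    MvPolynomial.coe_eval₂Hom]
  congr 1
  ext p
  push_cast
  rfl

/-- The matrix coefficient `u ↦ (u f)(1)` of an integral function `f` on Kostant's form. -/
def coeffZ {ℓ : ℕ} (f : MatFun ℓ) (hf : f ∈ intFun ℓ) : kostant ℓ →+ ℤ :=
  (AddMonoidHom.ofInjective (f := Int.castAddHom ℂ) Int.cast_injective).symm.toAddMonoidHom.comp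
    { toFun := fun u => ⟨evalOne ℓ (rep ℓ u f), evalOne_mem _ (rep_kostant_mem _ u.2 f hf)⟩
      map_zero' := by ext1; simp
      map_add' := fun u v => by ext1; simp }

theorem coe_coeffZ {ℓ : ℕ} (f : MatFun ℓ) (hf : f ∈ intFun ℓ) (u : kostant ℓ) :
    ((coeffZ f hf u : ℤ) : ℂ) = evalOne ℓ (rep ℓ u f) := by
  have := congrArg Subtype.val ((AddMonoidHom.ofInjective (f := Int.castAddHom ℂ)
    Int.cast_injective).apply_symm_apply
      ⟨evalOne ℓ (rep ℓ u f), evalOne_mem _ (rep_kostant_mem _ u.2 f hf)⟩)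
  exact this

/-- The matrix coefficient `u ↦ (u f)(1)` of an integral function `f` on the hyperalgebra. -/
def coeffK (K : Type*) [Field K] {ℓ : ℕ} (f : MatFun ℓ) (hf : f ∈ intFun ℓ) :
    Hyper K ℓ →ₗ[K] K :=
  LinearMap.liftBaseChange K
    (((Int.castAddHom K).comp (coeffZ f hf)).toIntLinearMap)

theorem coeffK_tmul (K : Type*) [Field K] {ℓ : ℕ} (f : MatFun ℓ) (hf : f ∈ intFun ℓ) (k : K)
    (u : kostant ℓ) : coeffK K f hf (k ⊗ₜ u) = k * (coeffZ f hf u : K) := by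
  rw [coeffK, LinearMap.liftBaseChange_tmul]
  rfl

/-- A function that is invariant under upper unipotent matrices gives a functional that kills the
ideal generated by the positive part. -/
theorem coeffK_posIdeal (K : Type*) [Field K] {ℓ : ℕ} (f : MatFun ℓ) (hf : f ∈ intFun ℓ)
    (h : ∀ a b : Fin (ℓ + 1), a < b → colDer (Matrix.single a b 1) f = 0) (u : Hyper K ℓ)
    (hu : u ∈ posIdeal K ℓ) : coeffK K f hf u = 0 := by
  suffices h' : ∀ v, coeffK K f hf (v * u) = 0 by simpa using h' 1
  induction hu using Submodule.span_induction with
  | zero => intro v; rw [mul_zero, map_zero]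
  | add x y _ _ hx hy => intro v; rw [mul_add, map_add, hx, hy, add_zero]
  | smul w x _ hx => intro v; rw [smul_eq_mul, ← mul_assoc, hx]
  | mem x hx =>
    obtain ⟨a, b, k, hab, hk, rfl⟩ := hx
    intro v
    rw [Ediv, dif_pos hab.ne]
    induction v using TensorProduct.induction_on with
    | zero => rw [zero_mul, map_zero]
    | add x y hx hy => rw [add_mul, map_add, hx, hy, add_zero]
    | tmul c w =>
      rw [Algebra.TensorProduct.tmul_mul_tmul, coeffK_tmul]
      have : coeffZ f hf (w * ⟨divPow (unitE a b hab.ne) k, divPow_mem_kostant a b hab.ne k⟩)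
          = 0 := by
        have h0 : ((coeffZ f hf (w * ⟨divPow (unitE a b hab.ne) k,
            divPow_mem_kostant a b hab.ne k⟩) : ℤ) : ℂ) = 0 := by
          obtain ⟨k, rfl⟩ := Nat.exists_eq_succ_of_ne_zero hk.ne'
          rw [coe_coeffZ, Subring.coe_mul, map_mul, Module.End.mul_apply, map_divPow, rep_unitE,
            divPow, pow_succ]
          simp [h a b hab]
        exact_mod_cast h0
      rw [this, Int.cast_zero, mul_zero]

/-! ### Lifting products to Kostant's form -/

section Lift

variable {ℓ : ℕ}

/-- The divided power `E_{a,b}^{(m)}` in Kostant's form, with the value `0` if `a = b`. -/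
def kEdiv (a b : Fin (ℓ + 1)) (m : ℕ) : kostant ℓ :=
  if h : a ≠ b then ⟨divPow (unitE a b h) m, divPow_mem_kostant a b h m⟩ else 0

/-- The element `binom (H_{α_l} + r) m` of Kostant's form. -/
def kHbin (l : Fin ℓ) (r : ℤ) (m : ℕ) : kostant ℓ :=
  ⟨binom (cartanH l + (r : UC ℓ)) m, binom_mem_kostant l r m⟩

variable (K : Type*) [Field K]

/-- The canonical map from Kostant's form to the hyperalgebra. -/
def ofKostant (ℓ : ℕ) : kostant ℓ →+* Hyper K ℓ :=
  (Algebra.TensorProduct.includeRight : kostant ℓ →ₐ[ℤ] Hyper K ℓ).toRingHom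

theorem ofKostant_apply (u : kostant ℓ) : ofKostant K ℓ u = 1 ⊗ₜ u := rfl

theorem Ediv_eq_ofKostant (a b : Fin (ℓ + 1)) (m : ℕ) :
    Ediv K a b m = ofKostant K ℓ (kEdiv a b m) := by
  rw [Ediv, kEdiv]
  split_ifs with h
  · rfl
  · rw [map_zero]

theorem Hbin_eq_ofKostant (l : Fin ℓ) (r : ℤ) (m : ℕ) :
    Hbin K l r m = ofKostant K ℓ (kHbin l r m) := rfl

/-- The pairs `(d, c)` with `c < d`, in the order of the factors of `negMon`. -/
def negRoots (ℓ : ℕ) : List (Fin (ℓ + 1) × Fin (ℓ + 1)) :=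
  (List.finRange (ℓ + 1)).flatMap fun d =>
    ((List.finRange (ℓ + 1)).filter (fun c => c < d)).map fun c => (d, c)

theorem mem_negRoots {p : Fin (ℓ + 1) × Fin (ℓ + 1)} : p ∈ negRoots ℓ ↔ p.2 < p.1 := by
  obtain ⟨d, c⟩ := p
  simp [negRoots]

theorem nodup_negRoots : (negRoots ℓ).Nodup := by
  rw [negRoots, List.nodup_flatMap]
  refine ⟨fun d _ => ?_, ?_⟩
  · exact ((List.nodup_finRange _).filter _).map fun x y h => (Prod.mk.inj h).2
  · refine (List.nodup_finRange (ℓ + 1)).imp_of_mem fun {a b} _ _ hab => ?_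
    simp only [Function.onFun, List.disjoint_left, List.mem_map]
    rintro x ⟨c, -, rfl⟩ ⟨c', -, h⟩
    exact hab (Prod.mk.inj h).1.symm

theorem pairwise_negRoots : (negRoots ℓ).Pairwise fun p q => p.1 ≤ q.1 := by
  rw [negRoots, List.pairwise_flatMap]
  refine ⟨fun d _ => ?_, ?_⟩
  · refine List.pairwise_map.2 (List.pairwise_of_forall fun _ _ => le_rfl)
  · refine (List.pairwise_le_finRange (ℓ + 1)).imp fun hab => ?_
    simp only [List.mem_map]
    rintro x ⟨c, -, rfl⟩ y ⟨c', -, rfl⟩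
    exact hab

/-- The monomial `F^{(N)}` in Kostant's form. -/
def kNegMon (N : Matrix (Fin (ℓ + 1)) (Fin (ℓ + 1)) ℕ) : kostant ℓ :=
  ((negRoots ℓ).map fun p => kEdiv p.1 p.2 (N p.2 p.1)).prod

theorem negMon_eq_ofKostant (N : Matrix (Fin (ℓ + 1)) (Fin (ℓ + 1)) ℕ) :
    negMon K N = ofKostant K ℓ (kNegMon N) := by
  rw [negMon, kNegMon, map_list_prod, negRoots, List.map_map, List.map_flatMap]
  congr 2
  ext1 d
  rw [List.map_map]
  congr 1
  ext1 c
  exact Ediv_eq_ofKostant K d c _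

/-- The product of the `binom (H_{α_l} + δ_l) m_l` in Kostant's form. -/
def kCartMon (δ : Fin ℓ → ℤ) (m : Fin ℓ → ℕ) : kostant ℓ :=
  ((List.finRange ℓ).map fun l => kHbin l (δ l) (m l)).prod

theorem cartMon_eq_ofKostant (δ : Fin ℓ → ℤ) (m : Fin ℓ → ℕ) :
    cartMon K δ m = ofKostant K ℓ (kCartMon δ m) := by
  rw [cartMon, kCartMon, map_list_prod, List.map_map]
  rfl

theorem rep_kEdiv {a b : Fin (ℓ + 1)} (h : a ≠ b) (m : ℕ) :
    rep ℓ (kEdiv a b m : UC ℓ) =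
      divPow (A := Module.End ℂ (MatFun ℓ)) (colDer (Matrix.single a b 1)) m := by
  rw [kEdiv, dif_pos h, map_divPow, rep_unitE]

end Lift

/-! ### Matrix coefficients of negative monomials -/

section Restriction

variable {ℓ : ℕ}

open MvPolynomial

/-- The restriction of functions to the matrices with arbitrary entries at the places in `S` that
coincide with the identity matrix outside `S`. -/
def resFun (S : Finset (Fin (ℓ + 1) × Fin (ℓ + 1))) : MatFun ℓ →ₐ[ℂ] MatFun ℓ :=
  aeval fun p => if p ∈ S then X p else if p.1 = p.2 then 1 else 0

theorem resFun_X (S : Finset (Fin (ℓ + 1) × Fin (ℓ + 1))) (p : Fin (ℓ + 1) × Fin (ℓ + 1)) :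
    resFun S (X p) = if p ∈ S then X p else if p.1 = p.2 then 1 else 0 := by
  rw [resFun, aeval_X]

/-- If `S` contains `(d, c)` but no place in column `d`, then the root vector `E_{d,c}` acts on the
restricted functions as a partial derivative. -/
theorem pderiv_resFun {S : Finset (Fin (ℓ + 1) × Fin (ℓ + 1))} {d c : Fin (ℓ + 1)} (hdc : d ≠ c)
    (hS : ∀ p ∈ S, p.2 ≠ d) (hr : (d, c) ∈ S) (f : MatFun ℓ) :
    pderiv (d, c) (resFun S f) = resFun S (colDer (Matrix.single d c 1) f) := by
  induction f using MvPolynomial.induction_on with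
  | C a => simp [resFun]
  | add p q hp hq => rw [map_add, map_add, hp, hq, map_add, map_add]
  | mul_X p x hp =>
    rw [map_mul, Derivation.leibniz, hp, Derivation.leibniz, map_add, smul_eq_mul, smul_eq_mul,
      smul_eq_mul, smul_eq_mul, map_mul, map_mul]
    congr 2
    obtain ⟨k, s⟩ := x
    rw [colDer_single_X]
    by_cases hs : c = s
    · subst hs
      rw [if_pos rfl, resFun_X S (k, d), if_neg (fun h => hS (k, d) h rfl), resFun_X]
      by_cases hk : k = d
      · subst hk
        rw [if_pos hr, if_pos rfl, pderiv_X_self]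
      · rw [if_neg (show ¬ (k, d).1 = (k, d).2 from hk)]
        split_ifs
        · rw [pderiv_X_of_ne (by simpa using hk)]
        · exact Derivation.map_one_eq_zero _
        · exact map_zero _
    · rw [if_neg hs, map_zero, resFun_X]
      split_ifs
      · rw [pderiv_X_of_ne (by simpa using fun _ h => hs h.symm)]
      · exact Derivation.map_one_eq_zero _
      · exact map_zero _

theorem divPow_pderiv_resFun {S : Finset (Fin (ℓ + 1) × Fin (ℓ + 1))} {d c : Fin (ℓ + 1)}
    (hdc : d ≠ c) (hS : ∀ p ∈ S, p.2 ≠ d) (hr : (d, c) ∈ S) (m : ℕ) (f : MatFun ℓ) :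
    divPow (A := Module.End ℂ (MatFun ℓ)) (pderiv (R := ℂ) (d, c)) m (resFun S f) = resFun S
      (divPow (A := Module.End ℂ (MatFun ℓ)) (colDer (Matrix.single d c 1)) m f) := by
  have h : ∀ f, (((pderiv (d, c) : Derivation ℂ (MatFun ℓ) (MatFun ℓ)) :
      Module.End ℂ (MatFun ℓ)) ^ m) (resFun S f) =
      resFun S (((colDer (Matrix.single d c 1) : Derivation ℂ (MatFun ℓ) (MatFun ℓ)) :
        Module.End ℂ (MatFun ℓ)) ^ m <| f) := by
    induction m with
    | zero => intro f; rfl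
    | succ m ih =>
      intro f
      rw [pow_succ, pow_succ, Module.End.mul_apply, Module.End.mul_apply, ← ih]
      exact congrArg _ (pderiv_resFun hdc hS hr f)
  rw [divPow, divPow, LinearMap.smul_apply, LinearMap.smul_apply, h, map_smul]

theorem coeff_divPow_pderiv {σ : Type*} (r : σ) (m : ℕ) (e : σ →₀ ℕ) (he : e r = 0)
    (f : MvPolynomial σ ℂ) :
    coeff e (divPow (A := Module.End ℂ (MvPolynomial σ ℂ)) (pderiv (R := ℂ) r) m f) =
      coeff (e + Finsupp.single r m) f := by
  induction m generalizing f with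
  | zero => simp [divPow_zero]
  | succ m ih =>
    have h0 : ((m : ℂ) + 1) ≠ 0 := by exact_mod_cast m.succ_ne_zero
    refine mul_left_cancel₀ h0 ?_
    rw [← smul_eq_mul, ← coeff_smul, ← LinearMap.smul_apply, divPow_succ', Module.End.mul_apply, ih]
    show coeff _ (pderiv r f) = _
    rw [coeff_pderiv, add_assoc, ← Finsupp.single_add, Finsupp.add_apply, he, zero_add,
      Finsupp.single_eq_same, mul_comm]

theorem coeff_resFun_insert (S : Finset (Fin (ℓ + 1) × Fin (ℓ + 1)))
    (r : Fin (ℓ + 1) × Fin (ℓ + 1)) (hr : r.1 ≠ r.2) (hrS : r ∉ S)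
    (e : Fin (ℓ + 1) × Fin (ℓ + 1) →₀ ℕ) (he : e r = 0) (f : MatFun ℓ) :
    coeff e (resFun (insert r S) f) = coeff e (resFun S f) := by
  obtain ⟨g, hg⟩ : ∃ g, resFun (insert r S) f = resFun S f + g * X r := by
    induction f using MvPolynomial.induction_on with
    | C a => exact ⟨0, by simp [resFun]⟩
    | add p q hp hq =>
      obtain ⟨g, hg⟩ := hp
      obtain ⟨g', hg'⟩ := hq
      exact ⟨g + g', by rw [map_add, hg, hg', map_add]; ring⟩
    | mul_X p x hp =>
      obtain ⟨g, hg⟩ := hp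
      have hx : ∃ g', resFun (insert r S) (X x) = resFun S (X x) + g' * X r := by
        simp only [resFun_X, Finset.mem_insert]
        by_cases h : x = r
        · subst h
          exact ⟨1, by rw [if_pos (Or.inl rfl), if_neg hrS, if_neg hr]; ring⟩
        · simp only [h, false_or]
          exact ⟨0, by ring⟩
      obtain ⟨g', hg'⟩ := hx
      exact ⟨g * (resFun S (X x) + g' * X r) + resFun S p * g', by
        rw [map_mul, hg, hg', map_mul]; ring⟩
  classical
  rw [hg, coeff_add, coeff_mul_X', if_neg (by simpa using he), add_zero]

/-- Applying the divided powers of negative root vectors and then setting the entries to be those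
of the identity matrix extracts a coefficient of the restriction to unipotent matrices. -/
theorem coeff_resFun_prod (N : Fin (ℓ + 1) × Fin (ℓ + 1) → ℕ)
    (L : List (Fin (ℓ + 1) × Fin (ℓ + 1))) :
    ∀ (S : Finset (Fin (ℓ + 1) × Fin (ℓ + 1))) (e : Fin (ℓ + 1) × Fin (ℓ + 1) →₀ ℕ) (f : MatFun ℓ),
      L.Nodup → (∀ r ∈ L, r.2 < r.1) → L.Pairwise (fun p q => p.1 ≤ q.1) →
      (∀ p ∈ S, ∀ r ∈ L, p.2 ≠ r.1) → (∀ r ∈ L, r ∉ S ∧ e r = 0) →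
      coeff e (resFun S ((L.map fun r => divPow (A := Module.End ℂ (MatFun ℓ))
        (colDer (Matrix.single r.1 r.2 1)) (N r)).prod f)) =
      coeff (e + (L.map fun r => Finsupp.single r (N r)).sum) (resFun (S ∪ L.toFinset) f) := by
  induction L with
  | nil => intro S e f _ _ _ _ _; simp
  | cons r t ih =>
    intro S e f hnd hlt hpw hS he
    rw [List.nodup_cons] at hnd
    rw [List.pairwise_cons] at hpw
    have hr := hlt r List.mem_cons_self
    have her := he r List.mem_cons_self
    rw [List.map_cons, List.prod_cons, Module.End.mul_apply, List.map_cons, List.sum_cons,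
      ← coeff_resFun_insert S r hr.ne' her.1 e her.2, ← divPow_pderiv_resFun hr.ne' _
        (Finset.mem_insert_self _ _), coeff_divPow_pderiv _ _ _ her.2, ih]
    · rw [add_assoc, List.toFinset_cons, Finset.union_insert, Finset.insert_union]
    · exact hnd.2
    · exact fun x hx => hlt x (List.mem_cons_of_mem _ hx)
    · exact hpw.2
    · intro p hp x hx
      rw [Finset.mem_insert] at hp
      rcases hp with rfl | hp
      · exact (hr.trans_le (hpw.1 x hx)).ne
      · exact hS p hp x (List.mem_cons_of_mem _ hx)
    · intro x hx
      have hxr : x ≠ r := fun h => hnd.1 (h ▸ hx)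
      have := he x (List.mem_cons_of_mem _ hx)
      refine ⟨?_, ?_⟩
      · rw [Finset.mem_insert, not_or]
        exact ⟨hxr, this.1⟩
      · rw [Finsupp.add_apply, this.2, Finsupp.single_eq_of_ne hxr, add_zero]
    · intro p hp
      rw [Finset.mem_insert] at hp
      rcases hp with rfl | hp
      · exact hr.ne
      · exact hS p hp r List.mem_cons_self

/-- The exponent of the monomial that corresponds to `N`, supported below the diagonal. -/
def negExp (N : Matrix (Fin (ℓ + 1)) (Fin (ℓ + 1)) ℕ) : Fin (ℓ + 1) × Fin (ℓ + 1) →₀ ℕ :=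
  Finsupp.equivFunOnFinite.symm fun p => if p.2 < p.1 then N p.2 p.1 else 0

/-- The matrix coefficients of a negative monomial are the coefficients of the restriction of the
function to the lower unitriangular matrices. -/
theorem evalOne_kNegMon (N : Matrix (Fin (ℓ + 1)) (Fin (ℓ + 1)) ℕ) (f : MatFun ℓ) :
    evalOne ℓ (rep ℓ (kNegMon N : UC ℓ) f) =
      coeff (negExp N) (resFun (negRoots ℓ).toFinset f) := by
  have h0 : ∀ f : MatFun ℓ, evalOne ℓ f = coeff 0 (resFun ∅ f) := by
    intro f
    have : (algebraMap ℂ (MatFun ℓ)) (evalOne ℓ f) = resFun ∅ f := by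
      have h : (Algebra.ofId ℂ (MatFun ℓ)).comp (evalOne ℓ) = resFun (∅ : Finset _) := by
        refine MvPolynomial.algHom_ext fun p => ?_
        rw [AlgHom.comp_apply, resFun_X, evalOne, aeval_X]
        simp only [Finset.notMem_empty, if_false]
        split_ifs <;> simp
      exact congrArg (· f) (congrArg DFunLike.coe h)
    rw [← this, algebraMap_eq, coeff_zero_C]
  have h1 : rep ℓ (kNegMon N : UC ℓ) = ((negRoots ℓ).map fun r =>
      divPow (A := Module.End ℂ (MatFun ℓ)) (colDer (Matrix.single r.1 r.2 1))
        (N r.2 r.1)).prod := by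
    rw [kNegMon, ← Subring.coe_subtype, map_list_prod, map_list_prod, List.map_map, List.map_map]
    congr 1
    refine List.map_congr_left fun r hr => ?_
    exact rep_kEdiv (mem_negRoots.1 hr).ne' _
  have h2 : ((negRoots ℓ).map fun r => Finsupp.single r (N r.2 r.1)).sum = negExp N := by
    rw [← List.sum_toFinset _ nodup_negRoots]
    ext p
    rw [Finsupp.finsetSum_apply, negExp, Finsupp.equivFunOnFinite_symm_apply_apply]
    split_ifs with h
    · rw [Finset.sum_eq_single p]
      · rw [Finsupp.single_eq_same]
      · intro q _ hq
        rw [Finsupp.single_eq_of_ne hq.symm]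
      · intro hp
        exact absurd (List.mem_toFinset.2 (mem_negRoots.2 h)) hp
    · refine Finset.sum_eq_zero fun q hq => ?_
      rw [Finsupp.single_eq_of_ne]
      rintro rfl
      exact h (mem_negRoots.1 (List.mem_toFinset.1 hq))
  rw [h0, h1, coeff_resFun_prod (fun r => N r.2 r.1) _ ∅ 0 f nodup_negRoots
    (fun r hr => mem_negRoots.1 hr) pairwise_negRoots (by simp) (by simp), h2, zero_add,
    Finset.empty_union]

end Restriction

/-! ### Highest weight functions -/

section Minors

variable {ℓ : ℕ}

open MvPolynomial

/-- The minor of the generic matrix with the first columns up to `l` and the first rows up to `l`,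
of which the last is replaced with `d`. -/
def minor (l : Fin ℓ) (d : Fin (ℓ + 1)) : MatFun ℓ :=
  (Matrix.of fun s s' : {s : Fin (ℓ + 1) // s ≤ l.castSucc} =>
    (X (if s.1 = l.castSucc then d else s.1, s'.1) : MatFun ℓ)).det

theorem minor_mem (l : Fin ℓ) (d : Fin (ℓ + 1)) : minor l d ∈ intFun ℓ := by
  rw [minor, Matrix.det_apply']
  refine (intFun ℓ).sum_mem fun σ _ => (intFun ℓ).mul_mem ?_ ((intFun ℓ).prod_mem fun s _ => ?_)
  · exact intCast_mem _ _
  · exact X_mem_intFun _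

/-- The derivation given by a matrix with a block of zeros multiplies a minor by the trace of
the corresponding block. -/
theorem colDer_minor (A : Matrix (Fin (ℓ + 1)) (Fin (ℓ + 1)) ℂ) (l : Fin ℓ) (d : Fin (ℓ + 1))
    (hA : ∀ r s, s ≤ l.castSucc → l.castSucc < r → A r s = 0) :
    colDer A (minor l d) =
      (∑ s : {s : Fin (ℓ + 1) // s ≤ l.castSucc}, A s.1 s.1) • minor l d := by
  set M : Matrix {s : Fin (ℓ + 1) // s ≤ l.castSucc} {s : Fin (ℓ + 1) // s ≤ l.castSucc} (MatFun ℓ) :=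
    Matrix.of fun s s' => (X (if s.1 = l.castSucc then d else s.1, s'.1) : MatFun ℓ) with hM
  set B : Matrix {s : Fin (ℓ + 1) // s ≤ l.castSucc} {s : Fin (ℓ + 1) // s ≤ l.castSucc} (MatFun ℓ) :=
    Matrix.of fun s s' => C (A s.1 s'.1) with hB
  have h : M.map (colDer A) = M * B := by
    ext1 s s'
    have h1 : ∀ F : Fin (ℓ + 1) → MatFun ℓ, (∀ r, l.castSucc < r → F r = 0) →
        ∑ r, F r = ∑ r : {s : Fin (ℓ + 1) // s ≤ l.castSucc}, F r.1 := by
      intro F hF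
      rw [← Finset.sum_subset (Finset.filter_subset (fun s => s ≤ l.castSucc) Finset.univ)]
      · exact Finset.sum_subtype _ (by simp) _
      · intro r _ hr
        exact hF r (by simpa using hr)
    rw [Matrix.map_apply, hM, hB, Matrix.of_apply, colDer_X, Matrix.mul_apply, h1]
    · refine Finset.sum_congr rfl fun r _ => ?_
      rw [Matrix.of_apply, Matrix.of_apply, MvPolynomial.smul_eq_C_mul, mul_comm]
    · intro r hr
      rw [hA r _ s'.2 hr, zero_smul]
  show colDer A M.det = _ • M.det
  rw [derivation_det, h, ← mul_assoc, Matrix.adjugate_mul, Matrix.smul_mul, one_mul,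
    Matrix.trace_smul, smul_eq_mul, mul_comm, MvPolynomial.smul_eq_C_mul, map_sum]
  rfl

theorem colDer_minor_of_lt {a b : Fin (ℓ + 1)} (hab : a < b) (l : Fin ℓ) (d : Fin (ℓ + 1)) :
    colDer (Matrix.single a b 1) (minor l d) = 0 := by
  rw [colDer_minor, Finset.sum_eq_zero, zero_smul]
  · intro s _
    rw [Matrix.single_apply_of_ne]
    rintro ⟨rfl, h⟩
    exact hab.ne h.symm
  · intro r s hs hr
    rw [Matrix.single_apply_of_ne]
    rintro ⟨rfl, rfl⟩
    exact absurd (hr.trans hab) (not_lt.2 hs)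

theorem colDer_minor_cartan (k l : Fin ℓ) (d : Fin (ℓ + 1)) :
    colDer (Matrix.single k.castSucc k.castSucc 1 - Matrix.single k.succ k.succ 1) (minor l d) =
      (if k = l then (1 : ℂ) else 0) • minor l d := by
  rw [colDer_minor]
  · congr 1
    have h : ∀ x : Fin (ℓ + 1), ∑ s : {s : Fin (ℓ + 1) // s ≤ l.castSucc},
        Matrix.single x x (1 : ℂ) s.1 s.1 = if x ≤ l.castSucc then 1 else 0 := by
      intro x
      split_ifs with hx
      · rw [Finset.sum_eq_single (⟨x, hx⟩ : {s : Fin (ℓ + 1) // s ≤ l.castSucc})]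
        · simp
        · intro s _ hs
          exact Matrix.single_apply_of_ne _ _ _ _ _ fun h => hs (Subtype.ext h.1.symm)
        · simp
      · refine Finset.sum_eq_zero fun s _ => Matrix.single_apply_of_ne _ _ _ _ _ fun h => hx ?_
        rw [h.1]; exact s.2
    simp only [Matrix.sub_apply, Finset.sum_sub_distrib, h]
    have h1 : k.castSucc ≤ l.castSucc ↔ k ≤ l := Fin.castSucc_le_castSucc_iff
    have h2 : k.succ ≤ l.castSucc ↔ k < l := by
      rw [Fin.le_def, Fin.lt_def]; simp
    simp only [h1, h2]
    rcases lt_trichotomy k l with h | h | h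
    · simp [h, h.le, h.ne]
    · simp [h]
    · simp [not_le.2 h, not_lt.2 h.le, h.ne']
  · intro r s hs hr
    have : ∀ x : Fin (ℓ + 1), Matrix.single x x (1 : ℂ) r s = 0 := fun x =>
      Matrix.single_apply_of_ne _ _ _ _ _ fun h => (hs.trans_lt hr).ne (h.2.symm.trans h.1)
    rw [Matrix.sub_apply, this, this, sub_zero]

theorem resFun_minor (l : Fin ℓ) (d : Fin (ℓ + 1)) (hd : l.castSucc ≤ d) :
    resFun (negRoots ℓ).toFinset (minor l d) =
      if d = l.castSucc then 1 else X (d, l.castSucc) := by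
  have hX : ∀ k s : Fin (ℓ + 1), resFun (negRoots ℓ).toFinset (X (k, s)) =
      if s < k then X (k, s) else if k = s then 1 else 0 := by
    intro k s
    rw [resFun_X]
    simp only [List.mem_toFinset, mem_negRoots]
  rw [minor, AlgHom.map_det, Matrix.det_of_isLowerTriangular]
  · rw [Finset.prod_eq_single (⟨l.castSucc, le_rfl⟩ : {s : Fin (ℓ + 1) // s ≤ l.castSucc})]
    · simp only [AlgHom.mapMatrix_apply, Matrix.map_apply, Matrix.of_apply, hX, if_true]
      rcases hd.lt_or_eq with h | h
      · rw [if_pos h, if_neg h.ne']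
      · subst h; simp
    · intro s _ hs
      have : s.1 ≠ l.castSucc := fun h => hs (Subtype.ext h)
      simp [hX, this]
    · simp
  · intro s s' hss
    have hss' : s.1 < s'.1 := hss
    have h1 : s.1 ≠ l.castSucc := (hss'.trans_le s'.2).ne
    simp [hX, h1, not_lt.2 hss'.le, hss'.ne]

/-- A product of minors. Its restriction to the lower unipotent matrices is the monomial given by
`N`, and its weight is given by `N` and the numbers `k l`, which can be arbitrarily large. -/
def minorProd (N : Matrix (Fin (ℓ + 1)) (Fin (ℓ + 1)) ℕ) (k : Fin ℓ → ℕ) : MatFun ℓ :=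
  ∏ l, (minor l l.castSucc ^ k l * ∏ d ∈ Finset.Ioi l.castSucc, minor l d ^ N l.castSucc d)

theorem minorProd_mem (N : Matrix (Fin (ℓ + 1)) (Fin (ℓ + 1)) ℕ) (k : Fin ℓ → ℕ) :
    minorProd N k ∈ intFun ℓ :=
  (intFun ℓ).prod_mem fun _ _ => (intFun ℓ).mul_mem ((intFun ℓ).pow_mem (minor_mem _ _) _)
    ((intFun ℓ).prod_mem fun _ _ => (intFun ℓ).pow_mem (minor_mem _ _) _)

theorem derivation_pow_of_eigen {S : Type*} [CommRing S] [Algebra ℂ S] (D : Derivation ℂ S S)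
    {f : S} {a : ℂ} (h : D f = a • f) (m : ℕ) : D (f ^ m) = (m * a) • f ^ m := by
  induction m with
  | zero => simp
  | succ m ih =>
    rw [pow_succ, D.leibniz, ih, h, smul_eq_mul, smul_eq_mul, mul_smul_comm, mul_smul_comm,
      mul_comm f, ← add_smul]
    congr 1
    push_cast
    ring

theorem derivation_prod_of_eigen {S ι : Type*} [CommRing S] [Algebra ℂ S] (D : Derivation ℂ S S)
    (s : Finset ι) {f : ι → S} {a : ι → ℂ} (h : ∀ i ∈ s, D (f i) = a i • f i) :
    D (∏ i ∈ s, f i) = (∑ i ∈ s, a i) • ∏ i ∈ s, f i := by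
  classical
  induction s using Finset.induction_on with
  | empty => simp
  | insert i s hi ih =>
    rw [Finset.prod_insert hi, D.leibniz, ih fun j hj => h j (Finset.mem_insert_of_mem hj),
      h i (Finset.mem_insert_self _ _), Finset.sum_insert hi, smul_eq_mul, smul_eq_mul,
      mul_smul_comm, mul_smul_comm, mul_comm (∏ i ∈ s, f i), ← add_smul, add_comm]

theorem derivation_mul_of_eigen {S : Type*} [CommRing S] [Algebra ℂ S] (D : Derivation ℂ S S)
    {f g : S} {a b : ℂ} (hf : D f = a • f) (hg : D g = b • g) :
    D (f * g) = (a + b) • (f * g) := by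
  rw [D.leibniz, hf, hg, smul_eq_mul, smul_eq_mul, mul_smul_comm, mul_smul_comm, mul_comm g,
    ← add_smul, add_comm]

/-- The weight of `minorProd`. -/
def minorWeight (N : Matrix (Fin (ℓ + 1)) (Fin (ℓ + 1)) ℕ) (k : Fin ℓ → ℕ) (l : Fin ℓ) : ℕ :=
  k l + ∑ d ∈ Finset.Ioi l.castSucc, N l.castSucc d

theorem colDer_minorProd (D : Derivation ℂ (MatFun ℓ) (MatFun ℓ)) (a : Fin ℓ → ℂ)
    (h : ∀ l d, D (minor l d) = a l • minor l d)
    (N : Matrix (Fin (ℓ + 1)) (Fin (ℓ + 1)) ℕ) (k : Fin ℓ → ℕ) :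
    D (minorProd N k) = (∑ l, (minorWeight N k l : ℂ) * a l) • minorProd N k := by
  refine derivation_prod_of_eigen D _ fun l _ => ?_
  rw [derivation_mul_of_eigen D (derivation_pow_of_eigen D (h l _) _)
    (derivation_prod_of_eigen D _ fun d _ => derivation_pow_of_eigen D (h l d) _), minorWeight]
  congr 1
  rw [Nat.cast_add, Nat.cast_sum, add_mul, Finset.sum_mul]

theorem colDer_minorProd_of_lt {a b : Fin (ℓ + 1)} (hab : a < b)
    (N : Matrix (Fin (ℓ + 1)) (Fin (ℓ + 1)) ℕ) (k : Fin ℓ → ℕ) :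
    colDer (Matrix.single a b 1) (minorProd N k) = 0 := by
  rw [colDer_minorProd _ (fun _ => 0) fun l d => by rw [colDer_minor_of_lt hab, zero_smul]]
  simp

theorem rep_cartanH_minorProd (N : Matrix (Fin (ℓ + 1)) (Fin (ℓ + 1)) ℕ) (k : Fin ℓ → ℕ)
    (l : Fin ℓ) :
    rep ℓ (cartanH l) (minorProd N k) = (minorWeight N k l : ℂ) • minorProd N k := by
  rw [rep_cartanH]
  refine (colDer_minorProd _ _ (colDer_minor_cartan l) N k).trans ?_
  simp

theorem rep_kHbin_minorProd (N : Matrix (Fin (ℓ + 1)) (Fin (ℓ + 1)) ℕ) (k : Fin ℓ → ℕ)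
    (l : Fin ℓ) (m : ℕ) :
    rep ℓ (kHbin l 0 m : UC ℓ) (minorProd N k) =
      ((minorWeight N k l).choose m : ℂ) • minorProd N k := by
  show rep ℓ (binom (cartanH l + ((0 : ℤ) : UC ℓ)) m) _ = _
  rw [Int.cast_zero, add_zero]
  induction m with
  | zero => simp [binom_zero]
  | succ m ih =>
    have h0 : ((m : ℂ) + 1) ≠ 0 := by exact_mod_cast m.succ_ne_zero
    refine smul_right_injective _ h0 ?_
    show ((m : ℂ) + 1) • _ = ((m : ℂ) + 1) • _
    rw [← LinearMap.smul_apply, ← map_smul, binom_succ, map_mul, Module.End.mul_apply, map_sub,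
      map_natCast, LinearMap.sub_apply, rep_cartanH_minorProd, Module.End.natCast_apply,
      ← Nat.cast_smul_eq_nsmul ℂ, ← sub_smul, map_smul, ih, smul_smul, smul_smul]
    congr 1
    have := Nat.choose_succ_right_eq (minorWeight N k l) m
    rcases le_or_gt m (minorWeight N k l) with hm | hm
    · have h2 : ((minorWeight N k l - m : ℕ) : ℂ) = (minorWeight N k l : ℂ) - m :=
        Nat.cast_sub hm
      rw [← h2, mul_comm, mul_comm ((m : ℂ) + 1)]
      exact_mod_cast this.symm
    · rw [Nat.choose_eq_zero_of_lt hm, Nat.choose_eq_zero_of_lt (hm.trans (Nat.lt_succ_self m))]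
      simp

theorem rep_kCartMon_minorProd (N : Matrix (Fin (ℓ + 1)) (Fin (ℓ + 1)) ℕ) (k : Fin ℓ → ℕ)
    (m : Fin ℓ → ℕ) :
    rep ℓ (kCartMon 0 m : UC ℓ) (minorProd N k) =
      ((∏ l, (minorWeight N k l).choose (m l) : ℕ) : ℂ) • minorProd N k := by
  have h : ∀ L : List (Fin ℓ), rep ℓ ((L.map fun l => kHbin l 0 (m l)).prod : kostant ℓ)
      (minorProd N k) =
      (((L.map fun l => (minorWeight N k l).choose (m l)).prod : ℕ) : ℂ) • minorProd N k := by
    intro L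
    induction L with
    | nil => simp
    | cons l L ih =>
      rw [List.map_cons, List.prod_cons, Subring.coe_mul, map_mul, Module.End.mul_apply, ih,
        map_smul, rep_kHbin_minorProd, smul_smul, List.map_cons, List.prod_cons, Nat.cast_mul,
        mul_comm]
  rw [kCartMon, Fin.prod_univ_def]
  exact h _

theorem resFun_minorProd (N : Matrix (Fin (ℓ + 1)) (Fin (ℓ + 1)) ℕ) (k : Fin ℓ → ℕ) :
    resFun (negRoots ℓ).toFinset (minorProd N k) = monomial (negExp N) 1 := by
  have h1 : resFun (negRoots ℓ).toFinset (minorProd N k) =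
      ∏ c : Fin (ℓ + 1), ∏ d ∈ Finset.Ioi c, X (d, c) ^ N c d := by
    rw [minorProd, map_prod, Fin.prod_univ_castSucc (n := ℓ)]
    have hlast : Finset.Ioi (Fin.last ℓ) = ∅ := Finset.Ioi_eq_empty.2 fun x => by simp [Fin.le_last]
    rw [hlast, Finset.prod_empty, mul_one]
    refine Finset.prod_congr rfl fun l _ => ?_
    rw [map_mul, map_pow, resFun_minor _ _ le_rfl, if_pos rfl, one_pow, one_mul, map_prod]
    refine Finset.prod_congr rfl fun d hd => ?_
    have hd := Finset.mem_Ioi.1 hd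
    rw [map_pow, resFun_minor _ _ hd.le, if_neg hd.ne']
  rw [h1, monomial_eq, map_one, one_mul, Finsupp.prod_fintype _ _ (by simp),
    Fintype.prod_prod_type, Finset.prod_comm]
  refine Finset.prod_congr rfl fun c _ => ?_
  rw [← Finset.prod_subset (Finset.subset_univ (Finset.Ioi c))]
  · refine Finset.prod_congr rfl fun d hd => ?_
    rw [negExp, Finsupp.equivFunOnFinite_symm_apply_apply, if_pos (Finset.mem_Ioi.1 hd)]
  · intro d _ hd
    rw [negExp, Finsupp.equivFunOnFinite_symm_apply_apply,
      if_neg (fun h => hd (Finset.mem_Ioi.2 h)), pow_zero]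

variable (K : Type*) [Field K]

/-- The functionals that separate the basis elements of `𝒰^{-,0}`. -/
theorem coeffK_minorProd (N N' : Matrix (Fin (ℓ + 1)) (Fin (ℓ + 1)) ℕ) (k m : Fin ℓ → ℕ) :
    coeffK K (minorProd N k) (minorProd_mem N k) (negMon K N' * cartMon K 0 m) =
      if negExp N = negExp N' then ((∏ l, (minorWeight N k l).choose (m l) : ℕ) : K) else 0 := by
  rw [negMon_eq_ofKostant, cartMon_eq_ofKostant, ← map_mul, ofKostant_apply, coeffK_tmul, one_mul]
  have h : coeffZ (minorProd N k) (minorProd_mem N k) (kNegMon N' * kCartMon 0 m) =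
      if negExp N = negExp N' then ((∏ l, (minorWeight N k l).choose (m l) : ℕ) : ℤ) else 0 := by
    have : ((coeffZ (minorProd N k) (minorProd_mem N k) (kNegMon N' * kCartMon 0 m) : ℤ) : ℂ) =
        ((if negExp N = negExp N' then ((∏ l, (minorWeight N k l).choose (m l) : ℕ) : ℤ)
          else 0 : ℤ) : ℂ) := by
      rw [coe_coeffZ, Subring.coe_mul, map_mul, Module.End.mul_apply, rep_kCartMon_minorProd,
        map_smul, map_smul, evalOne_kNegMon, resFun_minorProd, coeff_monomial, smul_eq_mul]
      split_ifs <;> simp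
    exact_mod_cast this
  rw [h]
  split_ifs <;> simp

end Minors

/-! ### Independence of the basis elements -/

theorem prod_choose_add_single {ℓ : ℕ} (s k m : Fin ℓ → ℕ) (l : Fin ℓ) :
    ∏ j, ((k + Pi.single l 1 : Fin ℓ → ℕ) j + s j).choose ((m + Pi.single l 1 : Fin ℓ → ℕ) j) =
      ∏ j, (k j + s j).choose ((m + Pi.single l 1 : Fin ℓ → ℕ) j) +
        ∏ j, (k j + s j).choose (m j) := by
  have key : ∀ f g h : Fin ℓ → ℕ, f l = g l + h l → (∀ j, j ≠ l → f j = h j ∧ g j = h j) →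
      ∏ j, f j = ∏ j, g j + ∏ j, h j := by
    intro f g h hl hne
    have hp : ∀ f : Fin ℓ → ℕ, ∏ j, f j = f l * ∏ j ∈ Finset.univ.erase l, f j := fun f =>
      (Finset.mul_prod_erase Finset.univ f (Finset.mem_univ l)).symm
    rw [hp f, hp g, hp h, hl, add_mul,
      Finset.prod_congr rfl fun j hj => (hne j (Finset.ne_of_mem_erase hj)).1,
      Finset.prod_congr rfl fun j hj => (hne j (Finset.ne_of_mem_erase hj)).2]
  refine key _ _ _ ?_ fun j hj => ⟨by simp [hj], by simp [hj]⟩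
  simp only [Pi.add_apply, Pi.single_eq_same]
  rw [add_right_comm, Nat.choose_succ_succ', add_comm]

/-- The difference operator in the direction `l` shifts the coefficients of a linear combination of
products of binomial coefficients, by Pascal's rule. -/
theorem sum_comapDomain_choose {K : Type*} [Field K] {ℓ : ℕ} (s k : Fin ℓ → ℕ) (l : Fin ℓ)
    (c : (Fin ℓ → ℕ) →₀ K) :
    (Finsupp.comapDomain (· + Pi.single l 1) c
      (add_left_injective (Pi.single l 1 : Fin ℓ → ℕ)).injOn).sum
        (fun m a => a * ((∏ l, (k l + s l).choose (m l) : ℕ) : K)) =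
      c.sum (fun m a =>
        a * ((∏ j, ((k + Pi.single l 1 : Fin ℓ → ℕ) j + s j).choose (m j) : ℕ) : K)) -
      c.sum (fun m a => a * ((∏ l, (k l + s l).choose (m l) : ℕ) : K)) := by
  have hinj := add_left_injective (Pi.single l 1 : Fin ℓ → ℕ)
  have hadd : ∀ (c c' : (Fin ℓ → ℕ) →₀ K) (f : (Fin ℓ → ℕ) → K),
      (c + c').sum (fun m a => a * f m) =
        c.sum (fun m a => a * f m) + c'.sum (fun m a => a * f m) := fun c c' f =>
    Finsupp.sum_add_index' (fun _ => zero_mul _) fun _ _ _ => add_mul _ _ _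
  induction c using Finsupp.induction_linear with
  | zero => simp
  | add c c' hc hc' =>
    rw [Finsupp.comapDomain_add_of_injective hinj, hadd, hadd, hadd, hc, hc']
    ring
  | single m a =>
    rw [Finsupp.sum_single_index (zero_mul _), Finsupp.sum_single_index (zero_mul _)]
    by_cases hm : m l = 0
    · have h0 : Finsupp.comapDomain (· + Pi.single l 1) (Finsupp.single m a) hinj.injOn = 0 := by
        ext m'
        rw [Finsupp.comapDomain_apply, Finsupp.single_eq_of_ne, Finsupp.zero_apply]
        rintro rfl
        simp at hm
      rw [h0, Finsupp.sum_zero_index, ← mul_sub, eq_comm, mul_eq_zero, sub_eq_zero]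
      refine Or.inr (congrArg _ (Finset.prod_congr rfl fun j _ => ?_))
      by_cases hj : j = l
      · subst hj; simp [hm]
      · simp [hj]
    · obtain ⟨m, rfl⟩ : ∃ m', m = m' + Pi.single l 1 := by
        refine ⟨m - Pi.single l 1, (tsub_add_cancel_of_le fun j => ?_).symm⟩
        by_cases hj : j = l
        · subst hj
          simpa using Nat.one_le_iff_ne_zero.2 hm
        · simp [hj]
      have h0 : Finsupp.comapDomain (· + Pi.single l 1)
          (Finsupp.single (m + Pi.single l 1) a) hinj.injOn = Finsupp.single m a :=
        Finsupp.comapDomain_single _ _ _ _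
      rw [h0, Finsupp.sum_single_index (zero_mul _), prod_choose_add_single, Nat.cast_add]
      ring

/-- The functions `k ↦ ∏ binom (k l + s l) (m l)` are linearly independent over any field. -/
theorem eq_zero_of_sum_choose {K : Type*} [Field K] {ℓ : ℕ} (s : Fin ℓ → ℕ) (n : ℕ) :
    ∀ c : (Fin ℓ → ℕ) →₀ K, (∀ m, n ≤ ∑ l, m l → c m = 0) →
      (∀ k : Fin ℓ → ℕ, c.sum (fun m a => a * ((∏ l, (k l + s l).choose (m l) : ℕ) : K)) = 0) →
      c = 0 := by
  induction n with
  | zero => exact fun c hc _ => Finsupp.ext fun m => hc m (Nat.zero_le _)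
  | succ n ih =>
    intro c hc h
    have hinj : ∀ l : Fin ℓ, Function.Injective fun m : Fin ℓ → ℕ => m + Pi.single l 1 :=
      fun l => add_left_injective _
    -- the difference operator in the direction `l` lowers the degree
    have hT : ∀ l, Finsupp.comapDomain (· + Pi.single l 1) c (hinj l).injOn = 0 := by
      intro l
      refine ih _ (fun m hm => ?_) fun k => ?_
      · rw [Finsupp.comapDomain_apply]
        refine hc _ ?_
        simp only [Pi.add_apply, Finset.sum_add_distrib]
        rw [Finset.sum_pi_single']
        simpa using hm
      · have key : ∀ c : (Fin ℓ → ℕ) →₀ K,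
            (Finsupp.comapDomain (· + Pi.single l 1) c (hinj l).injOn).sum
              (fun m a => a * ((∏ l, (k l + s l).choose (m l) : ℕ) : K)) =
            c.sum (fun m a => a * ((∏ j, ((k + Pi.single l 1 : Fin ℓ → ℕ) j + s j).choose (m j) : ℕ) : K)) -
              c.sum (fun m a => a * ((∏ l, (k l + s l).choose (m l) : ℕ) : K)) := by
          exact fun c => sum_comapDomain_choose s k l c
        rw [key, h, h, sub_zero]
    have h1 : ∀ m, m ≠ 0 → c m = 0 := by
      intro m hm
      obtain ⟨l, hl⟩ := Function.ne_iff.1 hm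
      have : m = (m - Pi.single l 1) + Pi.single l 1 := by
        refine (tsub_add_cancel_of_le fun j => ?_).symm
        by_cases hj : j = l
        · subst hj
          simpa using Nat.one_le_iff_ne_zero.2 hl
        · simp [hj]
      rw [this, ← Finsupp.comapDomain_apply (· + Pi.single l 1) c (hinj l).injOn, hT,
        Finsupp.zero_apply]
    have h2 : c = Finsupp.single 0 (c 0) := by
      ext m
      by_cases hm : m = 0
      · rw [hm, Finsupp.single_eq_same]
      · rw [h1 m hm, Finsupp.single_eq_of_ne hm]
    have h3 := h 0
    rw [h2, Finsupp.sum_single_index (by simp)] at h3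
    rw [h2]
    simpa using h3

/-- The indices of the basis of `𝒰^{-,0}`: the exponents of the negative root vectors and of the
binomial coefficients. -/
abbrev BasisIndex (ℓ : ℕ) : Type := Set.range (negExp (ℓ := ℓ)) × (Fin ℓ → ℕ)

/-- The matrix with given exponents. -/
def expMat {ℓ : ℕ} (e : Fin (ℓ + 1) × Fin (ℓ + 1) →₀ ℕ) : Matrix (Fin (ℓ + 1)) (Fin (ℓ + 1)) ℕ :=
  fun c d => e (d, c)

theorem negExp_expMat {ℓ : ℕ} (e : Set.range (negExp (ℓ := ℓ))) : negExp (expMat e.1) = e.1 := by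
  obtain ⟨-, N, rfl⟩ := e
  ext p
  simp only [negExp, Finsupp.equivFunOnFinite_symm_apply_apply, expMat]
  split_ifs <;> rfl

theorem kNegMon_congr {ℓ : ℕ} {N N' : Matrix (Fin (ℓ + 1)) (Fin (ℓ + 1)) ℕ}
    (h : negExp N = negExp N') : kNegMon N = kNegMon N' := by
  rw [kNegMon, kNegMon]
  congr 1
  refine List.map_congr_left fun p hp => ?_
  have := DFunLike.congr_fun h p
  simp only [negExp, Finsupp.equivFunOnFinite_symm_apply_apply, if_pos (mem_negRoots.1 hp)] at this
  rw [this]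

/-- The basis elements of `𝒰^{-,0}`. -/
def basisElt (K : Type*) [Field K] {ℓ : ℕ} (x : BasisIndex ℓ) : Hyper K ℓ :=
  negMon K (expMat x.1.1) * cartMon K 0 x.2

/-- The basis elements are independent even modulo the ideal generated by the positive part. -/
theorem linearCombination_basisElt_eq_zero (K : Type*) [Field K] {ℓ : ℕ} (c : BasisIndex ℓ →₀ K)
    (h : Finsupp.linearCombination K (basisElt K) c ∈ posIdeal K ℓ) : c = 0 := by
  suffices h0 : ∀ e, Finsupp.comapDomain (fun m => (e, m)) c
      (Prod.mk_right_injective e).injOn = 0 by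
    ext ⟨e, m⟩
    exact DFunLike.congr_fun (h0 e) m
  intro e
  set s : Fin ℓ → ℕ := fun l => ∑ d ∈ Finset.Ioi l.castSucc, expMat e.1 l.castSucc d with hs
  obtain ⟨n, hn⟩ : ∃ n, ∀ x ∈ c.support, ∑ l, x.2 l < n := by
    refine ⟨c.support.sup (fun x => ∑ l, x.2 l) + 1, fun x hx => Nat.lt_succ_of_le ?_⟩
    exact Finset.le_sup (f := fun x : BasisIndex ℓ => ∑ l, x.2 l) hx
  refine eq_zero_of_sum_choose s n _ (fun m hm => ?_) fun k => ?_
  · rw [Finsupp.comapDomain_apply]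
    by_contra hne
    exact absurd (hn _ (Finsupp.mem_support_iff.2 hne)) (not_lt.2 hm)
  · have h1 := coeffK_posIdeal K (minorProd (expMat e.1) k) (minorProd_mem _ k)
      (fun a b hab => colDer_minorProd_of_lt hab _ _) _ h
    have h2 : ∀ c : BasisIndex ℓ →₀ K, coeffK K (minorProd (expMat e.1) k) (minorProd_mem _ k)
        (Finsupp.linearCombination K (basisElt K) c) =
        (Finsupp.comapDomain (fun m => (e, m)) c (Prod.mk_right_injective e).injOn).sum
          (fun m a => a * ((∏ l, (k l + s l).choose (m l) : ℕ) : K)) := by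
      intro c
      induction c using Finsupp.induction_linear with
      | zero => simp
      | add c c' hc hc' =>
        rw [map_add, map_add, hc, hc', Finsupp.comapDomain_add_of_injective
          (Prod.mk_right_injective e), Finsupp.sum_add_index' (fun _ => zero_mul _)
            fun _ _ _ => add_mul _ _ _]
      | single x a =>
        obtain ⟨e', m⟩ := x
        rw [Finsupp.linearCombination_single, map_smul, basisElt, coeffK_minorProd, negExp_expMat,
          negExp_expMat]
        by_cases he : e = e'
        · subst he
          rw [if_pos rfl]
          have : Finsupp.comapDomain (fun m => (e, m)) (Finsupp.single (e, m) a)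
              (Prod.mk_right_injective e).injOn = Finsupp.single m a :=
            Finsupp.comapDomain_single _ _ _ _
          rw [this, Finsupp.sum_single_index (zero_mul _)]
          rfl
        · rw [if_neg fun h => he (Subtype.ext h), smul_zero]
          have : Finsupp.comapDomain (fun m => (e, m)) (Finsupp.single (e', m) a)
              (Prod.mk_right_injective e).injOn = 0 := by
            ext m'
            rw [Finsupp.comapDomain_apply, Finsupp.single_eq_of_ne, Finsupp.zero_apply]
            exact fun h => he (Prod.mk.inj h).1
          rw [this, Finsupp.sum_zero_index]
    rw [← h2, h1]

/-! ### Commutation relations of divided powers and binomial coefficients -/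

section AlgebraRelations

variable {A : Type*} [Ring A] [Algebra ℂ A]

theorem commute_divPow {x y : A} (h : Commute x y) (m m' : ℕ) :
    Commute (divPow x m) (divPow y m') :=
  ((h.pow_pow m m').smul_left _).smul_right _

theorem mul_divPow_succ {e f z : A} (h : e * f = f * e + z) (hz : Commute z f) (m : ℕ) :
    e * divPow f (m + 1) = divPow f (m + 1) * e + z * divPow f m := by
  induction m with
  | zero => simp [divPow, h]
  | succ m ih =>
    have h0 : ((m : ℂ) + 1 + 1) ≠ 0 := by exact_mod_cast (m + 1).succ_ne_zero
    have e1 := divPow_succ' f (m + 1)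
    push_cast at e1
    refine smul_right_injective A h0 ?_
    show ((m : ℂ) + 1 + 1) • _ = ((m : ℂ) + 1 + 1) • _
    have e2 : divPow f (m + 1) * z = z * divPow f (m + 1) :=
      ((hz.pow_right _).smul_right _).eq.symm
    rw [← mul_smul_comm, e1, ← mul_assoc, ih, smul_add, ← smul_mul_assoc, e1, add_mul, mul_assoc,
      h, mul_add, mul_assoc z, ← divPow_succ' f m, e2, mul_smul_comm,
      ← mul_assoc (divPow f (m + 1)) f e]
    module

theorem mul_divPow_of_weight {f h : A} (w : ℤ) (hf : h * f = f * (h + (w : A))) (m : ℕ) :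
    h * divPow f m = divPow f m * (h + ((m * w : ℤ) : A)) := by
  have key : h * f ^ m = f ^ m * (h + ((m * w : ℤ) : A)) := by
    induction m with
    | zero => simp
    | succ m ih =>
      rw [pow_succ, ← mul_assoc, ih, mul_assoc, add_mul, hf, (Int.cast_commute _ f).eq, ← mul_add,
        ← mul_assoc]
      congr 1
      push_cast
      noncomm_ring
  rw [divPow, mul_smul_comm, key, smul_mul_assoc]

theorem mul_binom_of_weight {e h : A} (w : ℤ) (he : e * h = (h - (w : A)) * e) (s : ℤ) (k : ℕ) :
    e * binom (h + (s : A)) k = binom (h + ((s - w : ℤ) : A)) k * e := by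
  induction k with
  | zero => simp [binom_zero]
  | succ k ih =>
    have h0 : ((k : ℂ) + 1) ≠ 0 := by exact_mod_cast k.succ_ne_zero
    refine smul_right_injective A h0 ?_
    show ((k : ℂ) + 1) • (e * binom (h + s) (k + 1)) =
      ((k : ℂ) + 1) • (binom (h + ((s - w : ℤ) : A)) (k + 1) * e)
    rw [← mul_smul_comm, ← smul_mul_assoc, binom_succ, binom_succ, ← mul_assoc, ih, mul_assoc,
      mul_assoc]
    congr 1
    rw [mul_sub, mul_add, he, ← (Int.cast_commute s e).eq, ← (Nat.cast_commute k e).eq]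
    push_cast
    noncomm_ring

theorem self_mul_binom (h : A) (r : ℤ) (m : ℕ) :
    h * binom (h + (r : A)) m =
      ((m + 1 : ℕ) : A) * binom (h + (r : A)) (m + 1) + ((m - r : ℤ) : A) * binom (h + (r : A)) m := by
  have h1 := binom_succ (h + (r : A)) m
  rw [show ((m : ℂ) + 1) = ((m + 1 : ℕ) : ℂ) by push_cast; rfl, Nat.cast_smul_eq_nsmul,
    nsmul_eq_mul] at h1
  have h2 : Commute (h + (r : A)) (binom (h + (r : A)) m) := commute_binom _ _ (Commute.refl _) _
  have h3 : Commute h (binom (h + (r : A)) m) :=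
    commute_binom _ _ ((Commute.refl h).add_right (Int.cast_commute r h).symm) _
  rw [h1, h3.eq, (Int.cast_commute _ (binom (h + (r : A)) m)).eq, ← mul_add]
  congr 1
  push_cast
  abel

end AlgebraRelations

section Relations

variable {ℓ : ℕ}

attribute [local instance] LieRing.ofAssociativeRing

theorem commute_unitE {a b c d : Fin (ℓ + 1)} (hab : a ≠ b) (hcd : c ≠ d) (hbc : b ≠ c)
    (had : a ≠ d) : Commute (unitE a b hab) (unitE c d hcd) := by
  have := iota_mul (LieAlgebra.SpecialLinear.single a b hab (1 : ℂ))
    (LieAlgebra.SpecialLinear.single c d hcd (1 : ℂ)) 0 (by simp [hbc, had.symm])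
  rw [map_zero, add_zero] at this
  exact this

theorem unitE_mul_unitE {a b c : Fin (ℓ + 1)} (hab : a ≠ b) (hbc : b ≠ c) (hac : a ≠ c) :
    unitE a b hab * unitE b c hbc = unitE b c hbc * unitE a b hab + unitE a c hac :=
  iota_mul _ _ _ (by simp [hac.symm])

theorem unitE_mul_unitE_swap {l : Fin ℓ} :
    unitE l.castSucc l.succ Fin.castSucc_lt_succ.ne * unitE l.succ l.castSucc Fin.castSucc_lt_succ.ne' =
      unitE l.succ l.castSucc Fin.castSucc_lt_succ.ne' *
        unitE l.castSucc l.succ Fin.castSucc_lt_succ.ne + cartanH l := by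
  apply iota_mul
  simp

/-- The value at `H_{α_l}` of the weight of the entry `a`. -/
def entryWeight (l : Fin ℓ) (a : Fin (ℓ + 1)) : ℤ :=
  (if a = l.castSucc then 1 else 0) - if a = l.succ then 1 else 0

theorem cartanH_mul_unitE (l : Fin ℓ) {a b : Fin (ℓ + 1)} (hab : a ≠ b) :
    cartanH l * unitE a b hab =
      unitE a b hab * (cartanH l + ((entryWeight l a - entryWeight l b : ℤ) : UC ℓ)) := by
  have := iota_mul (LieAlgebra.SpecialLinear.singleSubSingle l.castSucc l.succ (1 : ℂ))
    (LieAlgebra.SpecialLinear.single a b hab (1 : ℂ))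
    ((entryWeight l a - entryWeight l b) • LieAlgebra.SpecialLinear.single a b hab (1 : ℂ)) (by
      have h1 : ∀ x : Fin (ℓ + 1), Matrix.single x x (1 : ℂ) * Matrix.single a b 1 =
          (if a = x then (1 : ℤ) else 0) • Matrix.single a b 1 := by
        intro x
        split_ifs with h
        · subst h; simp
        · rw [Matrix.single_mul_single_of_ne _ _ _ _ (Ne.symm h), zero_smul]
      have h2 : ∀ x : Fin (ℓ + 1), Matrix.single a b (1 : ℂ) * Matrix.single x x 1 =
          (if b = x then (1 : ℤ) else 0) • Matrix.single a b 1 := by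
        intro x
        split_ifs with h
        · subst h; simp
        · rw [Matrix.single_mul_single_of_ne _ _ _ _ h, zero_smul]
      have h3 : ((entryWeight l a - entryWeight l b) •
          LieAlgebra.SpecialLinear.single a b hab (1 : ℂ)).val =
          (entryWeight l a - entryWeight l b) • Matrix.single a b (1 : ℂ) := by
        simp
      rw [h3, LieAlgebra.SpecialLinear.val_singleSubSingle, LieAlgebra.SpecialLinear.val_single,
        sub_mul, mul_sub, h1, h1, h2, h2, entryWeight, entryWeight]
      module)
  rw [map_zsmul] at this
  rw [cartanH, unitE, this, mul_add, zsmul_eq_mul', Int.cast_sub]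

theorem commute_cartanH (k l : Fin ℓ) : Commute (cartanH k) (cartanH l) := by
  have h : ∀ x y : Fin (ℓ + 1), Matrix.single x x (1 : ℂ) * Matrix.single y y 1 =
      Matrix.single y y (1 : ℂ) * Matrix.single x x 1 := by
    intro x y
    by_cases hxy : x = y
    · rw [hxy]
    · rw [Matrix.single_mul_single_of_ne _ _ _ _ hxy,
        Matrix.single_mul_single_of_ne _ _ _ _ (Ne.symm hxy)]
  have := iota_mul (LieAlgebra.SpecialLinear.singleSubSingle k.castSucc k.succ (1 : ℂ))
    (LieAlgebra.SpecialLinear.singleSubSingle l.castSucc l.succ (1 : ℂ)) 0 (by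
      rw [LieAlgebra.SpecialLinear.val_singleSubSingle,
        LieAlgebra.SpecialLinear.val_singleSubSingle, sub_mul, mul_sub, mul_sub, sub_mul, mul_sub,
        mul_sub, h l.castSucc, h l.castSucc, h l.succ, h l.succ,
        ZeroMemClass.coe_zero]
      abel)
  rw [map_zero, add_zero] at this
  exact this

variable (K : Type*) [Field K]

theorem kEdiv_val {a b : Fin (ℓ + 1)} (h : a ≠ b) (m : ℕ) :
    (kEdiv a b m : UC ℓ) = divPow (unitE a b h) m := by
  rw [kEdiv, dif_pos h]

theorem divPow_one {A : Type*} [Ring A] [Algebra ℂ A] (x : A) : divPow x 1 = x := by simp [divPow]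

theorem kHbin_zero_one (l : Fin ℓ) : (kHbin l 0 1 : UC ℓ) = cartanH l := by
  simp [kHbin, binom]

theorem commute_Ediv {a b c d : Fin (ℓ + 1)} (hab : a ≠ b) (hcd : c ≠ d) (hbc : b ≠ c)
    (had : a ≠ d) (m m' : ℕ) : Commute (Ediv K a b m) (Ediv K c d m') := by
  rw [Ediv_eq_ofKostant, Ediv_eq_ofKostant]
  refine Commute.map (Subtype.ext ?_) _
  rw [Subring.coe_mul, Subring.coe_mul, kEdiv_val hab, kEdiv_val hcd]
  exact commute_divPow (commute_unitE hab hcd hbc had) m m'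

theorem Ediv_zero {a b : Fin (ℓ + 1)} (hab : a ≠ b) : Ediv K a b 0 = 1 := by
  rw [Ediv_eq_ofKostant, ← map_one (ofKostant K ℓ)]
  congr 1
  refine Subtype.ext ?_
  rw [kEdiv_val hab, divPow_zero, Subring.coe_one]

theorem Ediv_one_mul {a b : Fin (ℓ + 1)} (hab : a ≠ b) (m : ℕ) :
    Ediv K a b 1 * Ediv K a b m = ((m + 1 : ℕ) : Hyper K ℓ) * Ediv K a b (m + 1) := by
  simp only [Ediv_eq_ofKostant]
  rw [← map_mul, ← map_natCast (ofKostant K ℓ), ← map_mul]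
  congr 1
  refine Subtype.ext ?_
  rw [Subring.coe_mul, Subring.coe_mul, kEdiv_val hab, kEdiv_val hab, kEdiv_val hab, divPow_one,
    ← divPow_succ, SubringClass.coe_natCast, ← nsmul_eq_mul, ← Nat.cast_smul_eq_nsmul ℂ]
  push_cast
  rfl

/-- Moving a root vector to the right past a divided power of another one. -/
theorem Ediv_one_mul_Ediv {a b c : Fin (ℓ + 1)} (hab : a ≠ b) (hbc : b ≠ c) (hac : a ≠ c) (m : ℕ) :
    Ediv K a b 1 * Ediv K b c (m + 1) =
      Ediv K b c (m + 1) * Ediv K a b 1 + Ediv K a c 1 * Ediv K b c m := by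
  simp only [Ediv_eq_ofKostant]
  simp only [← map_mul, ← map_add]
  congr 1
  refine Subtype.ext ?_
  rw [Subring.coe_add, Subring.coe_mul, Subring.coe_mul, Subring.coe_mul, kEdiv_val hab,
    kEdiv_val hbc, kEdiv_val hac, kEdiv_val hbc, divPow_one, divPow_one]
  exact mul_divPow_succ (unitE_mul_unitE hab hbc hac) (commute_unitE _ _ hbc.symm hac) m

/-- Moving a root vector to the right past a divided power of another one. -/
theorem Ediv_one_mul_Ediv' {a b d : Fin (ℓ + 1)} (hab : a ≠ b) (hda : d ≠ a) (hdb : d ≠ b)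
    (m : ℕ) :
    Ediv K a b 1 * Ediv K d a (m + 1) =
      Ediv K d a (m + 1) * Ediv K a b 1 + (-Ediv K d b 1) * Ediv K d a m := by
  simp only [Ediv_eq_ofKostant]
  simp only [← map_mul, ← map_neg, ← map_add]
  congr 1
  refine Subtype.ext ?_
  rw [Subring.coe_add, Subring.coe_mul, Subring.coe_mul, Subring.coe_mul, Subring.coe_neg,
    kEdiv_val hab, kEdiv_val hda, kEdiv_val hdb, kEdiv_val hda, divPow_one, divPow_one]
  refine mul_divPow_succ ?_ (commute_unitE _ _ hdb.symm hda).neg_left m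
  rw [unitE_mul_unitE hda hab hdb]
  abel

theorem Ediv_one_mul_Ediv_swap (l : Fin ℓ) (m : ℕ) :
    Ediv K l.castSucc l.succ 1 * Ediv K l.succ l.castSucc (m + 1) =
      Ediv K l.succ l.castSucc (m + 1) * Ediv K l.castSucc l.succ 1 +
        Ediv K l.succ l.castSucc m * (Hbin K l 0 1 - (m : Hyper K ℓ)) := by
  have hne : l.castSucc ≠ l.succ := Fin.castSucc_lt_succ.ne
  simp only [Ediv_eq_ofKostant, Hbin_eq_ofKostant]
  rw [← map_natCast (ofKostant K ℓ)]
  simp only [← map_mul, ← map_sub, ← map_add]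
  congr 1
  refine Subtype.ext ?_
  rw [Subring.coe_add, Subring.coe_mul, Subring.coe_mul, Subring.coe_mul, AddSubgroupClass.coe_sub,
    kEdiv_val hne, kEdiv_val hne.symm, kEdiv_val hne.symm, divPow_one, kHbin_zero_one,
    SubringClass.coe_natCast]
  refine e_mul_divPow unitE_mul_unitE_swap ?_ m
  rw [cartanH_mul_unitE, entryWeight, entryWeight]
  simp only [hne, hne.symm, if_true, if_false]
  congr 1
  push_cast
  noncomm_ring

theorem Hbin_mul_Ediv (l : Fin ℓ) {a b : Fin (ℓ + 1)} (hab : a ≠ b) (m : ℕ) :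
    Hbin K l 0 1 * Ediv K a b m =
      Ediv K a b m * (Hbin K l 0 1 +
        ((m * (entryWeight l a - entryWeight l b) : ℤ) : Hyper K ℓ)) := by
  simp only [Ediv_eq_ofKostant, Hbin_eq_ofKostant]
  rw [← map_intCast (ofKostant K ℓ)]
  simp only [← map_mul, ← map_add]
  congr 1
  refine Subtype.ext ?_
  rw [Subring.coe_mul, Subring.coe_mul, Subring.coe_add, kEdiv_val hab, kHbin_zero_one,
    SubringClass.coe_intCast]
  exact mul_divPow_of_weight _ (cartanH_mul_unitE l hab) m

theorem Ediv_mul_Hbin (k : Fin ℓ) {a b : Fin (ℓ + 1)} (hab : a ≠ b) (r : ℤ) (m : ℕ) :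
    Ediv K a b 1 * Hbin K k r m =
      Hbin K k (r - (entryWeight k a - entryWeight k b)) m * Ediv K a b 1 := by
  simp only [Ediv_eq_ofKostant, Hbin_eq_ofKostant]
  simp only [← map_mul]
  congr 1
  refine Subtype.ext ?_
  rw [Subring.coe_mul, Subring.coe_mul, kEdiv_val hab, divPow_one]
  refine mul_binom_of_weight _ ?_ r m
  have h := cartanH_mul_unitE k hab
  rw [sub_mul, h, mul_add, ← (Int.cast_commute _ (unitE a b hab)).eq]
  abel

theorem commute_Hbin (k l : Fin ℓ) (r r' : ℤ) (m m' : ℕ) :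
    Commute (Hbin K k r m) (Hbin K l r' m') := by
  refine Commute.map (x := kHbin k r m) (y := kHbin l r' m') (Subtype.ext ?_) (ofKostant K ℓ)
  refine commute_binom _ _ (Commute.symm (commute_binom _ _ ?_ _)) _
  exact ((commute_cartanH l k).add_left (Int.cast_commute _ _)).add_right (Int.cast_commute _ _).symm

theorem Hbin_mul_Hbin (l : Fin ℓ) (r : ℤ) (m : ℕ) :
    Hbin K l 0 1 * Hbin K l r m =
      ((m + 1 : ℕ) : Hyper K ℓ) * Hbin K l r (m + 1) + ((m - r : ℤ) : Hyper K ℓ) * Hbin K l r m := by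
  simp only [Hbin_eq_ofKostant]
  rw [← map_natCast (ofKostant K ℓ), ← map_intCast (ofKostant K ℓ)]
  simp only [← map_mul, ← map_add]
  congr 1
  refine Subtype.ext ?_
  rw [Subring.coe_mul, Subring.coe_add, Subring.coe_mul, Subring.coe_mul, kHbin_zero_one,
    SubringClass.coe_intCast, SubringClass.coe_natCast]
  exact self_mul_binom _ _ _

theorem Hbin_pascal (l : Fin ℓ) (r : ℤ) (m : ℕ) :
    Hbin K l (r + 1) (m + 1) = Hbin K l r (m + 1) + Hbin K l r m := by
  simp only [Hbin_eq_ofKostant, ← map_add]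
  congr 1
  refine Subtype.ext ?_
  rw [Subring.coe_add]
  show binom (cartanH l + ((r + 1 : ℤ) : UC ℓ)) (m + 1) = _
  rw [Int.cast_add, Int.cast_one, ← add_assoc, binom_pascal]
  rfl

theorem Hbin_zero (l : Fin ℓ) (r : ℤ) : Hbin K l r 0 = 1 := by
  rw [Hbin_eq_ofKostant, ← map_one (ofKostant K ℓ)]
  congr 1
  refine Subtype.ext ?_
  exact binom_zero _

end Relations

/-! ### Moving elements past ordered products -/

section ListProducts

variable {A ι : Type*} [Ring A]

theorem map_prod_update (x : ι → ℕ → A) (f g : ι → ℕ) (L : List ι)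
    (h : ∀ c ∈ L, f c = g c) :
    (L.map fun c => x c (f c)).prod = (L.map fun c => x c (g c)).prod := by
  congr 1
  exact List.map_congr_left fun c hc => by rw [h c hc]

variable [DecidableEq ι] in
/-- If `y x_c(m) = x_c(m) y + z_c x_c(m - 1)`, where the `z_c` commute with all `x_c(m)`, then
moving `y` to the right past a product of factors `x_c(f c)` gives one more summand for
every factor. -/
theorem mul_map_prod {x : ι → ℕ → A} {y : A} {z : ι → A} (L : List ι) (hL : L.Nodup)
    (h0 : ∀ c ∈ L, y * x c 0 = x c 0 * y)
    (hs : ∀ c ∈ L, ∀ m, y * x c (m + 1) = x c (m + 1) * y + z c * x c m)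
    (hz : ∀ c ∈ L, ∀ c' ∈ L, ∀ m, Commute (z c) (x c' m)) (f : ι → ℕ) :
    y * (L.map fun c => x c (f c)).prod = (L.map fun c => x c (f c)).prod * y +
      (L.map fun c => if f c = 0 then 0 else
        z c * (L.map fun c' => x c' ((f - Pi.single c 1 : ι → ℕ) c')).prod).sum := by
  induction L with
  | nil => simp
  | cons c L ih =>
    rw [List.nodup_cons] at hL
    have hy : y * x c (f c) = x c (f c) * y + if f c = 0 then 0 else z c * x c (f c - 1) := by
      split_ifs with h
      · rw [h, h0 c List.mem_cons_self, add_zero]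
      · obtain ⟨m, hm⟩ := Nat.exists_eq_succ_of_ne_zero h
        rw [hm]
        exact hs c List.mem_cons_self m
    rw [List.map_cons, List.prod_cons, ← mul_assoc, hy, add_mul, mul_assoc,
      ih hL.2 (fun c' hc' => h0 c' (List.mem_cons_of_mem _ hc'))
        (fun c' hc' => hs c' (List.mem_cons_of_mem _ hc'))
        fun c' hc' c'' hc'' => hz c' (List.mem_cons_of_mem _ hc') c'' (List.mem_cons_of_mem _ hc''),
      mul_add, List.map_cons, List.sum_cons, ← mul_assoc, add_assoc]
    congr 1
    rw [add_comm]
    congr 1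
    · rw [ite_mul, zero_mul]
      refine if_congr Iff.rfl rfl ?_
      rw [List.map_cons, List.prod_cons, mul_assoc]
      simp only [Pi.sub_apply, Pi.single_eq_same]
      congr 2
      refine map_prod_update x _ _ L fun c' hc' => ?_
      have : c' ≠ c := fun h => hL.1 (h ▸ hc')
      simp [this]
    · rw [← List.sum_map_mul_left]
      congr 1
      refine List.map_congr_left fun c' hc' => ?_
      rw [mul_ite, mul_zero]
      refine if_congr Iff.rfl rfl ?_
      have : c ≠ c' := fun h => hL.1 (h ▸ hc')
      rw [List.map_cons, List.prod_cons, ← mul_assoc, ← mul_assoc,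
        ← (hz c' (List.mem_cons_of_mem _ hc') c List.mem_cons_self (f c)).eq]
      simp [this]

theorem weight_mul_map_prod {x : ι → ℕ → A} {y : A} {w : ι → ℕ → ℤ} (L : List ι)
    (hx : ∀ c ∈ L, ∀ m, y * x c m = x c m * (y + (w c m : A))) (f : ι → ℕ) :
    y * (L.map fun c => x c (f c)).prod =
      (L.map fun c => x c (f c)).prod * (y + ((L.map fun c => w c (f c)).sum : ℤ)) := by
  induction L with
  | nil => simp
  | cons c L ih =>
    rw [List.map_cons, List.prod_cons, List.map_cons, List.sum_cons, ← mul_assoc,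
      hx c List.mem_cons_self, mul_assoc, add_mul,
      ih fun c' hc' => hx c' (List.mem_cons_of_mem _ hc'), (Int.cast_commute _ _).eq, ← mul_add,
      mul_assoc]
    congr 2
    push_cast
    abel

variable [DecidableEq ι] in
/-- If `y x_c(m) = (m + 1) x_c(m + 1)` for one of the factors of a product of commuting factors,
then multiplication by `y` raises the corresponding exponent. -/
theorem mul_map_prod_raise {x : ι → ℕ → A} {y : A} (c : ι) (L : List ι) (hL : L.Nodup) (hc : c ∈ L)
    (hy : ∀ m, y * x c m = ((m + 1 : ℕ) : A) * x c (m + 1))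
    (hcomm : ∀ c' ∈ L, ∀ m, Commute y (x c' m)) (f : ι → ℕ) :
    y * (L.map fun c => x c (f c)).prod =
      ((f c + 1 : ℕ) : A) * (L.map fun c' => x c' ((f + Pi.single c 1 : ι → ℕ) c')).prod := by
  induction L with
  | nil => simp at hc
  | cons a L ih =>
    rw [List.nodup_cons] at hL
    rw [List.map_cons, List.prod_cons, ← mul_assoc, List.map_cons, List.prod_cons]
    by_cases h : a = c
    · subst h
      rw [hy, mul_assoc]
      simp only [Pi.add_apply, Pi.single_eq_same]
      congr 2
      refine map_prod_update x _ _ L fun c' hc' => ?_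
      have : c' ≠ a := fun h => hL.1 (h ▸ hc')
      simp [this]
    · rw [(hcomm a List.mem_cons_self _).eq, mul_assoc,
        ih hL.2 ((List.mem_cons.1 hc).resolve_left (Ne.symm h))
          fun c' hc' => hcomm c' (List.mem_cons_of_mem _ hc'), ← mul_assoc,
        ← (Nat.cast_commute _ _).eq, mul_assoc]
      simp [h]

end ListProducts

/-! ### Rows of negative monomials -/

section Rows

variable (K : Type*) [Field K] {ℓ : ℕ}

/-- The part of a negative monomial that consists of the root vectors `E_{d,c}` with fixed `d`. -/
def rowMon (d : Fin (ℓ + 1)) (f : Fin (ℓ + 1) → ℕ) : Hyper K ℓ :=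
  (((List.finRange (ℓ + 1)).filter (fun c => c < d)).map fun c => Ediv K d c (f c)).prod

/-- The part of a negative monomial that consists of the rows in `L`. The exponent of `E_{d,c}` is
`N (c, d)`. -/
def rowsMon (L : List (Fin (ℓ + 1))) (N : Fin (ℓ + 1) × Fin (ℓ + 1) → ℕ) : Hyper K ℓ :=
  (L.map fun d => rowMon K d fun c => N (c, d)).prod

theorem negMon_eq_rowsMon (N : Fin (ℓ + 1) × Fin (ℓ + 1) → ℕ) :
    negMon K (fun c d => N (c, d)) = rowsMon K (List.finRange (ℓ + 1)) N := by
  unfold negMon rowsMon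
  rw [List.flatMap_def, List.prod_flatten, List.map_map]
  rfl

theorem mem_filter_lt {c d : Fin (ℓ + 1)} :
    c ∈ (List.finRange (ℓ + 1)).filter (fun c => c < d) ↔ c < d := by
  simp

theorem nodup_filter_lt (d : Fin (ℓ + 1)) :
    ((List.finRange (ℓ + 1)).filter (fun c => c < d)).Nodup :=
  (List.nodup_finRange _).filter _

theorem rowMon_congr {d : Fin (ℓ + 1)} {f g : Fin (ℓ + 1) → ℕ} (h : ∀ c, c < d → f c = g c) :
    rowMon K d f = rowMon K d g :=
  map_prod_update _ _ _ _ fun c hc => h c (mem_filter_lt.1 hc)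

theorem rowsMon_congr {L : List (Fin (ℓ + 1))} {N N' : Fin (ℓ + 1) × Fin (ℓ + 1) → ℕ}
    (h : ∀ d ∈ L, ∀ c, N (c, d) = N' (c, d)) : rowsMon K L N = rowsMon K L N' := by
  rw [rowsMon, rowsMon]
  congr 1
  exact List.map_congr_left fun d hd => rowMon_congr K fun c _ => h d hd c

theorem commute_rowMon (l : Fin ℓ) {d : Fin (ℓ + 1)} (hd : d ≤ l.castSucc)
    (f : Fin (ℓ + 1) → ℕ) : Commute (Ediv K l.castSucc l.succ 1) (rowMon K d f) := by
  refine Commute.list_prod_right _ _ fun x hx => ?_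
  obtain ⟨c, hc, rfl⟩ := List.mem_map.1 hx
  have hc := mem_filter_lt.1 hc
  have h1 : d < l.succ := hd.trans_lt Fin.castSucc_lt_succ
  exact commute_Ediv K Fin.castSucc_lt_succ.ne hc.ne' h1.ne' (hc.trans_le hd).ne' _ _

theorem Ediv_mul_rowMon {c d : Fin (ℓ + 1)} (hc : c < d) (f : Fin (ℓ + 1) → ℕ) :
    Ediv K d c 1 * rowMon K d f =
      ((f c + 1 : ℕ) : Hyper K ℓ) * rowMon K d (f + Pi.single c 1) := by
  refine mul_map_prod_raise (x := fun c m => Ediv K d c m) c _ (nodup_filter_lt d)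
    (mem_filter_lt.2 hc) (fun m => Ediv_one_mul K hc.ne' m) (fun c' hc' m => ?_) f
  have hc' := mem_filter_lt.1 hc'
  exact commute_Ediv K hc.ne' hc'.ne' hc.ne hc'.ne' _ _

theorem Ediv_mul_rowMon_of_gt (l : Fin ℓ) {d : Fin (ℓ + 1)} (hd : l.succ < d)
    (f : Fin (ℓ + 1) → ℕ) :
    Ediv K l.castSucc l.succ 1 * rowMon K d f = rowMon K d f * Ediv K l.castSucc l.succ 1 -
      if f l.castSucc = 0 then 0 else ((f l.succ + 1 : ℕ) : Hyper K ℓ) *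
        rowMon K d (f - Pi.single l.castSucc 1 + Pi.single l.succ 1) := by
  have hl : l.castSucc < l.succ := Fin.castSucc_lt_succ
  have hld : l.castSucc < d := hl.trans hd
  have key := mul_map_prod (x := fun c m => Ediv K d c m) (y := Ediv K l.castSucc l.succ 1)
    (z := fun c => if c = l.castSucc then -Ediv K d l.succ 1 else 0) _ (nodup_filter_lt d)
    (fun c hc => by
      simp only [Ediv_zero K (mem_filter_lt.1 hc).ne', one_mul, mul_one])
    (fun c hc m => by
      have hc := mem_filter_lt.1 hc
      split_ifs with h
      · subst h
        exact Ediv_one_mul_Ediv' K hl.ne hld.ne' hd.ne' m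
      · rw [zero_mul, add_zero]
        exact commute_Ediv K hl.ne hc.ne' hd.ne (Ne.symm h) _ _)
    (fun c hc c' hc' m => by
      have hc' := mem_filter_lt.1 hc'
      split_ifs
      · exact (commute_Ediv K hd.ne' hc'.ne' hd.ne hc'.ne' _ _).neg_left
      · exact Commute.zero_left _) f
  rw [rowMon, key, sub_eq_add_neg]
  congr 1
  rw [← List.sum_toFinset _ (nodup_filter_lt d), Finset.sum_eq_single l.castSucc]
  · rw [apply_ite Neg.neg, neg_zero]
    refine if_congr Iff.rfl rfl ?_
    rw [if_pos rfl]
    refine (neg_mul (Ediv K d l.succ 1) _).trans (congrArg Neg.neg ?_)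
    refine (Ediv_mul_rowMon K hd _).trans ?_
    simp [hl.ne']
  · intro c _ hc
    rw [if_neg hc, zero_mul, ite_self]
  · intro h
    exact absurd (List.mem_toFinset.2 (mem_filter_lt.2 hld)) h

theorem Hbin_mul_rowMon_of_gt (l : Fin ℓ) {d : Fin (ℓ + 1)} (hd : l.succ < d)
    (f : Fin (ℓ + 1) → ℕ) :
    Hbin K l 0 1 * rowMon K d f =
      rowMon K d f * (Hbin K l 0 1 + ((f l.succ - f l.castSucc : ℤ) : Hyper K ℓ)) := by
  have hl : l.castSucc < l.succ := Fin.castSucc_lt_succ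
  have hld : l.castSucc < d := hl.trans hd
  have key := weight_mul_map_prod (x := fun c m => Ediv K d c m) (y := Hbin K l 0 1)
    (w := fun c m => m * (entryWeight l d - entryWeight l c))
    ((List.finRange (ℓ + 1)).filter (fun c => c < d))
    (fun c hc m => Hbin_mul_Ediv K l (mem_filter_lt.1 hc).ne' m) f
  rw [rowMon, key]
  congr 3
  rw [← List.sum_toFinset _ (nodup_filter_lt d)]
  have h : ∀ c, (f c : ℤ) * (entryWeight l d - entryWeight l c) =
      (if c = l.succ then (f c : ℤ) else 0) - if c = l.castSucc then (f c : ℤ) else 0 := by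
    intro c
    simp only [entryWeight, hld.ne', hd.ne', if_false]
    split_ifs <;> ring
  simp only [h, Finset.sum_sub_distrib]
  rw [Finset.sum_ite_eq', Finset.sum_ite_eq', if_pos (List.mem_toFinset.2 (mem_filter_lt.2 hd)),
    if_pos (List.mem_toFinset.2 (mem_filter_lt.2 hld))]

theorem filter_lt_succ (l : Fin ℓ) :
    (List.finRange (ℓ + 1)).filter (fun c => c < l.succ) =
      (List.finRange (ℓ + 1)).filter (fun c => c < l.castSucc) ++ [l.castSucc] := by
  refine List.Perm.eq_of_pairwise (le := (· ≤ ·)) (fun a b _ _ h h' => le_antisymm h h') ?_ ?_ ?_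
  · exact (List.pairwise_le_finRange _).filter _
  · rw [List.pairwise_append]
    refine ⟨(List.pairwise_le_finRange _).filter _, List.pairwise_singleton _ _, ?_⟩
    intro a ha b hb
    rw [List.mem_singleton.1 hb]
    exact (mem_filter_lt.1 ha).le
  · refine (List.perm_ext_iff_of_nodup (nodup_filter_lt _) ?_).2 fun c => ?_
    · rw [List.nodup_append]
      refine ⟨nodup_filter_lt _, List.nodup_singleton _, ?_⟩
      intro a ha b hb
      rw [List.mem_singleton.1 hb]
      exact (mem_filter_lt.1 ha).ne
    · rw [List.mem_append, mem_filter_lt, mem_filter_lt, List.mem_singleton, ← le_iff_lt_or_eq,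
        Fin.lt_def, Fin.le_def]
      simp

set_option maxHeartbeats 800000 in
theorem Ediv_mul_rowMon_succ (l : Fin ℓ) (f : Fin (ℓ + 1) → ℕ) :
    Ediv K l.castSucc l.succ 1 * rowMon K l.succ f =
      rowMon K l.succ f * Ediv K l.castSucc l.succ 1 +
      (∑ c ∈ Finset.Iio l.castSucc, if f c = 0 then 0 else
        Ediv K l.castSucc c 1 * rowMon K l.succ (f - Pi.single c 1)) +
      if f l.castSucc = 0 then 0 else
        rowMon K l.succ (f - Pi.single l.castSucc 1) *
          (Hbin K l 0 1 + ((1 - f l.castSucc : ℤ) : Hyper K ℓ)) := by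
  have hl : l.castSucc < l.succ := Fin.castSucc_lt_succ
  have hlt : ∀ {c}, c ∈ (List.finRange (ℓ + 1)).filter (fun c => c < l.castSucc) → c < l.castSucc :=
    fun hc => mem_filter_lt.1 hc
  have key := mul_map_prod (x := fun c m => Ediv K l.succ c m) (y := Ediv K l.castSucc l.succ 1)
    (z := fun c => Ediv K l.castSucc c 1) _ (nodup_filter_lt l.castSucc)
    (fun c hc => by
      simp only [Ediv_zero K ((hlt hc).trans hl).ne', one_mul, mul_one])
    (fun c hc m => Ediv_one_mul_Ediv K hl.ne ((hlt hc).trans hl).ne' (hlt hc).ne' m)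
    (fun c hc c' hc' m => commute_Ediv K (hlt hc).ne' ((hlt hc').trans hl).ne'
      ((hlt hc).trans hl).ne (hlt hc').ne' _ _) f
  have hrow : ∀ g, rowMon K l.succ g =
      (((List.finRange (ℓ + 1)).filter (fun c => c < l.castSucc)).map
        fun c => Ediv K l.succ c (g c)).prod * Ediv K l.succ l.castSucc (g l.castSucc) := by
    intro g
    rw [rowMon, filter_lt_succ, List.map_append, List.prod_append]
    simp
  have hlast : Ediv K l.castSucc l.succ 1 * Ediv K l.succ l.castSucc (f l.castSucc) =
      Ediv K l.succ l.castSucc (f l.castSucc) * Ediv K l.castSucc l.succ 1 +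
      if f l.castSucc = 0 then 0 else Ediv K l.succ l.castSucc (f l.castSucc - 1) *
          (Hbin K l 0 1 + ((1 - f l.castSucc : ℤ) : Hyper K ℓ)) := by
    split_ifs with h
    · rw [h, Ediv_zero K hl.ne', one_mul, mul_one, add_zero]
    · obtain ⟨m, hm⟩ := Nat.exists_eq_succ_of_ne_zero h
      rw [hm, Nat.succ_eq_add_one, Ediv_one_mul_Ediv_swap, Nat.add_sub_cancel]
      congr 3
      push_cast
      abel
  rw [hrow f, ← mul_assoc, key, add_mul, mul_assoc, hlast, mul_add, ← mul_assoc, add_assoc, add_assoc]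
  congr 1
  rw [add_comm]
  congr 1
  · rw [← List.sum_map_mul_right, ← List.sum_toFinset _ (nodup_filter_lt _)]
    have : ((List.finRange (ℓ + 1)).filter (fun c => c < l.castSucc)).toFinset =
        Finset.Iio l.castSucc := by
      ext c; simp
    rw [this]
    refine Finset.sum_congr rfl fun c hc => ?_
    have hc := Finset.mem_Iio.1 hc
    rw [ite_mul, zero_mul]
    refine if_congr Iff.rfl rfl ?_
    rw [hrow, mul_assoc]
    simp [hc.ne']
  · rw [mul_ite, mul_zero]
    refine if_congr Iff.rfl rfl ?_
    rw [hrow, ← mul_assoc]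
    simp only [Pi.sub_apply, Pi.single_eq_same]
    congr 2
    refine map_prod_update _ _ _ _ fun c hc => ?_
    simp [(hlt hc).ne]

end Rows

/-! ### A model of the negative part -/

section Model

variable (K : Type*) [Field K] (ℓ : ℕ)

/-- A vector space with basis the exponents of negative monomials; the exponent of `E_{d,c}` is the
value at `(c, d)`. -/
abbrev NegSpace : Type _ := (Fin (ℓ + 1) × Fin (ℓ + 1) →₀ ℕ) →₀ K

variable {ℓ}

/-- The negative monomials as images of the basis vectors of the model. -/
def toHyper : NegSpace K ℓ →ₗ[K] Hyper K ℓ :=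
  Finsupp.linearCombination K fun N => negMon K (fun c d => N (c, d))

theorem toHyper_single (N : Fin (ℓ + 1) × Fin (ℓ + 1) →₀ ℕ) (a : K) :
    toHyper K (Finsupp.single N a) = a • rowsMon K (List.finRange (ℓ + 1)) N := by
  rw [toHyper, Finsupp.linearCombination_single, negMon_eq_rowsMon]

/-- The operator that lowers the exponents by `e`, with the value zero if this is impossible. -/
def lowerBy (e : Fin (ℓ + 1) × Fin (ℓ + 1) →₀ ℕ) : Module.End K (NegSpace K ℓ) :=
  Finsupp.linearCombination K fun N => if e ≤ N then Finsupp.single (N - e) 1 else 0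

theorem lowerBy_single (e N : Fin (ℓ + 1) × Fin (ℓ + 1) →₀ ℕ) (a : K) :
    lowerBy K e (Finsupp.single N a) = if e ≤ N then Finsupp.single (N - e) a else 0 := by
  rw [lowerBy, Finsupp.linearCombination_single]
  split_ifs <;> simp

/-- The operator that lowers the exponent at `p` by one. -/
def lower (p : Fin (ℓ + 1) × Fin (ℓ + 1)) : Module.End K (NegSpace K ℓ) :=
  lowerBy K (Finsupp.single p 1)

theorem lower_single (p : Fin (ℓ + 1) × Fin (ℓ + 1)) (N : Fin (ℓ + 1) × Fin (ℓ + 1) →₀ ℕ) (a : K) :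
    lower K p (Finsupp.single N a) =
      if N p = 0 then 0 else Finsupp.single (N - Finsupp.single p 1) a := by
  rw [lower, lowerBy_single]
  simp only [Finsupp.single_le_iff, Nat.one_le_iff_ne_zero, ite_not]

/-- Multiplication of divided powers by the variable `p`. -/
def raise (p : Fin (ℓ + 1) × Fin (ℓ + 1)) : Module.End K (NegSpace K ℓ) :=
  Finsupp.linearCombination K fun N => Finsupp.single (N + Finsupp.single p 1) (N p + 1 : K)

theorem raise_single (p : Fin (ℓ + 1) × Fin (ℓ + 1)) (N : Fin (ℓ + 1) × Fin (ℓ + 1) →₀ ℕ) (a : K) :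
    raise K p (Finsupp.single N a) =
      Finsupp.single (N + Finsupp.single p 1) (((N p + 1 : ℕ) : K) * a) := by
  rw [raise, Finsupp.linearCombination_single, Finsupp.smul_single, smul_eq_mul, mul_comm]
  push_cast
  rfl

theorem raise_lower_single (p : Fin (ℓ + 1) × Fin (ℓ + 1))
    (N : Fin (ℓ + 1) × Fin (ℓ + 1) →₀ ℕ) (a : K) :
    raise K p (lower K p (Finsupp.single N a)) = Finsupp.single N ((N p : K) * a) := by
  rw [lower_single]
  split_ifs with h
  · simp [h]
  · have h1 : Finsupp.single p 1 ≤ N := Finsupp.single_le_iff.2 (Nat.one_le_iff_ne_zero.2 h)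
    rw [raise_single, tsub_add_cancel_of_le h1]
    congr 2
    simp only [Finsupp.tsub_apply, Finsupp.single_eq_same]
    congr 1
    omega

/-- The part without Cartan elements of the operator `η_l`. -/
def etaNeg (l : Fin ℓ) : Module.End K (NegSpace K ℓ) :=
  ∑ c ∈ Finset.Iio l.castSucc, raise K (c, l.castSucc) * lower K (c, l.succ) -
    ∑ d ∈ Finset.Ioi l.succ, raise K (l.succ, d) * lower K (l.castSucc, d) +
    lower K (l.castSucc, l.succ) *
      (1 - ∑ d ∈ Finset.Ioi l.castSucc, raise K (l.castSucc, d) * lower K (l.castSucc, d) +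
        ∑ d ∈ Finset.Ioi l.succ, raise K (l.succ, d) * lower K (l.succ, d))

end Model

section Commutation

/-- The way an element `e` passes the four factors of a monomial; the third one produces an element
`h`, which is then moved past the fourth one. -/
theorem mul_four_eq {A : Type*} [Ring A] {e x y z w s t z' h : A} {k k' : ℤ}
    (hx : Commute e x) (hy : Commute e y) (hz : e * z = z * e + s + z' * (h + (k : A)))
    (hw : e * w = w * e - t) (hh : h * w = w * (h + (k' : A))) :
    e * (x * (y * (z * w))) = x * (y * (s * w)) - x * (y * (z * t)) +
      x * (y * (z' * w)) * ((k + k' : ℤ) : A) + x * (y * (z' * w)) * h +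
      x * (y * (z * w)) * e := by
  have h1 : e * (z * w) = s * w - z * t + z' * w * ((k + k' : ℤ) : A) + z' * w * h + z * w * e := by
    rw [← mul_assoc, hz, add_mul, add_mul, mul_assoc, hw, mul_assoc z', add_mul, hh,
      (Int.cast_commute k w).eq]
    push_cast
    noncomm_ring
  rw [← mul_assoc, hx.eq, mul_assoc, ← mul_assoc e y, hy.eq, mul_assoc, h1]
  noncomm_ring

theorem finRange_split (ℓ : ℕ) (l : Fin ℓ) : ∃ L₁ L₂ : List (Fin (ℓ + 1)),
    List.finRange (ℓ + 1) = L₁ ++ l.castSucc :: l.succ :: L₂ ∧ (∀ d ∈ L₁, d < l.castSucc) ∧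
      (∀ d, d ∈ L₂ ↔ l.succ < d) ∧ L₂.Nodup := by
  obtain ⟨L₁, L, h⟩ := List.append_of_mem (List.mem_finRange l.castSucc)
  have hs := List.pairwise_lt_finRange (ℓ + 1)
  rw [h, List.pairwise_append, List.pairwise_cons] at hs
  have hlt : ∀ d ∈ L₁, d < l.castSucc := fun d hd => hs.2.2 d hd _ List.mem_cons_self
  have hmem : l.succ ∈ L := by
    have : l.succ ∈ L₁ ++ l.castSucc :: L := h ▸ List.mem_finRange _
    rw [List.mem_append, List.mem_cons] at this
    rcases this with h1 | h1 | h1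
    · exact absurd ((hlt _ h1).trans Fin.castSucc_lt_succ) (lt_irrefl _)
    · exact absurd h1 Fin.castSucc_lt_succ.ne'
    · exact h1
  cases L with
  | nil => simp at hmem
  | cons d L₂ =>
    have hd : d = l.succ := by
      have h1 : l.castSucc < d := hs.2.1.1 d List.mem_cons_self
      have h2 : d ≤ l.succ := by
        rcases List.mem_cons.1 hmem with h2 | h2
        · exact h2.ge
        · exact ((List.pairwise_cons.1 hs.2.1.2).1 _ h2).le
      refine le_antisymm h2 ?_
      rw [Fin.lt_def] at h1
      rw [Fin.le_def]
      simpa using h1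
    subst hd
    have hs2 := List.pairwise_cons.1 hs.2.1.2
    refine ⟨L₁, L₂, h, hlt, fun x => ⟨fun hx => hs2.1 x hx, fun hx => ?_⟩,
      hs2.2.imp fun hab => hab.ne⟩
    have : x ∈ L₁ ++ l.castSucc :: l.succ :: L₂ := h ▸ List.mem_finRange _
    rw [List.mem_append, List.mem_cons, List.mem_cons] at this
    rcases this with h1 | h1 | h1 | h1
    · exact absurd ((hlt _ h1).trans (Fin.castSucc_lt_succ.trans hx)) (lt_irrefl _)
    · exact absurd h1 (Fin.castSucc_lt_succ.trans hx).ne'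
    · exact absurd h1 hx.ne'
    · exact h1

variable (K : Type*) [Field K] {ℓ : ℕ}

theorem rowsMon_cons (d : Fin (ℓ + 1)) (L : List (Fin (ℓ + 1)))
    (N : Fin (ℓ + 1) × Fin (ℓ + 1) → ℕ) :
    rowsMon K (d :: L) N = rowMon K d (fun c => N (c, d)) * rowsMon K L N := by
  rw [rowsMon, List.map_cons, List.prod_cons, rowsMon]

theorem rowsMon_append (L L' : List (Fin (ℓ + 1))) (N : Fin (ℓ + 1) × Fin (ℓ + 1) → ℕ) :
    rowsMon K (L ++ L') N = rowsMon K L N * rowsMon K L' N := by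
  rw [rowsMon, List.map_append, List.prod_append, rowsMon, rowsMon]

theorem commute_rowsMon (l : Fin ℓ) {L : List (Fin (ℓ + 1))} (hL : ∀ d ∈ L, d < l.castSucc)
    (N : Fin (ℓ + 1) × Fin (ℓ + 1) → ℕ) :
    Commute (Ediv K l.castSucc l.succ 1) (rowsMon K L N) := by
  refine Commute.list_prod_right _ _ fun x hx => ?_
  obtain ⟨d, hd, rfl⟩ := List.mem_map.1 hx
  exact commute_rowMon K l (hL d hd).le _

theorem Hbin_mul_rowsMon (l : Fin ℓ) {L : List (Fin (ℓ + 1))} (hL : ∀ d ∈ L, l.succ < d)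
    (N : Fin (ℓ + 1) × Fin (ℓ + 1) → ℕ) :
    Hbin K l 0 1 * rowsMon K L N = rowsMon K L N * (Hbin K l 0 1 +
      (((L.map fun d => (N (l.succ, d) : ℤ) - N (l.castSucc, d)).sum : ℤ) : Hyper K ℓ)) := by
  induction L with
  | nil => simp [rowsMon]
  | cons d L ih =>
    rw [rowsMon_cons, ← mul_assoc, Hbin_mul_rowMon_of_gt K l (hL d List.mem_cons_self), mul_assoc,
      add_mul, ih fun d' hd' => hL d' (List.mem_cons_of_mem _ hd'),
      (Int.cast_commute _ (rowsMon K L N)).eq, ← mul_add, mul_assoc, List.map_cons, List.sum_cons]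
    congr 2
    push_cast
    abel

theorem Ediv_mul_rowsMon (l : Fin ℓ) {L : List (Fin (ℓ + 1))} (hnd : L.Nodup)
    (hL : ∀ d ∈ L, l.succ < d) (N : Fin (ℓ + 1) × Fin (ℓ + 1) →₀ ℕ) :
    Ediv K l.castSucc l.succ 1 * rowsMon K L N = rowsMon K L N * Ediv K l.castSucc l.succ 1 -
      (L.map fun d => if N (l.castSucc, d) = 0 then 0 else
        ((N (l.succ, d) + 1 : ℕ) : Hyper K ℓ) * rowsMon K L
          (N - Finsupp.single (l.castSucc, d) 1 + Finsupp.single (l.succ, d) 1 :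
            Fin (ℓ + 1) × Fin (ℓ + 1) →₀ ℕ)).sum := by
  induction L with
  | nil => simp [rowsMon]
  | cons d L ih =>
    rw [List.nodup_cons] at hnd
    rw [rowsMon_cons, ← mul_assoc, Ediv_mul_rowMon_of_gt K l (hL d List.mem_cons_self), sub_mul,
      mul_assoc, ih hnd.2 fun d' hd' => hL d' (List.mem_cons_of_mem _ hd'), mul_sub, ← mul_assoc,
      List.map_cons, List.sum_cons, sub_sub,
      add_comm ((rowMon K d fun c => N (c, d)) * _)]
    congr 2
    · rw [ite_mul, zero_mul]
      refine if_congr Iff.rfl rfl ?_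
      rw [mul_assoc, rowsMon_cons]
      congr 2
      · refine rowMon_congr K fun c _ => ?_
        simp [Finsupp.single_apply, Pi.single_apply, eq_comm]
      · refine rowsMon_congr K fun d' hd' c => ?_
        have : d ≠ d' := fun h => hnd.1 (h ▸ hd')
        simp [this]
    · rw [← List.sum_map_mul_left]
      congr 1
      refine List.map_congr_left fun d' hd' => ?_
      rw [mul_ite, mul_zero]
      refine if_congr Iff.rfl rfl ?_
      rw [← mul_assoc, ← (Nat.cast_commute _ _).eq, mul_assoc, rowsMon_cons]
      congr 2
      refine rowMon_congr K fun c _ => ?_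
      have : d' ≠ d := fun h => hnd.1 (h ▸ hd')
      simp [this]

theorem mul_natCast_mul_three {A : Type*} [Ring A] (x y z t : A) (n : ℕ) :
    x * (y * (z * ((n : A) * t))) = (n : A) * (x * (y * (z * t))) := by
  rw [← mul_assoc z, ← (Nat.cast_commute n z).eq, mul_assoc, ← mul_assoc y,
    ← (Nat.cast_commute n y).eq, mul_assoc, ← mul_assoc x, ← (Nat.cast_commute n x).eq, mul_assoc]

theorem mul_raise_mul_three {A : Type*} [Ring A] {x y y' e z w : A} {n : ℕ} (h : Commute y e)
    (h' : e * y = (n : A) * y') :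
    x * (y * (e * z * w)) = (n : A) * (x * (y' * (z * w))) := by
  rw [mul_assoc e, ← mul_assoc y, h.eq, h', mul_assoc, ← mul_assoc x, ← (Nat.cast_commute n x).eq,
    mul_assoc]

/-- The monomial with the rows in `L₁`, the rows `l` and `l + 1`, and the rows in `L₂`. -/
def splitMon (L₁ L₂ : List (Fin (ℓ + 1))) (l : Fin ℓ) (N : Fin (ℓ + 1) × Fin (ℓ + 1) → ℕ) :
    Hyper K ℓ :=
  rowsMon K L₁ N * (rowMon K l.castSucc (fun c => N (c, l.castSucc)) *
    (rowMon K l.succ (fun c => N (c, l.succ)) * rowsMon K L₂ N))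

section

variable {l : Fin ℓ} {L₁ L₂ : List (Fin (ℓ + 1))}
  (N : Fin (ℓ + 1) × Fin (ℓ + 1) →₀ ℕ)

theorem splitMon_lower (h₁ : ∀ d ∈ L₁, d < l.castSucc) (h₂ : ∀ d ∈ L₂, l.succ < d) :
    rowsMon K L₁ N * (rowMon K l.castSucc (fun c => N (c, l.castSucc)) *
      (rowMon K l.succ ((fun c => N (c, l.succ)) - Pi.single l.castSucc 1) * rowsMon K L₂ N)) =
      splitMon K L₁ L₂ l (N - Finsupp.single (l.castSucc, l.succ) 1 :
        Fin (ℓ + 1) × Fin (ℓ + 1) →₀ ℕ) := by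
  have hl : l.castSucc < l.succ := Fin.castSucc_lt_succ
  rw [splitMon]
  congr 1
  · refine rowsMon_congr K fun d hd c => ?_
    have : l.succ ≠ d := ((h₁ d hd).trans hl).ne'
    simp [this]
  congr 1
  · refine rowMon_congr K fun c _ => ?_
    simp [hl.ne']
  congr 1
  · refine rowMon_congr K fun c _ => ?_
    simp [Finsupp.single_apply, Pi.single_apply, eq_comm]
  · refine rowsMon_congr K fun d hd c => ?_
    have : l.succ ≠ d := (h₂ d hd).ne
    simp [this]

theorem splitMon_move_row (h₁ : ∀ d ∈ L₁, d < l.castSucc) (h₂ : ∀ d ∈ L₂, l.succ < d)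
    {c : Fin (ℓ + 1)} (hc : c < l.castSucc) :
    rowsMon K L₁ N * (rowMon K l.castSucc (fun c => N (c, l.castSucc)) *
      (Ediv K l.castSucc c 1 * rowMon K l.succ ((fun c => N (c, l.succ)) - Pi.single c 1) *
        rowsMon K L₂ N)) =
      ((N (c, l.castSucc) + 1 : ℕ) : Hyper K ℓ) * splitMon K L₁ L₂ l
        (N - Finsupp.single (c, l.succ) 1 + Finsupp.single (c, l.castSucc) 1 :
          Fin (ℓ + 1) × Fin (ℓ + 1) →₀ ℕ) := by
  have hl : l.castSucc < l.succ := Fin.castSucc_lt_succ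
  have hcomm : Commute (rowMon K l.castSucc (fun c => N (c, l.castSucc)))
      (Ediv K l.castSucc c 1) := by
    refine Commute.list_prod_left _ _ fun x hx => ?_
    obtain ⟨c', hc', rfl⟩ := List.mem_map.1 hx
    have hc' := mem_filter_lt.1 hc'
    exact commute_Ediv K hc'.ne' hc.ne' hc'.ne hc.ne' _ _
  rw [mul_raise_mul_three hcomm (Ediv_mul_rowMon K hc _), splitMon]
  congr 1
  congr 1
  · refine rowsMon_congr K fun d hd c => ?_
    have h1 : l.succ ≠ d := ((h₁ d hd).trans hl).ne'
    have h2 : l.castSucc ≠ d := (h₁ d hd).ne'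
    simp [h1, h2]
  congr 1
  · refine rowMon_congr K fun c' _ => ?_
    simp [Finsupp.single_apply, Pi.single_apply, hl.ne', eq_comm]
  congr 1
  · refine rowMon_congr K fun c' _ => ?_
    simp [Finsupp.single_apply, Pi.single_apply, hl.ne, eq_comm]
  · refine rowsMon_congr K fun d hd c => ?_
    have h1 : l.succ ≠ d := (h₂ d hd).ne
    have h2 : l.castSucc ≠ d := (hl.trans (h₂ d hd)).ne
    simp [h1, h2]

theorem splitMon_move_column (h₁ : ∀ d ∈ L₁, d < l.castSucc) {d : Fin (ℓ + 1)} (hd : l.succ < d)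
    (n : ℕ) :
    rowsMon K L₁ N * (rowMon K l.castSucc (fun c => N (c, l.castSucc)) *
      (rowMon K l.succ (fun c => N (c, l.succ)) * ((n : Hyper K ℓ) * rowsMon K L₂
        (N - Finsupp.single (l.castSucc, d) 1 + Finsupp.single (l.succ, d) 1 :
          Fin (ℓ + 1) × Fin (ℓ + 1) →₀ ℕ)))) =
      (n : Hyper K ℓ) * splitMon K L₁ L₂ l
        (N - Finsupp.single (l.castSucc, d) 1 + Finsupp.single (l.succ, d) 1 :
          Fin (ℓ + 1) × Fin (ℓ + 1) →₀ ℕ) := by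
  have hl : l.castSucc < l.succ := Fin.castSucc_lt_succ
  rw [mul_natCast_mul_three, splitMon]
  congr 1
  congr 1
  · refine rowsMon_congr K fun d' hd' c => ?_
    have h1 : d ≠ d' := ((h₁ d' hd').trans (hl.trans hd)).ne'
    simp [h1]
  congr 1
  · refine rowMon_congr K fun c' _ => ?_
    simp [(hl.trans hd).ne']
  congr 1
  refine rowMon_congr K fun c' _ => ?_
  simp [hd.ne']

end

theorem sum_raise_lower_single (x : Fin (ℓ + 1)) (s : Finset (Fin (ℓ + 1)))
    (N : Fin (ℓ + 1) × Fin (ℓ + 1) →₀ ℕ) :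
    (∑ d ∈ s, raise K (x, d) * lower K (x, d)) (Finsupp.single N 1) =
      ((∑ d ∈ s, (N (x, d) : ℤ) : ℤ) : K) • Finsupp.single N (1 : K) := by
  rw [LinearMap.sum_apply, Int.cast_sum, Finset.sum_smul]
  refine Finset.sum_congr rfl fun d _ => ?_
  rw [Module.End.mul_apply, raise_lower_single, Finsupp.smul_single, smul_eq_mul, Int.cast_natCast]

theorem cartanShift_single (l : Fin ℓ) {L₂ : List (Fin (ℓ + 1))} (hnd : L₂.Nodup)
    (hL₂ : L₂.toFinset = Finset.Ioi l.succ) (N : Fin (ℓ + 1) × Fin (ℓ + 1) →₀ ℕ) :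
    (1 - ∑ d ∈ Finset.Ioi l.castSucc, raise K (l.castSucc, d) * lower K (l.castSucc, d) +
      ∑ d ∈ Finset.Ioi l.succ, raise K (l.succ, d) * lower K (l.succ, d)) (Finsupp.single N 1) =
      ((1 - N (l.castSucc, l.succ) + (L₂.map fun d => (N (l.succ, d) : ℤ) -
        N (l.castSucc, d)).sum : ℤ) : K) • Finsupp.single N (1 : K) := by
  have hins : Finset.Ioi l.castSucc = insert l.succ (Finset.Ioi l.succ) := by
    ext d
    rw [Finset.mem_insert, Finset.mem_Ioi, Finset.mem_Ioi, eq_comm (a := d), or_comm,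
      ← le_iff_lt_or_eq, Fin.lt_def, Fin.le_def]
    simp
  rw [LinearMap.add_apply, LinearMap.sub_apply, sum_raise_lower_single, sum_raise_lower_single,
    Module.End.one_apply, ← List.sum_toFinset _ hnd, hL₂, hins, Finset.sum_insert (by simp),
    Finset.sum_sub_distrib]
  push_cast
  module

set_option maxHeartbeats 800000 in
/-- Moving a simple root vector to the right past a negative monomial. -/
theorem Ediv_mul_toHyper_single (l : Fin ℓ) (N : Fin (ℓ + 1) × Fin (ℓ + 1) →₀ ℕ) :
    Ediv K l.castSucc l.succ 1 * toHyper K (Finsupp.single N 1) =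
      toHyper K (etaNeg K l (Finsupp.single N 1)) +
      toHyper K (lower K (l.castSucc, l.succ) (Finsupp.single N 1)) * Hbin K l 0 1 +
      toHyper K (Finsupp.single N 1) * Ediv K l.castSucc l.succ 1 := by
  obtain ⟨L₁, L₂, hsplit, h₁, h₂', hnd⟩ := finRange_split ℓ l
  have h₂ : ∀ d ∈ L₂, l.succ < d := fun d hd => (h₂' d).1 hd
  have hfull : ∀ N : Fin (ℓ + 1) × Fin (ℓ + 1) → ℕ, rowsMon K (List.finRange (ℓ + 1)) N =
      splitMon K L₁ L₂ l N := by
    intro N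
    rw [hsplit, rowsMon_append, rowsMon_cons, rowsMon_cons, splitMon]
  have hL₂ : L₂.toFinset = Finset.Ioi l.succ := by
    ext d
    rw [List.mem_toFinset, h₂', Finset.mem_Ioi]
  have key := mul_four_eq (commute_rowsMon K l h₁ N)
    (commute_rowMon K l le_rfl fun c => N (c, l.castSucc))
    (s := ∑ c ∈ Finset.Iio l.castSucc, if N (c, l.succ) = 0 then 0 else
        Ediv K l.castSucc c 1 * rowMon K l.succ ((fun c => N (c, l.succ)) - Pi.single c 1))
    (z' := if N (l.castSucc, l.succ) = 0 then 0 else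
        rowMon K l.succ ((fun c => N (c, l.succ)) - Pi.single l.castSucc 1))
    (h := Hbin K l 0 1) (k := 1 - N (l.castSucc, l.succ))
    ((Ediv_mul_rowMon_succ K l fun c => N (c, l.succ)).trans (by rw [ite_mul, zero_mul]))
    (Ediv_mul_rowsMon K l hnd h₂ N)
    (Hbin_mul_rowsMon K l h₂ N)
  have hmid : rowsMon K L₁ N * (rowMon K l.castSucc (fun c => N (c, l.castSucc)) *
      ((if N (l.castSucc, l.succ) = 0 then 0 else
        rowMon K l.succ ((fun c => N (c, l.succ)) - Pi.single l.castSucc 1)) * rowsMon K L₂ N)) =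
      toHyper K (lower K (l.castSucc, l.succ) (Finsupp.single N 1)) := by
    rw [lower_single]
    split_ifs with h
    · simp only [zero_mul, mul_zero, map_zero]
    · rw [toHyper_single, one_smul, hfull, splitMon_lower K N h₁ h₂]
  have hrow : rowsMon K L₁ N * (rowMon K l.castSucc (fun c => N (c, l.castSucc)) *
      ((∑ c ∈ Finset.Iio l.castSucc, if N (c, l.succ) = 0 then 0 else
        Ediv K l.castSucc c 1 * rowMon K l.succ ((fun c => N (c, l.succ)) - Pi.single c 1)) *
          rowsMon K L₂ N)) =
      toHyper K ((∑ c ∈ Finset.Iio l.castSucc, raise K (c, l.castSucc) * lower K (c, l.succ))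
        (Finsupp.single N 1)) := by
    rw [LinearMap.sum_apply, map_sum, Finset.sum_mul, Finset.mul_sum, Finset.mul_sum]
    refine Finset.sum_congr rfl fun c hc => ?_
    have hc := Finset.mem_Iio.1 hc
    rw [Module.End.mul_apply, lower_single]
    split_ifs with h
    · simp only [zero_mul, mul_zero, map_zero]
    · rw [raise_single, toHyper_single, hfull, mul_one, Nat.cast_smul_eq_nsmul, nsmul_eq_mul,
        splitMon_move_row K N h₁ h₂ hc]
      simp [(Fin.castSucc_lt_succ (i := l)).ne']
  have hcol : rowsMon K L₁ N * (rowMon K l.castSucc (fun c => N (c, l.castSucc)) *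
      (rowMon K l.succ (fun c => N (c, l.succ)) *
        (L₂.map fun d => if N (l.castSucc, d) = 0 then 0 else
          ((N (l.succ, d) + 1 : ℕ) : Hyper K ℓ) * rowsMon K L₂
            (N - Finsupp.single (l.castSucc, d) 1 + Finsupp.single (l.succ, d) 1 :
              Fin (ℓ + 1) × Fin (ℓ + 1) →₀ ℕ)).sum)) =
      toHyper K ((∑ d ∈ Finset.Ioi l.succ, raise K (l.succ, d) * lower K (l.castSucc, d))
        (Finsupp.single N 1)) := by
    rw [LinearMap.sum_apply, map_sum, ← List.sum_toFinset _ hnd, hL₂, Finset.mul_sum,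
      Finset.mul_sum, Finset.mul_sum]
    refine Finset.sum_congr rfl fun d hd => ?_
    have hd := Finset.mem_Ioi.1 hd
    rw [Module.End.mul_apply, lower_single]
    split_ifs with h
    · simp only [mul_zero, map_zero]
    · rw [raise_single, toHyper_single, hfull, mul_one, Nat.cast_smul_eq_nsmul, nsmul_eq_mul,
        splitMon_move_column K N h₁ hd]
      simp [(Fin.castSucc_lt_succ (i := l)).ne]
  rw [hmid, hrow, hcol] at key
  rw [toHyper_single K N 1, one_smul, hfull, splitMon, key, etaNeg, LinearMap.add_apply, map_add,
    LinearMap.sub_apply, map_sub, Module.End.mul_apply, cartanShift_single K l hnd hL₂ N, map_smul,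
    map_smul, Int.cast_smul_eq_zsmul, zsmul_eq_mul']

/-- Moving a simple root vector to the right past the negative part. -/
theorem Ediv_mul_toHyper (l : Fin ℓ) (v : NegSpace K ℓ) :
    Ediv K l.castSucc l.succ 1 * toHyper K v = toHyper K (etaNeg K l v) +
      toHyper K (lower K (l.castSucc, l.succ) v) * Hbin K l 0 1 +
      toHyper K v * Ediv K l.castSucc l.succ 1 := by
  induction v using Finsupp.induction_linear with
  | zero => simp
  | add v w hv hw =>
    simp only [map_add, mul_add, add_mul, hv, hw]
    abel
  | single N a =>
    have : Finsupp.single N a = a • Finsupp.single N (1 : K) := by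
      rw [Finsupp.smul_single, smul_eq_mul, mul_one]
    simp only [this, map_smul, mul_smul_comm, smul_mul_assoc, Ediv_mul_toHyper_single, smul_add]

end Commutation

/-! ### Polynomials in the lowering operators -/

section Commutators

variable {A : Type*} [Ring A]

theorem commutator_mul_left {x y z s : A} (hx : x * z - z * x = s) (hy : Commute y z) :
    x * y * z - z * (x * y) = s * y := by
  rw [mul_assoc, hy.eq, ← hx, sub_mul, mul_assoc, mul_assoc]

theorem ite_neg_one_mul (P : Prop) [Decidable P] (x : A) :
    (if P then -1 else 0) * x = if P then -x else 0 := by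
  split_ifs <;> simp

theorem commutator_sum {ι : Type*} (s : Finset ι) {f g : ι → A} {z : A}
    (h : ∀ i ∈ s, f i * z - z * f i = g i) :
    (∑ i ∈ s, f i) * z - z * ∑ i ∈ s, f i = ∑ i ∈ s, g i := by
  rw [Finset.sum_mul, Finset.mul_sum, ← Finset.sum_sub_distrib]
  exact Finset.sum_congr rfl h

theorem commutator_combination {x y z s b q x' y' z' s' : A} (hx : x * q - q * x = x')
    (hy : y * q - q * y = y') (hz : z * q - q * z = z') (hs : s * q - q * s = s')
    (hb : Commute b q) :
    (x - y + b * (1 - z + s)) * q - q * (x - y + b * (1 - z + s)) = x' - y' + b * (s' - z') := by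
  have h : (x - y + b * (1 - z + s)) * q - q * (x - y + b * (1 - z + s)) =
      (x * q - q * x) - (y * q - q * y) + b * ((s * q - q * s) - (z * q - q * z)) +
        (b * q - q * b) * (1 - z + s) := by
    noncomm_ring
  rw [h, hx, hy, hz, hs, hb.eq, sub_self, zero_mul, add_zero]

theorem commutator_mul_right {x p y p' y' : A} (hp : x * p - p * x = p')
    (hy : x * y - y * x = y') (hc : Commute y p') :
    x * (p * y) - p * y * x = p * y' + y * p' := by
  rw [hc.eq, ← hp, ← hy]
  noncomm_ring

theorem commutator_add {x p y p' y' : A} (hp : x * p - p * x = p') (hy : x * y - y * x = y') :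
    x * (p + y) - (p + y) * x = p' + y' := by
  rw [← hp, ← hy]
  noncomm_ring

theorem commutator_of_commute {x y : A} (h : Commute y x) : x * y - y * x = 0 := by
  rw [h.eq, sub_self]

theorem ite_commutator_combination (P Q R : Prop) [Decidable P] [Decidable Q] [Decidable R]
    (x y z b : A) :
    (if P then -x else 0) - (if Q then -y else 0) +
        b * ((if Q then -z else 0) - (if R then -y else 0)) =
      (if P then -x else 0) + (if Q then y - b * z else 0) + (if R then b * y else 0) := by
  split_ifs <;> noncomm_ring

end Commutators

section Weyl

open MvPolynomial

variable (K : Type*) [Field K] {ℓ : ℕ}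

theorem lowerBy_zero : lowerBy (ℓ := ℓ) K 0 = 1 := by
  refine Finsupp.lhom_ext fun N a => ?_
  rw [lowerBy_single, if_pos zero_le, tsub_zero, Module.End.one_apply]

theorem lowerBy_add (e e' : Fin (ℓ + 1) × Fin (ℓ + 1) →₀ ℕ) :
    lowerBy K (e + e') = lowerBy K e * lowerBy K e' := by
  refine Finsupp.lhom_ext fun N a => ?_
  rw [Module.End.mul_apply, lowerBy_single, lowerBy_single]
  by_cases h : e' ≤ N
  · rw [if_pos h, lowerBy_single, add_comm e e', tsub_add_eq_tsub_tsub]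
    exact if_congr (by rw [le_tsub_iff_left h]) rfl rfl
  · rw [if_neg h, map_zero, if_neg fun h' => h (le_trans le_add_self h')]

/-- The action of polynomials on the model in which the variables act as the lowering operators. -/
def act (ℓ : ℕ) : MvPolynomial (Fin (ℓ + 1) × Fin (ℓ + 1)) K →ₐ[K] Module.End K (NegSpace K ℓ) :=
  AddMonoidAlgebra.lift K (Module.End K (NegSpace K ℓ)) (Fin (ℓ + 1) × Fin (ℓ + 1) →₀ ℕ)
    { toFun := fun e => lowerBy K e.toAdd
      map_one' := lowerBy_zero K
      map_mul' := fun e e' => lowerBy_add K e.toAdd e'.toAdd }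

theorem act_monomial (e : Fin (ℓ + 1) × Fin (ℓ + 1) →₀ ℕ) (a : K) :
    act K ℓ (monomial e a) = a • lowerBy K e :=
  AddMonoidAlgebra.lift_single _ _ _

theorem act_X (p : Fin (ℓ + 1) × Fin (ℓ + 1)) : act K ℓ (X p) = lower K p := by
  rw [X, act_monomial, one_smul, lower]

/-- The relation of the Weyl algebra. -/
theorem raise_mul_lower_sub (p q : Fin (ℓ + 1) × Fin (ℓ + 1)) :
    raise K p * lower K q - lower K q * raise K p = if p = q then -1 else 0 := by
  refine Finsupp.lhom_ext fun N a => ?_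
  rw [LinearMap.sub_apply, Module.End.mul_apply, Module.End.mul_apply]
  split_ifs with h
  · subst h
    rw [raise_lower_single, raise_single, lower_single, if_neg (by simp), add_tsub_cancel_right,
      LinearMap.neg_apply, Module.End.one_apply, ← Finsupp.single_sub, ← Finsupp.single_neg]
    congr 1
    push_cast
    ring
  · rw [lower_single, raise_single, lower_single, LinearMap.zero_apply, sub_eq_zero,
      Finsupp.add_apply, Finsupp.single_eq_of_ne (Ne.symm h), add_zero]
    split_ifs with h0
    · rw [map_zero]
    · rw [raise_single, Finsupp.tsub_apply, Finsupp.single_eq_of_ne h, tsub_zero]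
      congr 1
      refine tsub_add_eq_add_tsub (Finsupp.single_le_iff.2 (Nat.one_le_iff_ne_zero.2 h0))

theorem commute_lower (p q : Fin (ℓ + 1) × Fin (ℓ + 1)) : Commute (lower K p) (lower K q) := by
  rw [← act_X, ← act_X, commute_iff_eq, ← map_mul, ← map_mul, mul_comm]

theorem raise_lower_commutator (p p' q : Fin (ℓ + 1) × Fin (ℓ + 1)) :
    raise K p * lower K p' * lower K q - lower K q * (raise K p * lower K p') =
      if p = q then -lower K p' else 0 :=
  (commutator_mul_left (A := Module.End K (NegSpace K ℓ)) (raise_mul_lower_sub K p q) (commute_lower K p' q)).trans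
    (ite_neg_one_mul (A := Module.End K (NegSpace K ℓ)) _ _)

theorem sum_raise_lower_commutator {ι : Type*} (s : Finset ι)
    (f g : ι → Fin (ℓ + 1) × Fin (ℓ + 1)) (q : Fin (ℓ + 1) × Fin (ℓ + 1)) :
    (∑ c ∈ s, raise K (f c) * lower K (g c)) * lower K q -
      lower K q * ∑ c ∈ s, raise K (f c) * lower K (g c) =
      ∑ c ∈ s, if f c = q then -lower K (g c) else 0 :=
  commutator_sum (A := Module.End K (NegSpace K ℓ)) s fun _ _ => raise_lower_commutator K _ _ _

/-- The derivation of the polynomial ring that is given by the commutator with `etaNeg`. -/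
def etaDer (l : Fin ℓ) : Derivation K (MvPolynomial (Fin (ℓ + 1) × Fin (ℓ + 1)) K)
    (MvPolynomial (Fin (ℓ + 1) × Fin (ℓ + 1)) K) :=
  mkDerivation K fun p =>
    (if p.2 = l.castSucc ∧ p.1 < l.castSucc then -X (p.1, l.succ) else 0) +
    (if p.1 = l.succ ∧ l.succ < p.2 then
      X (l.castSucc, p.2) - X (l.castSucc, l.succ) * X (l.succ, p.2) else 0) +
    (if p.1 = l.castSucc ∧ l.castSucc < p.2 then
      X (l.castSucc, l.succ) * X (l.castSucc, p.2) else 0)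

theorem etaNeg_commutator_lower (l : Fin ℓ) (q : Fin (ℓ + 1) × Fin (ℓ + 1)) :
    etaNeg K l * lower K q - lower K q * etaNeg K l = act K ℓ (etaDer K l (X q)) := by
  have h1 := sum_raise_lower_commutator K (Finset.Iio l.castSucc) (fun c => (c, l.castSucc))
    (fun c => (c, l.succ)) q
  have h2 := sum_raise_lower_commutator K (Finset.Ioi l.succ) (fun d => (l.succ, d))
    (fun d => (l.castSucc, d)) q
  have h3 := sum_raise_lower_commutator K (Finset.Ioi l.castSucc) (fun d => (l.castSucc, d))
    (fun d => (l.castSucc, d)) q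
  have h4 := sum_raise_lower_commutator K (Finset.Ioi l.succ) (fun d => (l.succ, d))
    (fun d => (l.succ, d)) q
  rw [etaNeg]
  obtain ⟨c, d⟩ := q
  have row : ∀ (x : Fin (ℓ + 1)) (g : Fin (ℓ + 1) → Module.End K (NegSpace K ℓ)),
      (∑ d' ∈ Finset.Ioi x, if (x, d') = (c, d) then g d' else 0) =
        if c = x ∧ x < d then g d else 0 := by
    intro x g
    simp only [Prod.mk.injEq, ite_and]
    by_cases hx : c = x
    · subst hx
      simp only [if_true, Finset.sum_ite_eq', Finset.mem_Ioi]
    · simp [hx, Ne.symm hx]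
  have row' : ∀ (x : Fin (ℓ + 1)) (g : Fin (ℓ + 1) → Module.End K (NegSpace K ℓ)),
      (∑ c' ∈ Finset.Iio x, if (c', x) = (c, d) then g c' else 0) =
        if d = x ∧ c < x then g c else 0 := by
    intro x g
    simp only [Prod.mk.injEq]
    by_cases hx : d = x
    · subst hx
      simp only [and_true, true_and, Finset.sum_ite_eq', Finset.mem_Iio]
    · simp [hx, Ne.symm hx]
  rw [row'] at h1
  rw [row] at h2 h3 h4
  have key := (commutator_combination (A := Module.End K (NegSpace K ℓ)) h1 h2 h3 h4
    (commute_lower K (l.castSucc, l.succ) (c, d))).trans (ite_commutator_combination (A := Module.End K (NegSpace K ℓ)) _ _ _ _ _ _ _)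
  refine key.trans ?_
  rw [etaDer, mkDerivation_X]
  simp only [map_add, apply_ite (act K ℓ), map_zero, map_neg, map_sub, map_mul, act_X]

/-- The commutator of `etaNeg` with a polynomial in the lowering operators. -/
theorem etaNeg_commutator (l : Fin ℓ) (y : MvPolynomial (Fin (ℓ + 1) × Fin (ℓ + 1)) K) :
    etaNeg K l * act K ℓ y - act K ℓ y * etaNeg K l = act K ℓ (etaDer K l y) := by
  induction y using MvPolynomial.induction_on with
  | C a =>
    rw [derivation_C, map_zero, ← algebraMap_eq, AlgHom.commutes]
    exact commutator_of_commute (A := Module.End K (NegSpace K ℓ)) (Algebra.commutes a _)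
  | add p q hp hq =>
    rw [map_add, map_add, map_add]
    exact commutator_add (A := Module.End K (NegSpace K ℓ)) hp hq
  | mul_X p x hp =>
    rw [Derivation.leibniz, map_add, smul_eq_mul, smul_eq_mul, map_mul, map_mul, map_mul]
    refine commutator_mul_right (A := Module.End K (NegSpace K ℓ)) hp ?_ ?_
    · rw [act_X, etaNeg_commutator_lower]
    · rw [commute_iff_eq, ← map_mul, ← map_mul, mul_comm]

/-- The polynomial in the lowering operators that describes a commutator of the operators `η`
with `θ_{ω_i}`. -/
def wordPoly (i : Fin ℓ) (w : List (Fin ℓ)) : MvPolynomial (Fin (ℓ + 1) × Fin (ℓ + 1)) K :=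
  w.foldr (fun l y => etaDer K l y - (if l = i then X (l.castSucc, l.succ) else 0) * y) 1

theorem wordPoly_nil (i : Fin ℓ) : wordPoly K i [] = 1 := rfl

theorem wordPoly_cons (i l : Fin ℓ) (w : List (Fin ℓ)) :
    wordPoly K i (l :: w) = etaDer K l (wordPoly K i w) -
      (if l = i then X (l.castSucc, l.succ) else 0) * wordPoly K i w := rfl

end Weyl

/-! ### The operators `θ` and `η` and their commutators -/

section CartanPart

theorem list_prod_extract {ι M : Type*} [DecidableEq ι] [Monoid M] {L : List ι} (hL : L.Nodup)
    (f : ι → M) {l : ι} (hl : l ∈ L) (h : ∀ j, Commute (f l) (f j)) :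
    (L.map f).prod = f l * (L.map (Function.update f l 1)).prod := by
  induction L with
  | nil => simp at hl
  | cons c L ih =>
    have hn := List.nodup_cons.1 hL
    rw [List.map_cons, List.prod_cons, List.map_cons, List.prod_cons]
    by_cases hc : c = l
    · subst hc
      rw [Function.update_self, one_mul]
      congr 2
      refine List.map_congr_left fun j hj => ?_
      rw [Function.update_of_ne]
      rintro rfl
      exact hn.1 hj
    · rw [Function.update_of_ne hc, ih hn.2 ((List.mem_cons.1 hl).resolve_left (Ne.symm hc)),
        ← mul_assoc, ← mul_assoc, (h c).eq]

variable (K : Type*) [Field K] {ℓ : ℕ}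

theorem cartMon_congr {δ δ' : Fin ℓ → ℤ} {m : Fin ℓ → ℕ} (h : ∀ l, m l ≠ 0 → δ l = δ' l) :
    cartMon K δ m = cartMon K δ' m := by
  rw [cartMon, cartMon]
  congr 1
  refine List.map_congr_left fun l _ => ?_
  by_cases hm : m l = 0
  · rw [hm, Hbin_zero, Hbin_zero]
  · rw [h l hm]

theorem cartMon_extract (δ : Fin ℓ → ℤ) (m : Fin ℓ → ℕ) (l : Fin ℓ) :
    cartMon K δ m = Hbin K l (δ l) (m l) * cartMon K δ (Function.update m l 0) := by
  rw [cartMon, list_prod_extract (List.nodup_finRange ℓ) _ (List.mem_finRange l)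
    fun j => commute_Hbin K l j _ _ _ _, cartMon]
  congr 3
  funext j
  by_cases hj : j = l
  · subst hj
    rw [Function.update_self, Function.update_self, Hbin_zero]
  · rw [Function.update_of_ne hj, Function.update_of_ne hj]

theorem cartMon_single_one (i : Fin ℓ) (m : Fin ℓ → ℕ) :
    cartMon K (Pi.single i 1) m =
      cartMon K 0 m + if m i = 0 then 0 else cartMon K 0 (Function.update m i (m i - 1)) := by
  have h : cartMon K (Pi.single i 1) (Function.update m i 0) =
      cartMon K 0 (Function.update m i 0) := by
    refine cartMon_congr K fun l hl => ?_
    by_cases hli : l = i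
    · subst hli
      simp at hl
    · rw [Pi.single_eq_of_ne hli, Pi.zero_apply]
  rw [cartMon_extract K _ m i, h, cartMon_extract K 0 m i, Pi.single_eq_same, Pi.zero_apply]
  cases hm : m i with
  | zero => rw [if_pos rfl, add_zero, Hbin_zero, Hbin_zero]
  | succ k =>
    rw [if_neg (Nat.succ_ne_zero k), Nat.add_sub_cancel, cartMon_extract K 0 (Function.update m i k) i,
      Function.update_self, Function.update_idem, ← add_mul]
    exact congrArg (· * _) (Hbin_pascal K i 0 k)

theorem Hbin_mul_cartMon (l : Fin ℓ) (δ : Fin ℓ → ℤ) (m : Fin ℓ → ℕ) :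
    Hbin K l 0 1 * cartMon K δ m =
      ((m l + 1 : ℕ) : K) • cartMon K δ (Function.update m l (m l + 1)) +
        ((m l - δ l : ℤ) : K) • cartMon K δ m := by
  rw [cartMon_extract K δ m l, cartMon_extract K δ (Function.update m l (m l + 1)) l,
    Function.update_self, Function.update_idem, ← mul_assoc, Hbin_mul_Hbin, add_mul,
    Nat.cast_smul_eq_nsmul, nsmul_eq_mul, Int.cast_smul_eq_zsmul, zsmul_eq_mul, mul_assoc,
    mul_assoc]

theorem Ediv_mul_cartMon {a b : Fin (ℓ + 1)} (hab : a ≠ b) (δ : Fin ℓ → ℤ) (m : Fin ℓ → ℕ) :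
    Ediv K a b 1 * cartMon K δ m =
      cartMon K (fun k => δ k - (entryWeight k a - entryWeight k b)) m * Ediv K a b 1 := by
  rw [cartMon, cartMon]
  induction List.finRange ℓ with
  | nil => simp
  | cons c L ih =>
    rw [List.map_cons, List.prod_cons, List.map_cons, List.prod_cons, ← mul_assoc,
      Ediv_mul_Hbin K c hab, mul_assoc, ih, mul_assoc]

variable (ℓ) in
/-- The span of the products of the elements `binom H_l m_l`. -/
def cartSpan : Submodule K (Hyper K ℓ) := Submodule.span K (Set.range (cartMon K 0))

theorem cartMon_zero_mem (m : Fin ℓ → ℕ) : cartMon K 0 m ∈ cartSpan K ℓ :=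
  Submodule.subset_span ⟨m, rfl⟩

theorem cartMon_single_mem (i : Fin ℓ) (m : Fin ℓ → ℕ) :
    cartMon K (Pi.single i 1) m ∈ cartSpan K ℓ := by
  rw [cartMon_single_one]
  refine Submodule.add_mem _ (cartMon_zero_mem K m) ?_
  split_ifs
  · exact Submodule.zero_mem _
  · exact cartMon_zero_mem K _

theorem Hbin_mul_cartMon_mem (l : Fin ℓ) {δ : Fin ℓ → ℤ} (hδ : ∀ m, cartMon K δ m ∈ cartSpan K ℓ)
    (m : Fin ℓ → ℕ) : Hbin K l 0 1 * cartMon K δ m ∈ cartSpan K ℓ := by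
  rw [Hbin_mul_cartMon]
  exact Submodule.add_mem _ (Submodule.smul_mem _ _ (hδ _)) (Submodule.smul_mem _ _ (hδ _))

theorem toHyper_mul_mem (v : NegSpace K ℓ) {C : Hyper K ℓ} (hC : C ∈ cartSpan K ℓ) :
    toHyper K v * C ∈ Um0 K ℓ := by
  induction hC using Submodule.span_induction with
  | mem x hx =>
    obtain ⟨m, rfl⟩ := hx
    induction v using Finsupp.induction_linear with
    | zero => rw [map_zero, zero_mul]; exact Submodule.zero_mem _
    | add v w hv hw => rw [map_add, add_mul]; exact Submodule.add_mem _ hv hw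
    | single N a =>
      rw [toHyper, Finsupp.linearCombination_single, smul_mul_assoc]
      exact Submodule.smul_mem _ _ (mem_Um0 K _ m)
  | zero => rw [mul_zero]; exact Submodule.zero_mem _
  | add x y _ _ hx hy => rw [mul_add]; exact Submodule.add_mem _ hx hy
  | smul a x _ hx => rw [mul_smul_comm]; exact Submodule.smul_mem _ _ hx

end CartanPart

section Basis

variable (K : Type*) [Field K] {ℓ : ℕ}

theorem negMon_congr {N N' : Matrix (Fin (ℓ + 1)) (Fin (ℓ + 1)) ℕ} (h : negExp N = negExp N') :
    negMon K N = negMon K N' := by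
  rw [negMon_eq_ofKostant, negMon_eq_ofKostant, kNegMon_congr h]

theorem linearIndependent_basisElt : LinearIndependent K (basisElt K (ℓ := ℓ)) :=
  linearIndependent_iff.2 fun c hc =>
    linearCombination_basisElt_eq_zero K c (hc ▸ Submodule.zero_mem _)

theorem basisElt_mem (x : BasisIndex ℓ) : basisElt K x ∈ Um0 K ℓ := mem_Um0 K _ _

theorem negMon_mul_cartMon_eq (N : Matrix (Fin (ℓ + 1)) (Fin (ℓ + 1)) ℕ) (δ : Fin ℓ → ℤ)
    (m : Fin ℓ → ℕ) :
    negMon K N * cartMon K δ m = negMon K (expMat (negExp N)) * cartMon K δ m := by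
  rw [negMon_congr K (negExp_expMat ⟨negExp N, N, rfl⟩)]

/-- The basis of `𝒰^{-,0}`. -/
def basisUm0 : Module.Basis (BasisIndex ℓ) K (Um0 K ℓ) :=
  Module.Basis.mk (v := fun x => (⟨basisElt K x, basisElt_mem K x⟩ : Um0 K ℓ))
    (LinearIndependent.of_comp (Um0 K ℓ).subtype (linearIndependent_basisElt K)) (by
      rintro ⟨x, hx⟩ -
      induction hx using Submodule.span_induction with
      | mem x hx =>
        obtain ⟨N, m, rfl⟩ := hx
        refine Submodule.subset_span ⟨⟨⟨negExp N, N, rfl⟩, m⟩, Subtype.ext ?_⟩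
        exact (negMon_mul_cartMon_eq K N 0 m).symm
      | zero => exact Submodule.zero_mem _
      | add x y hx hy h1 h2 => exact Submodule.add_mem _ h1 h2
      | smul a x hx h1 => exact Submodule.smul_mem _ a h1)

theorem basisUm0_apply (x : BasisIndex ℓ) : (basisUm0 K x : Hyper K ℓ) = basisElt K x := by
  rw [basisUm0, Module.Basis.mk_apply]

/-- The sum of `𝒰^{-,0}` and the left ideal generated by the positive part is direct. -/
theorem eq_zero_of_mem_posIdeal (x : Um0 K ℓ) (hx : (x : Hyper K ℓ) ∈ posIdeal K ℓ) : x = 0 := by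
  have h1 : (x : Hyper K ℓ) = Finsupp.linearCombination K (basisElt K) ((basisUm0 K).repr x) := by
    conv_lhs => rw [← (basisUm0 K).linearCombination_repr x]
    rw [← Submodule.subtype_apply, Finsupp.apply_linearCombination]
    congr 1
    congr 1
    funext y
    exact basisUm0_apply K y
  rw [h1] at hx
  rw [← (basisUm0 K).repr.map_eq_zero_iff]
  exact linearCombination_basisElt_eq_zero K _ hx

theorem mul_mem_posIdeal (x : Hyper K ℓ) {a b : Fin (ℓ + 1)} (hab : a < b) :
    x * Ediv K a b 1 ∈ posIdeal K ℓ :=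
  Ideal.mul_mem_left _ _ (Ideal.subset_span ⟨a, b, 1, hab, one_pos, rfl⟩)

/-- The defining property of `θ_{ω_i}`. -/
theorem theta_spec (i : Fin ℓ) (N : Matrix (Fin (ℓ + 1)) (Fin (ℓ + 1)) ℕ) (m : Fin ℓ → ℕ) :
    (theta K (Pi.single i 1) ⟨negMon K N * cartMon K 0 m, mem_Um0 K N m⟩ : Hyper K ℓ) =
      negMon K N * cartMon K (Pi.single i 1) m := by
  have hmem : ∀ (N : Matrix (Fin (ℓ + 1)) (Fin (ℓ + 1)) ℕ) (m : Fin ℓ → ℕ),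
      negMon K N * cartMon K (Pi.single i 1) m ∈ Um0 K ℓ := by
    intro N m
    have := toHyper_mul_mem K (Finsupp.single (Finsupp.equivFunOnFinite.symm fun p => N p.1 p.2) 1)
      (cartMon_single_mem K i m)
    rwa [toHyper, Finsupp.linearCombination_single, one_smul] at this
  refine Classical.epsilon_spec (p := fun f : Module.End K (Um0 K ℓ) =>
    ∀ (N : Matrix (Fin (ℓ + 1)) (Fin (ℓ + 1)) ℕ) (m : Fin ℓ → ℕ),
      (f ⟨negMon K N * cartMon K 0 m, mem_Um0 K N m⟩ : Hyper K ℓ) =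
        negMon K N * cartMon K (Pi.single i 1) m) ?_ N m
  refine ⟨(basisUm0 K).constr K fun x => ⟨_, hmem (expMat x.1.1) x.2⟩, fun N m => ?_⟩
  have h : (⟨negMon K N * cartMon K 0 m, mem_Um0 K N m⟩ : Um0 K ℓ) =
      basisUm0 K ⟨⟨negExp N, N, rfl⟩, m⟩ := by
    refine Subtype.ext ?_
    rw [basisUm0_apply]
    exact negMon_mul_cartMon_eq K N 0 m
  rw [h, Module.Basis.constr_basis]
  exact (negMon_mul_cartMon_eq K N _ m).symm

theorem Ediv_mul_toHyper_mul_cartMon (l : Fin ℓ) (v : NegSpace K ℓ) (δ : Fin ℓ → ℤ)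
    (m : Fin ℓ → ℕ) :
    Ediv K l.castSucc l.succ 1 * (toHyper K v * cartMon K δ m) -
      (toHyper K (etaNeg K l v) * cartMon K δ m +
        toHyper K (lower K (l.castSucc, l.succ) v) * (Hbin K l 0 1 * cartMon K δ m)) ∈
      posIdeal K ℓ := by
  have h : Ediv K l.castSucc l.succ 1 * (toHyper K v * cartMon K δ m) =
      toHyper K (etaNeg K l v) * cartMon K δ m +
        toHyper K (lower K (l.castSucc, l.succ) v) * (Hbin K l 0 1 * cartMon K δ m) +
      toHyper K v * cartMon K (fun k => δ k - (entryWeight k l.castSucc - entryWeight k l.succ)) m *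
        Ediv K l.castSucc l.succ 1 := by
    rw [← mul_assoc, Ediv_mul_toHyper, add_mul, add_mul, mul_assoc, mul_assoc (toHyper K v),
      Ediv_mul_cartMon K Fin.castSucc_lt_succ.ne, ← mul_assoc (toHyper K v)]
  rw [h]
  refine (congrArg (· ∈ posIdeal K ℓ) (add_sub_cancel_left _ _)).mpr ?_
  exact mul_mem_posIdeal K _ Fin.castSucc_lt_succ

theorem add_sub_add_mem {A : Type*} [Ring A] {I : Ideal A} {x y p q : A} (hx : x - p ∈ I)
    (hy : y - q ∈ I) : x + y - (p + q) ∈ I := by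
  rw [add_sub_add_comm]
  exact I.add_mem hx hy

theorem smul_sub_smul_mem {A : Type*} [Ring A] [Algebra K A] {I : Ideal A} (a : K) {x p : A}
    (hx : x - p ∈ I) : a • x - a • p ∈ I := by
  rw [← smul_sub]
  exact Submodule.smul_of_tower_mem _ a hx

set_option maxHeartbeats 1000000 in
/-- The defining property of `η_l`. -/
theorem eta_spec (l : Fin ℓ) (F : Um0 K ℓ) :
    Ediv K l.castSucc l.succ 1 * (F : Hyper K ℓ) - (eta K l.castSucc l.succ 1 F : Hyper K ℓ) ∈
      posIdeal K ℓ := by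
  have hex : ∀ x : BasisIndex ℓ, ∃ P : Um0 K ℓ,
      Ediv K l.castSucc l.succ 1 * basisElt K x - (P : Hyper K ℓ) ∈ posIdeal K ℓ := by
    intro x
    have h := Ediv_mul_toHyper_mul_cartMon K l
      (Finsupp.single (Finsupp.equivFunOnFinite.symm fun p => expMat x.1.1 p.1 p.2) 1) 0 x.2
    have h2 : basisElt K x = toHyper K (Finsupp.single
        (Finsupp.equivFunOnFinite.symm fun p => expMat x.1.1 p.1 p.2) 1) * cartMon K 0 x.2 := by
      rw [toHyper, Finsupp.linearCombination_single, one_smul]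
      rfl
    refine ⟨⟨_, Submodule.add_mem _ (toHyper_mul_mem K (etaNeg K l _) (cartMon_zero_mem K x.2))
      (toHyper_mul_mem K (lower K (l.castSucc, l.succ) _)
        (Hbin_mul_cartMon_mem K l (cartMon_zero_mem K) x.2))⟩, h2 ▸ h⟩
  choose P hP using hex
  refine Classical.epsilon_spec (p := fun f : Module.End K (Um0 K ℓ) => ∀ F : Um0 K ℓ,
    Ediv K l.castSucc l.succ 1 * (F : Hyper K ℓ) - (f F : Hyper K ℓ) ∈ posIdeal K ℓ) ?_ F
  refine ⟨(basisUm0 K).constr K P, fun F => ?_⟩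
  have hF : F ∈ Submodule.span K (Set.range (basisUm0 K)) := by
    rw [(basisUm0 K).span_eq]
    exact Submodule.mem_top
  induction hF using Submodule.span_induction with
  | zero => simp
  | mem y hy =>
    obtain ⟨x, rfl⟩ := hy
    rw [Module.Basis.constr_basis, basisUm0_apply]
    exact hP x
  | add x y _ _ hx hy =>
    rw [map_add, Submodule.coe_add, Submodule.coe_add, mul_add]
    exact add_sub_add_mem (A := Hyper K ℓ) (I := posIdeal K ℓ) hx hy
  | smul a x _ hx =>
    have h1 : (basisUm0 K).constr K P (a • x) = a • (basisUm0 K).constr K P x := map_smul _ a x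
    have h2 : Ediv K l.castSucc l.succ 1 * ((a • x : Um0 K ℓ) : Hyper K ℓ) =
        a • (Ediv K l.castSucc l.succ 1 * (x : Hyper K ℓ)) := mul_smul_comm a _ _
    rw [h1, h2]
    exact smul_sub_smul_mem K (A := Hyper K ℓ) (I := posIdeal K ℓ) a hx

theorem eta_eq_of_mem (l : Fin ℓ) (F P : Um0 K ℓ)
    (h : Ediv K l.castSucc l.succ 1 * (F : Hyper K ℓ) - (P : Hyper K ℓ) ∈ posIdeal K ℓ) :
    eta K l.castSucc l.succ 1 F = P := by
  refine sub_eq_zero.1 (eq_zero_of_mem_posIdeal K _ ?_)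
  have := Submodule.sub_mem _ h (eta_spec K l F)
  rwa [sub_sub_sub_cancel_left, ← Submodule.coe_sub] at this

end Basis

section Bracket

variable (K : Type*) [Field K] {ℓ : ℕ}

/-- The element of `𝒰^{-,0}` with given negative part and Cartan part. -/
def negCart (m : Fin ℓ → ℕ) : NegSpace K ℓ →ₗ[K] Um0 K ℓ where
  toFun v := ⟨toHyper K v * cartMon K 0 m, toHyper_mul_mem K v (cartMon_zero_mem K m)⟩
  map_add' v w := Subtype.ext <|
    (congrArg (· * cartMon K 0 m) (map_add (toHyper K) v w)).trans (add_mul _ _ _)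
  map_smul' a v := Subtype.ext <|
    (congrArg (· * cartMon K 0 m) (map_smul (toHyper K) a v)).trans (smul_mul_assoc _ _ _)

theorem coe_negCart (m : Fin ℓ → ℕ) (v : NegSpace K ℓ) :
    (negCart K m v : Hyper K ℓ) = toHyper K v * cartMon K 0 m := rfl

theorem theta_negCart (i : Fin ℓ) (m : Fin ℓ → ℕ) (v : NegSpace K ℓ) :
    (theta K (Pi.single i 1) (negCart K m v) : Hyper K ℓ) =
      toHyper K v * cartMon K (Pi.single i 1) m := by
  induction v using Finsupp.induction_linear with
  | zero => simp
  | add v w hv hw => rw [map_add, map_add, Submodule.coe_add, hv, hw, map_add, add_mul]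
  | single N a =>
    have h : negCart K m (Finsupp.single N a) =
        a • ⟨negMon K (fun c d => N (c, d)) * cartMon K 0 m, mem_Um0 K _ m⟩ := by
      refine Subtype.ext ?_
      rw [coe_negCart, toHyper, Finsupp.linearCombination_single, smul_mul_assoc]
      rfl
    rw [h, map_smul, Submodule.coe_smul, toHyper, Finsupp.linearCombination_single, smul_mul_assoc]
    exact congrArg (a • ·) (theta_spec K i _ m)

theorem mul_smul_add_smul {A : Type*} [Ring A] [Algebra K A] {a b : K} {x y z : A} (u : A)
    (h : x = a • y + b • z) : u * x = a • (u * y) + b • (u * z) := by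
  rw [h, mul_add, mul_smul_comm, mul_smul_comm]

/-- The value of `η_l` on an element with Cartan part shifted by `δ`. -/
theorem eta_apply (l : Fin ℓ) (m : Fin ℓ → ℕ) (v : NegSpace K ℓ) (δ : Fin ℓ → ℤ)
    (hδ : ∀ m, cartMon K δ m ∈ cartSpan K ℓ) (F : Um0 K ℓ)
    (hF : (F : Hyper K ℓ) = toHyper K v * cartMon K δ m) :
    (eta K l.castSucc l.succ 1 F : Hyper K ℓ) =
      toHyper K (etaNeg K l v) * cartMon K δ m +
        (((m l + 1 : ℕ) : K) • (toHyper K (lower K (l.castSucc, l.succ) v) *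
          cartMon K δ (Function.update m l (m l + 1))) +
        ((m l - δ l : ℤ) : K) • (toHyper K (lower K (l.castSucc, l.succ) v) * cartMon K δ m)) := by
  have h := eta_eq_of_mem K l F ⟨_, Submodule.add_mem _ (toHyper_mul_mem K (etaNeg K l v) (hδ m))
    (toHyper_mul_mem K (lower K (l.castSucc, l.succ) v) (Hbin_mul_cartMon_mem K l hδ m))⟩ (by
      rw [hF]
      exact Ediv_mul_toHyper_mul_cartMon K l v δ m)
  refine (congrArg Subtype.val h).trans ?_
  exact congrArg (HAdd.hAdd _) (mul_smul_add_smul K (A := Hyper K ℓ) _ (Hbin_mul_cartMon K l δ m))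

theorem eta_negCart (l : Fin ℓ) (m : Fin ℓ → ℕ) (v : NegSpace K ℓ) :
    eta K l.castSucc l.succ 1 (negCart K m v) =
      negCart K m (etaNeg K l v) +
        (((m l + 1 : ℕ) : K) • negCart K (Function.update m l (m l + 1))
          (lower K (l.castSucc, l.succ) v) +
        ((m l : ℤ) : K) • negCart K m (lower K (l.castSucc, l.succ) v)) := by
  refine Subtype.ext ?_
  rw [eta_apply K l m v 0 (cartMon_zero_mem K) _ (coe_negCart K m v), Pi.zero_apply, sub_zero]
  rfl

theorem bracket_identity {M : Type*} [AddCommGroup M] [Module K M] {x x' y z : M} {a b c d : K}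
    (h : b - c = d) : (x + (a • y + b • z)) - (x' + (a • y + c • z)) = (x - x') + d • z := by
  rw [← h, sub_smul]
  abel

theorem sub_mul_add_smul_mul {A : Type*} [Ring A] [Algebra K A] {d : K} {x y u z c : A}
    (h : d • z = -u) : x * c - y * c + d • (z * c) = (x - y - u) * c := by
  rw [← smul_mul_assoc, h, sub_mul, sub_mul, neg_mul, ← sub_eq_add_neg]

set_option maxHeartbeats 1000000 in
/-- A commutator of the operators `η` with `θ_{ω_i}` acts on the negative part by a polynomial in
the lowering operators and on the Cartan part as `θ_{ω_i}`. -/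
theorem bracket_apply (i : Fin ℓ) (w : List (Fin ℓ)) (m : Fin ℓ → ℕ) (v : NegSpace K ℓ) :
    (bracket K i w (negCart K m v) : Hyper K ℓ) =
      toHyper K (act K ℓ (wordPoly K i w) v) * cartMon K (Pi.single i 1) m := by
  induction w generalizing m v with
  | nil =>
    rw [wordPoly_nil, map_one, Module.End.one_apply]
    exact theta_negCart K i m v
  | cons l w ih =>
    have h1 : (eta K l.castSucc l.succ 1 (bracket K i w (negCart K m v)) : Hyper K ℓ) = _ :=
      eta_apply K l m _ _ (cartMon_single_mem K i) _ (ih m v)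
    have h2 : (bracket K i w (eta K l.castSucc l.succ 1 (negCart K m v)) : Hyper K ℓ) =
        toHyper K (act K ℓ (wordPoly K i w) (etaNeg K l v)) * cartMon K (Pi.single i 1) m +
          (((m l + 1 : ℕ) : K) • (toHyper K (act K ℓ (wordPoly K i w)
            (lower K (l.castSucc, l.succ) v)) *
              cartMon K (Pi.single i 1) (Function.update m l (m l + 1))) +
          ((m l : ℤ) : K) • (toHyper K (act K ℓ (wordPoly K i w)
            (lower K (l.castSucc, l.succ) v)) * cartMon K (Pi.single i 1) m)) := by
      rw [eta_negCart, map_add, map_add, map_smul, map_smul, Submodule.coe_add, Submodule.coe_add,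
        Submodule.coe_smul, Submodule.coe_smul, ih, ih, ih]
    have h3 : bracket K i (l :: w) (negCart K m v) =
        eta K l.castSucc l.succ 1 (bracket K i w (negCart K m v)) -
          bracket K i w (eta K l.castSucc l.succ 1 (negCart K m v)) := rfl
    have hy : ∀ u, lower K (l.castSucc, l.succ) (act K ℓ (wordPoly K i w) u) =
        act K ℓ (wordPoly K i w) (lower K (l.castSucc, l.succ) u) := by
      intro u
      rw [← act_X, ← Module.End.mul_apply, ← Module.End.mul_apply, ← map_mul, ← map_mul, mul_comm]
    have hc : act K ℓ (etaDer K l (wordPoly K i w)) v =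
        etaNeg K l (act K ℓ (wordPoly K i w) v) - act K ℓ (wordPoly K i w) (etaNeg K l v) := by
      rw [← etaNeg_commutator]
      rfl
    have hd : ((m l - (Pi.single i 1 : Fin ℓ → ℤ) l : ℤ) : K) - ((m l : ℤ) : K) =
        if l = i then -1 else 0 := by
      rw [Pi.single_apply]
      split_ifs <;> simp
    rw [h3, Submodule.coe_sub, h1, h2, hy]
    refine (@bracket_identity K _ (Hyper K ℓ) TensorProduct.addCommGroup _ _ _ _ _ _ _ _ _ hd).trans ?_
    rw [wordPoly_cons, map_sub, LinearMap.sub_apply, map_sub, hc, map_sub]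
    refine sub_mul_add_smul_mul K (A := Hyper K ℓ) ?_
    split_ifs with h
    · rw [map_mul, Module.End.mul_apply, act_X, hy, neg_smul, one_smul]
    · rw [zero_mul, map_zero, zero_smul, LinearMap.zero_apply, map_zero, neg_zero]

end Bracket

/-! ### Minors of the generic unitriangular matrix -/

section UnipotentMinors

open MvPolynomial

variable (K : Type*) [Field K] {ℓ : ℕ}

/-- The generic upper unitriangular matrix. -/
def uniMat (r s : Fin (ℓ + 1)) : MvPolynomial (Fin (ℓ + 1) × Fin (ℓ + 1)) K :=
  if r < s then X (r, s) else if r = s then 1 else 0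

theorem uniMat_of_lt {r s : Fin (ℓ + 1)} (h : r < s) : uniMat K r s = X (r, s) := if_pos h

theorem uniMat_self (r : Fin (ℓ + 1)) : uniMat K r r = 1 := by simp [uniMat]

theorem uniMat_of_gt {r s : Fin (ℓ + 1)} (h : s < r) : uniMat K r s = 0 := by
  rw [uniMat, if_neg h.not_gt, if_neg h.ne']

/-- The derivation `etaDer K l` acts on the generic unitriangular matrix by a row operation in the
rows `l` and `l + 1`, minus the operation that moves column `l + 1` to column `l`. -/
theorem etaDer_uniMat (l : Fin ℓ) (r s : Fin (ℓ + 1)) :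
    etaDer K l (uniMat K r s) =
      (if r = l.succ then uniMat K l.castSucc s - X (l.castSucc, l.succ) * uniMat K l.succ s else 0) +
        (if r = l.castSucc then X (l.castSucc, l.succ) * uniMat K l.castSucc s else 0) -
        (if s = l.castSucc then uniMat K r l.succ else 0) := by
  have hl : l.castSucc < l.succ := Fin.castSucc_lt_succ
  have hcov : ∀ x : Fin (ℓ + 1), x ≤ l.castSucc ∨ l.succ ≤ x := by
    intro x
    simp only [Fin.le_def, Fin.val_castSucc, Fin.val_succ]
    omega
  rcases lt_trichotomy r s with h | h | h
  · rw [uniMat_of_lt K h, etaDer, mkDerivation_X]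
    simp only
    by_cases h1 : r = l.succ
    · subst h1
      have h2 : s ≠ l.castSucc := (hl.trans h).ne'
      simp [h, h2, hl.ne', uniMat_of_lt K (hl.trans h), uniMat_of_lt K h]
    · by_cases h2 : r = l.castSucc
      · subst h2
        simp [h, h.ne', hl.ne, uniMat_of_lt K h]
      · by_cases h3 : s = l.castSucc
        · subst h3
          simp [h, h1, h2, uniMat_of_lt K (h.trans hl)]
        · simp [h1, h2, h3]
  · subst h
    rw [uniMat_self, Derivation.map_one_eq_zero]
    by_cases h1 : r = l.succ
    · subst h1
      simp [uniMat_of_lt K hl, uniMat_self, hl.ne']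
    · by_cases h2 : r = l.castSucc
      · subst h2
        simp [uniMat_of_lt K hl, uniMat_self, hl.ne]
      · simp [h1, h2]
  · rw [uniMat_of_gt K h, map_zero]
    by_cases h1 : r = l.succ
    · subst h1
      rcases ((hcov s).resolve_right (not_le.2 h)).lt_or_eq with h3 | h3
      · simp [uniMat_of_gt K h3, uniMat_of_gt K h, h3.ne, hl.ne']
      · subst h3
        simp [uniMat_self, uniMat_of_gt K h, hl.ne']
    · by_cases h2 : r = l.castSucc
      · subst h2
        simp [h.ne, uniMat_of_gt K h, hl.ne]
      · by_cases h3 : s = l.castSucc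
        · subst h3
          have : l.succ < r := ((hcov r).resolve_left (not_le.2 h)).lt_of_ne (Ne.symm h1)
          simp [h1, h2, uniMat_of_gt K this]
        · simp [h1, h2, h3]

/-- The minor of the generic unitriangular matrix with the rows `r ≤ i` and the columns `f r`. -/
def colMinor (i : Fin ℓ) (f : Fin (ℓ + 1) → Fin (ℓ + 1)) :
    MvPolynomial (Fin (ℓ + 1) × Fin (ℓ + 1)) K :=
  (Matrix.of fun r s : {r : Fin (ℓ + 1) // r ≤ i.castSucc} => uniMat K r.1 (f s.1)).det

theorem colMinor_id (i : Fin ℓ) : colMinor K i id = 1 := by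
  rw [colMinor, Matrix.det_of_isUpperTriangular]
  · exact Finset.prod_eq_one fun r _ => uniMat_self K _
  · exact fun r s h => uniMat_of_gt K h

/-- Applying the derivation `etaDer K l` to a minor moves the columns `l` to the right. -/
theorem etaDer_colMinor (i l : Fin ℓ) (f : Fin (ℓ + 1) → Fin (ℓ + 1)) :
    etaDer K l (colMinor K i f) -
        (if l = i then X (l.castSucc, l.succ) else 0) * colMinor K i f =
      -∑ s : {r : Fin (ℓ + 1) // r ≤ i.castSucc},
        if f s = l.castSucc then colMinor K i (Function.update f s l.succ) else 0 := by
  set R := {r : Fin (ℓ + 1) // r ≤ i.castSucc}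
  set x : MvPolynomial (Fin (ℓ + 1) × Fin (ℓ + 1)) K := X (l.castSucc, l.succ) with hx
  set M : Matrix R R (MvPolynomial (Fin (ℓ + 1) × Fin (ℓ + 1)) K) :=
    Matrix.of fun r s => uniMat K r.1 (f s.1) with hM
  set Z : Matrix R R (MvPolynomial (Fin (ℓ + 1) × Fin (ℓ + 1)) K) := Matrix.of fun r s =>
    (if r.1 = l.succ then (if s.1 = l.castSucc then 1 else 0) - x * (if s.1 = l.succ then 1 else 0)
      else 0) + (if r.1 = l.castSucc then x * (if s.1 = l.castSucc then 1 else 0) else 0) with hZ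
  set N : Matrix R R (MvPolynomial (Fin (ℓ + 1) × Fin (ℓ + 1)) K) := Matrix.of fun r s =>
    if f s.1 = l.castSucc then uniMat K r.1 l.succ else 0 with hN
  have hl : l.castSucc < l.succ := Fin.castSucc_lt_succ
  have hsum : ∀ (y : Fin (ℓ + 1)) (hy : y ≤ i.castSucc)
      (g : R → MvPolynomial (Fin (ℓ + 1) × Fin (ℓ + 1)) K),
      ∑ s : R, (if s.1 = y then 1 else 0) * g s = g ⟨y, hy⟩ := by
    intro y hy g
    rw [Finset.sum_eq_single ⟨y, hy⟩]
    · rw [if_pos rfl, one_mul]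
    · intro s _ hs
      rw [if_neg fun h => hs (Subtype.ext h), zero_mul]
    · exact fun h => absurd (Finset.mem_univ _) h
  -- `Z` is the row operation, restricted to the rows up to `i`
  have hDM : M.map (etaDer K l) = Z * M - N := by
    ext1 r s
    rw [Matrix.sub_apply, Matrix.mul_apply, Matrix.map_apply]
    refine (etaDer_uniMat K l r.1 (f s.1)).trans ?_
    congr 1
    simp only [hZ, hM, Matrix.of_apply]
    by_cases h1 : r.1 = l.succ
    · have h2 : r.1 ≠ l.castSucc := h1 ▸ hl.ne'
      have h3 : l.succ ≤ i.castSucc := h1 ▸ r.2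
      simp only [if_pos h1, if_neg h2, add_zero, sub_mul, mul_assoc, Finset.sum_sub_distrib,
        ← Finset.mul_sum]
      rw [hsum _ h3, hsum _ (hl.le.trans h3)]
    · by_cases h2 : r.1 = l.castSucc
      · have h3 : l.castSucc ≤ i.castSucc := h2 ▸ r.2
        simp only [if_neg h1, if_pos h2, zero_add, mul_assoc, ← Finset.mul_sum]
        rw [hsum _ h3]
      · simp only [if_neg h1, if_neg h2, zero_add, zero_mul, Finset.sum_const_zero]
  -- the rows `l` and `l + 1` contribute opposite summands, unless the latter is cut off
  have htr : Z.trace = if l = i then x else 0 := by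
    have h1 : Z.trace = ∑ r : R, ((if r.1 = l.castSucc then x else 0) -
        (if r.1 = l.succ then x else 0)) := by
      refine Finset.sum_congr rfl fun r _ => ?_
      simp only [hZ, Matrix.diag_apply, Matrix.of_apply]
      by_cases h1 : r.1 = l.succ
      · have h2 : r.1 ≠ l.castSucc := h1 ▸ hl.ne'
        simp [h1, hl.ne']
      · by_cases h2 : r.1 = l.castSucc
        · simp [h2, hl.ne]
        · simp [h1, h2]
    have h2 : ∀ y : Fin (ℓ + 1), ∑ r : R, (if r.1 = y then x else 0) =
        if y ≤ i.castSucc then x else 0 := by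
      intro y
      split_ifs with hy
      · simpa using hsum y hy fun _ => x
      · refine Finset.sum_eq_zero fun r _ => if_neg ?_
        rintro rfl
        exact hy r.2
    rw [h1, Finset.sum_sub_distrib, h2, h2]
    simp only [Fin.le_def, Fin.val_castSucc, Fin.val_succ, Fin.ext_iff]
    rcases lt_trichotomy (l : ℕ) (i : ℕ) with h | h | h
    · rw [if_pos h.le, if_pos (Nat.succ_le_of_lt h), if_neg h.ne, sub_self]
    · rw [if_pos h.le, if_neg (by omega), if_pos h, sub_zero]
    · rw [if_neg (by omega), if_neg (by omega), if_neg h.ne', sub_self]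
  -- Jacobi's formula, for one column at a time
  have hN' : (M.adjugate * N).trace = ∑ s : R,
      if f s = l.castSucc then colMinor K i (Function.update f s l.succ) else 0 := by
    refine Finset.sum_congr rfl fun s _ => ?_
    rw [Matrix.diag_apply, Matrix.mul_apply]
    split_ifs with h
    · have h1 : colMinor K i (Function.update f s l.succ) =
          (M.updateCol s fun r => uniMat K r.1 l.succ).det := by
        rw [colMinor]
        congr 1
        ext1 r s'
        rw [Matrix.updateCol_apply, Matrix.of_apply]
        by_cases hs : s' = s
        · rw [if_pos hs, hs, Function.update_self]
        · rw [if_neg hs, Function.update_of_ne fun h => hs (Subtype.ext h)]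
          rfl
      rw [h1, ← Matrix.cramer_apply, Matrix.cramer_eq_adjugate_mulVec, Matrix.mulVec, dotProduct]
      refine Finset.sum_congr rfl fun r _ => ?_
      simp only [hN, Matrix.of_apply, if_pos h]
    · refine Finset.sum_eq_zero fun r _ => ?_
      simp only [hN, Matrix.of_apply, if_neg h, mul_zero]
  have hD : etaDer K l (colMinor K i f) = (if l = i then x else 0) * colMinor K i f -
      (M.adjugate * N).trace := by
    rw [colMinor, derivation_det]
    change (M.adjugate * M.map (etaDer K l)).trace = _ * M.det - _
    rw [hDM, Matrix.mul_sub, Matrix.trace_sub, ← Matrix.mul_assoc, Matrix.trace_mul_cycle,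
      Matrix.mul_adjugate, Matrix.smul_mul, Matrix.one_mul, Matrix.trace_smul, htr, smul_eq_mul,
      mul_comm]
  rw [hD, hN', sub_right_comm, sub_self, zero_sub]

theorem etaDer_colMinor_of_unique (i l : Fin ℓ) (f : Fin (ℓ + 1) → Fin (ℓ + 1)) (r : Fin (ℓ + 1))
    (hr : r ≤ i.castSucc) (hf : f r = l.castSucc)
    (hu : ∀ s ≤ i.castSucc, f s = l.castSucc → s = r) :
    etaDer K l (colMinor K i f) -
        (if l = i then X (l.castSucc, l.succ) else 0) * colMinor K i f =
      -colMinor K i (Function.update f r l.succ) := by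
  rw [etaDer_colMinor, Finset.sum_eq_single ⟨r, hr⟩]
  · rw [if_pos hf]
  · exact fun s _ hs => if_neg fun h => hs (Subtype.ext (hu _ s.2 h))
  · exact fun h => absurd (Finset.mem_univ _) h

theorem colMinor_comp_swap (i : Fin ℓ) (f : Fin (ℓ + 1) → Fin (ℓ + 1)) {r s : Fin (ℓ + 1)}
    (hr : r ≤ i.castSucc) (hs : s ≤ i.castSucc) (hrs : r ≠ s) :
    colMinor K i (f ∘ Equiv.swap r s) = -colMinor K i f := by
  have h := Matrix.det_permute' (Equiv.swap (⟨r, hr⟩ : {r : Fin (ℓ + 1) // r ≤ i.castSucc}) ⟨s, hs⟩)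
    (Matrix.of fun r s : {r : Fin (ℓ + 1) // r ≤ i.castSucc} => uniMat K r.1 (f s.1))
  rw [Equiv.Perm.sign_swap fun h => hrs (congrArg Subtype.val h)] at h
  rw [colMinor, colMinor]
  refine Eq.trans ?_ (h.trans (by simp))
  congr 1
  ext1 x y
  rw [Matrix.submatrix_apply, Matrix.of_apply, Matrix.of_apply, Function.comp_apply, id]
  congr 2
  rw [Equiv.swap_apply_def, Equiv.swap_apply_def]
  simp only [Subtype.ext_iff]
  split_ifs <;> rfl

end UnipotentMinors

section Sequences

variable {ℓ : ℕ}

theorem ascSeq_self (i : Fin ℓ) : ascSeq i i.castSucc = [] := by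
  rw [ascSeq, List.filter_eq_nil_iff]
  simp

theorem ascSeq_cons {i p : Fin ℓ} (h : p < i) :
    ascSeq i p.castSucc = p :: ascSeq i p.succ := by
  have h1 := (List.pairwise_lt_finRange ℓ)
  refine List.Pairwise.eq_of_mem_iff (r := (· < ·)) (h1.filter _) ?_ fun x => ?_
  · refine List.pairwise_cons.2 ⟨fun x hx => ?_, h1.filter _⟩
    simp only [ascSeq, List.mem_filter, decide_eq_true_eq, Fin.le_def, Fin.val_succ,
      Fin.val_castSucc] at hx
    exact hx.2.1
  · simp only [ascSeq, List.mem_cons, List.mem_filter, List.mem_finRange, decide_eq_true_eq,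
      true_and, Fin.le_def, Fin.lt_def, Fin.val_succ, Fin.val_castSucc, Fin.ext_iff]
    rw [Fin.lt_def] at h
    omega

theorem descSeq_self (i : Fin ℓ) : descSeq i i.succ = [] := by
  rw [descSeq, List.reverse_eq_nil_iff, List.filter_eq_nil_iff]
  intro x _
  simp only [Fin.lt_def, Fin.val_succ, Fin.val_castSucc, decide_eq_true_eq]
  omega

theorem descSeq_cons {i x : Fin ℓ} (h : i < x) :
    descSeq i x.succ = x :: descSeq i x.castSucc := by
  have h1 := (List.pairwise_lt_finRange ℓ)
  refine List.Pairwise.eq_of_mem_iff (r := (· > ·))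
    (List.pairwise_reverse.2 (h1.filter _)) ?_ fun y => ?_
  · refine List.pairwise_cons.2 ⟨fun y hy => ?_, List.pairwise_reverse.2 (h1.filter _)⟩
    simp only [descSeq, List.mem_reverse, List.mem_filter, decide_eq_true_eq, Fin.lt_def,
      Fin.val_castSucc] at hy
    exact hy.2.2
  · simp only [descSeq, List.mem_cons, List.mem_reverse, List.mem_filter, List.mem_finRange,
      decide_eq_true_eq, true_and, Fin.lt_def, Fin.val_succ, Fin.val_castSucc, Fin.ext_iff]
    rw [Fin.lt_def] at h
    omega

theorem fullWord_succ {q : ℕ} (i : Fin ℓ) (w : Fin (q + 1) → List (Fin ℓ)) :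
    fullWord i w = w (Fin.last q) ++ i :: fullWord i fun j => w j.castSucc := by
  rw [fullWord, List.finRange_succ_last, List.reverse_append, fullWord]
  simp [List.flatMap_map, ← List.map_reverse]

theorem isShuffle_append {α : Type*} (u v : List α) : IsShuffle u v (u ++ v) := by
  induction u with
  | nil =>
    induction v with
    | nil => exact .nil
    | cons x v ih => exact .right x ih
  | cons x u ih => exact .left x ih

end Sequences

section Words

open MvPolynomial

variable (K : Type*) [Field K] {ℓ : ℕ}

/-- The effect of one block of the word: the column `a` of the minor is replaced with `b`. -/
theorem wordPoly_block (i : Fin ℓ) (f : Fin (ℓ + 1) → Fin (ℓ + 1)) (w' : List (Fin ℓ)) (n : ℕ)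
    (hw' : wordPoly K i w' = (-1) ^ n * colMinor K i f) (a b : Fin (ℓ + 1))
    (hf : ∀ r, a ≤ r → r ≤ i.castSucc → f r = r) (hf' : ∀ r, r < a → f r < a ∨ b ≤ f r)
    (u v w : List (Fin ℓ)) (h : IsShuffle u v w) :
    ∀ x y : Fin (ℓ + 1), u = ascSeq i x → v = descSeq i y → a ≤ x → x ≤ i.castSucc →
      i.castSucc < y → y ≤ b →
      wordPoly K i (w ++ i :: w') =
        (-1) ^ (n + ((y : ℕ) - (i : ℕ))) * colMinor K i (Function.update f x y) := by
  have step : ∀ (l : Fin ℓ) (k : ℕ) (L : List (Fin ℓ)) (g : Fin (ℓ + 1) → Fin (ℓ + 1))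
      (r : Fin (ℓ + 1)), wordPoly K i L = (-1) ^ k * colMinor K i g → r ≤ i.castSucc →
      g r = l.castSucc → (∀ s ≤ i.castSucc, g s = l.castSucc → s = r) →
      wordPoly K i (l :: L) = (-1) ^ (k + 1) * colMinor K i (Function.update g r l.succ) := by
    intro l k L g r hL hr hg hu
    have h1 := etaDer_colMinor_of_unique K i l g r hr hg hu
    have h2 : etaDer K l ((-1) ^ k * colMinor K i g) = (-1) ^ k * etaDer K l (colMinor K i g) := by
      rcases neg_one_pow_eq_or (MvPolynomial (Fin (ℓ + 1) × Fin (ℓ + 1)) K) k with h | h <;>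
        simp [h]
    rw [wordPoly_cons, hL, h2, mul_left_comm, ← mul_sub, h1, pow_succ]
    ring
  induction h with
  | nil =>
    intro x y hu hv hax hxi hiy hyb
    have hx : x = i.castSucc := by
      by_contra hne
      obtain ⟨p, rfl⟩ : ∃ p : Fin ℓ, x = p.castSucc :=
        ⟨x.castPred (ne_of_lt (hxi.trans_lt (Fin.castSucc_lt_last i))), by simp⟩
      rw [ascSeq_cons (lt_of_le_of_ne (by simpa using hxi) (by simpa using hne))] at hu
      simp at hu
    have hy : y = i.succ := by
      by_contra hne
      obtain ⟨z, rfl⟩ : ∃ z : Fin ℓ, y = z.succ :=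
        ⟨y.pred (ne_of_gt ((Fin.zero_le _).trans_lt hiy)), by simp⟩
      rw [descSeq_cons (lt_of_le_of_ne (by simpa [Fin.castSucc_lt_succ_iff] using hiy)
        (by simpa [eq_comm] using hne))] at hv
      simp at hv
    subst hx hy
    rw [List.nil_append, Fin.val_succ, Nat.add_sub_cancel_left]
    -- the letter `i` replaces column `i` with `i + 1`
    refine step i n w' f _ hw' le_rfl (hf _ hax le_rfl) fun s hs hfs => ?_
    rcases lt_or_ge s a with h1 | h1
    · rcases hf' s h1 with h2 | h2
      · rw [hfs] at h2
        exact absurd (h2.trans_le hax) (lt_irrefl _)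
      · rw [hfs] at h2
        exact absurd (hyb.trans h2) (not_le.2 hiy)
    · rw [← hf s h1 hs, hfs]
  | left p h ih =>
    intro x y hu hv hax hxi hiy hyb
    obtain ⟨p', rfl⟩ : ∃ p : Fin ℓ, x = p.castSucc :=
      ⟨x.castPred (ne_of_lt (hxi.trans_lt (Fin.castSucc_lt_last i))), by simp⟩
    have hpi : p' < i := by
      refine lt_of_le_of_ne (by simpa using hxi) ?_
      rintro rfl
      rw [ascSeq_self] at hu
      simp at hu
    rw [ascSeq_cons hpi, List.cons.injEq] at hu
    obtain ⟨rfl, hu⟩ := hu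
    have hp : p.castSucc < p.succ := Fin.castSucc_lt_succ
    have hpi' : p.succ ≤ i.castSucc := by
      rw [Fin.le_def, Fin.val_succ, Fin.val_castSucc]
      exact hpi
    have ih' := ih p.succ y hu hv (hax.trans hp.le) hpi' hiy hyb
    -- column `p` becomes `p + 1`; the sign cancels with that of the exchange with column `p + 1`,
    -- which carries `y`
    have h1 := step p _ _ _ p.castSucc ih' hxi
      (by rw [Function.update_of_ne hp.ne, hf _ hax hxi]) (fun s hs hfs => by
        by_cases hsp : s = p.succ
        · rw [hsp, Function.update_self] at hfs
          exact absurd hfs (hxi.trans_lt hiy).ne'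
        · rw [Function.update_of_ne hsp] at hfs
          rcases lt_or_ge s a with h1 | h1
          · rcases hf' s h1 with h2 | h2
            · rw [hfs] at h2
              exact absurd (h2.trans_le hax) (lt_irrefl _)
            · rw [hfs] at h2
              exact absurd (hyb.trans h2) (not_le.2 (hxi.trans_lt hiy))
          · rw [← hf s h1 hs, hfs])
    have h2 : Function.update (Function.update f p.succ y) p.castSucc p.succ =
        Function.update f p.castSucc y ∘ Equiv.swap p.castSucc p.succ := by
      funext s
      rw [Function.comp_apply]
      by_cases hs1 : s = p.castSucc
      · rw [hs1, Function.update_self, Equiv.swap_apply_left, Function.update_of_ne hp.ne',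
          hf _ (hax.trans hp.le) hpi']
      · by_cases hs2 : s = p.succ
        · rw [hs2, Function.update_of_ne hp.ne', Function.update_self, Equiv.swap_apply_right,
            Function.update_self]
        · rw [Equiv.swap_apply_of_ne_of_ne hs1 hs2, Function.update_of_ne hs1,
            Function.update_of_ne hs2, Function.update_of_ne hs1]
    rw [List.cons_append, h1, h2, colMinor_comp_swap K i _ hxi hpi' hp.ne, pow_succ]
    ring
  | right z h ih =>
    intro x y hu hv hax hxi hiy hyb
    obtain ⟨z', rfl⟩ : ∃ z : Fin ℓ, y = z.succ :=
      ⟨y.pred (ne_of_gt ((Fin.zero_le _).trans_lt hiy)), by simp⟩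
    have hiz : i < z' := by
      refine lt_of_le_of_ne (by simpa [Fin.castSucc_lt_succ_iff] using hiy) ?_
      rintro rfl
      rw [descSeq_self] at hv
      simp at hv
    rw [descSeq_cons hiz, List.cons.injEq] at hv
    obtain ⟨rfl, hv⟩ := hv
    have hz : z.castSucc < z.succ := Fin.castSucc_lt_succ
    have hiz' : i.castSucc < z.castSucc := by simpa using hiz
    have ih' := ih x z.castSucc hu hv hax hxi hiz' (hz.le.trans hyb)
    -- the letter `z` moves the column at `x` from `z` to `z + 1`
    have h1 := step z _ _ _ x ih' hxi (Function.update_self _ _ _) (fun s hs hfs => by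
      by_contra hsx
      rw [Function.update_of_ne hsx] at hfs
      rcases lt_or_ge s a with h1 | h1
      · rcases hf' s h1 with h2 | h2
        · rw [hfs] at h2
          exact absurd (h2.trans_le (hax.trans hxi)) hiz'.not_gt
        · rw [hfs] at h2
          exact absurd (hyb.trans h2) (not_le.2 hz)
      · rw [hf s h1 hs] at hfs
        exact absurd hs (not_le.2 (hfs ▸ hiz')))
    rw [List.cons_append, h1, Function.update_idem]
    congr 2
    rw [Fin.val_castSucc, Fin.val_succ]
    rw [Fin.lt_def] at hiz
    omega

/-- The polynomial of the word is, up to a sign, a minor whose columns are the identity ones except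
that `a_j` is replaced with `b_j`. In particular it does not depend on the shuffles. -/
theorem wordPoly_fullWord (i : Fin ℓ) {q : ℕ} (a b : Fin q → Fin (ℓ + 1)) (ha : StrictMono a)
    (hb : StrictAnti b) (hai : ∀ j, a j ≤ i.castSucc) (hib : ∀ j, i.castSucc < b j)
    (w : Fin q → List (Fin ℓ)) (hw : ∀ j, IsShuffle (ascSeq i (a j)) (descSeq i (b j)) (w j))
    (f : Fin (ℓ + 1) → Fin (ℓ + 1)) (hf : ∀ j, f (a j) = b j)
    (hf' : ∀ r, r ∉ Set.range a → f r = r) :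
    wordPoly K i (fullWord i w) =
      (-1) ^ (∑ j, ((b j : ℕ) - (i : ℕ))) * colMinor K i f := by
  induction q generalizing f with
  | zero =>
    have : f = id := funext fun r => hf' r (by rintro ⟨j, -⟩; exact j.elim0)
    rw [this, colMinor_id]
    simp [fullWord, wordPoly_nil]
  | succ q ih =>
    set a₀ := a (Fin.last q) with ha₀
    set g := Function.update f a₀ a₀ with hg
    have hne : ∀ j : Fin q, a j.castSucc < a₀ := fun j => ha (Fin.castSucc_lt_last j)
    have hfg : Function.update g a₀ (b (Fin.last q)) = f := by
      rw [hg, Function.update_idem, ← hf, Function.update_eq_self]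
    have hg1 : ∀ j : Fin q, g (a j.castSucc) = b j.castSucc := fun j => by
      rw [hg, Function.update_of_ne (hne j).ne, hf]
    have hg2 : ∀ r, r ∉ Set.range (fun j : Fin q => a j.castSucc) → g r = r := by
      intro r hr
      by_cases h : r = a₀
      · rw [h, hg, Function.update_self]
      · rw [hg, Function.update_of_ne h]
        refine hf' r ?_
        rintro ⟨j, rfl⟩
        cases j using Fin.lastCases with
        | last => exact h rfl
        | cast j => exact hr ⟨j, rfl⟩
    have h1 := ih (fun j => a j.castSucc) (fun j => b j.castSucc)
      (fun j k hjk => ha (by simpa using hjk)) (fun j k hjk => hb (by simpa using hjk))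
      (fun j => hai _) (fun j => hib _) (fun j => w j.castSucc) (fun j => hw _) g hg1 hg2
    rw [fullWord_succ, wordPoly_block K i g _ _ h1 a₀ (b (Fin.last q)) (fun r hr _ => hg2 r ?_)
      (fun r hr => ?_) _ _ _ (hw (Fin.last q)) _ _ rfl rfl le_rfl (hai _) (hib _) le_rfl, hfg,
      Fin.sum_univ_castSucc]
    · rintro ⟨j, rfl⟩
      exact absurd hr (not_le.2 (hne j))
    · by_cases h : r ∈ Set.range (fun j : Fin q => a j.castSucc)
      · obtain ⟨j, rfl⟩ := h
        right
        rw [hg1]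
        exact (hb (Fin.castSucc_lt_last j)).le
      · left
        rwa [hg2 r h]

end Words

/-! ### Signs of permutations and first returns -/

section FirstReturn

variable {α : Type*} {A : Set α}

/-- The point `v` of `A` is the first point of `A` that is met by the iteration of `π` on `u`. -/
inductive FirstReturn (A : Set α) (π : α → α) : α → α → Prop
  | hit {u v : α} : π u = v → v ∈ A → FirstReturn A π u v
  | pass {u w v : α} : π u = w → w ∉ A → FirstReturn A π w v → FirstReturn A π u v

/-- Leaving out a point `r` outside `A` does not change the first returns. -/
theorem FirstReturn.of_swap_mul [DecidableEq α] {π : Equiv.Perm α} {r : α} (hr : r ∉ A) {u v : α}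
    (h : FirstReturn A (Equiv.swap r (π r) * π : Equiv.Perm α) u v) : FirstReturn A π u v := by
  have key : ∀ u w, (Equiv.swap r (π r) * π : Equiv.Perm α) u = w →
      (u = r ∧ w = r) ∨ (π u = r ∧ π r = w) ∨ π u = w := by
    rintro u - rfl
    rw [Equiv.Perm.mul_apply, Equiv.swap_apply_def]
    split_ifs with h1 h2
    · exact Or.inr (Or.inl ⟨h1, rfl⟩)
    · exact Or.inl ⟨π.injective h2, rfl⟩
    · exact Or.inr (Or.inr rfl)
  induction h with
  | hit h hv =>
    rcases key _ _ h with ⟨-, h1⟩ | ⟨h1, h2⟩ | h1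
    · exact absurd (h1 ▸ hv) hr
    · exact .pass h1 hr (.hit h2 hv)
    · exact .hit h1 hv
  | pass h hw _ ih =>
    rcases key _ _ h with ⟨h1, h2⟩ | ⟨h1, h2⟩ | h1
    · rw [h1, ← h2]
      exact ih
    · exact .pass h1 hr (.pass h2 hw ih)
    · exact .pass h1 hw ih

/-- If a permutation does not decrease outside the range of `a`, the induced permutation of the
range of `a` by first returns has the same sign up to the number of the moved points that do not
lie in this range. -/
theorem exists_perm_firstReturn [Fintype α] [DecidableEq α] [PartialOrder α] {q : ℕ} {a : Fin q → α}
    (ha : Function.Injective a) (n : ℕ) : ∀ π : Equiv.Perm α,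
    (∀ r, π r ∉ Set.range a → r ≤ π r) →
    {r | r ∉ Set.range a ∧ π r ≠ r}.ncard = n →
    ∃ σ : Equiv.Perm (Fin q), Equiv.Perm.sign π = Equiv.Perm.sign σ * (-1) ^ n ∧
      ∀ j, FirstReturn (Set.range a) π (a j) (a (σ j)) := by
  classical
  induction n with
  | zero =>
    intro π _ hn
    have hfix : ∀ r, π r ≠ r → r ∈ Set.range a := by
      intro r hr
      by_contra h
      have : r ∈ {r | r ∉ Set.range a ∧ π r ≠ r} := ⟨h, hr⟩
      rw [(Set.ncard_eq_zero (Set.toFinite _)).1 hn] at this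
      exact this
    have hmaps : ∀ r, π r ∈ Set.range a ↔ r ∈ Set.range a := by
      intro r
      by_cases h : π r = r
      · rw [h]
      · refine ⟨fun _ => hfix r h, fun _ => hfix _ fun h' => h (π.injective h')⟩
    set e := Equiv.ofInjective a ha
    set ρ : Equiv.Perm (Set.range a) := π.subtypePerm hmaps with hρ
    refine ⟨e.symm.permCongr ρ, ?_, fun j => .hit ?_ ⟨_, rfl⟩⟩
    · rw [Equiv.Perm.sign_permCongr, pow_zero, mul_one]
      convert (Equiv.Perm.sign_subtypePerm π hmaps hfix).symm
    · have h1 : a (e.symm (ρ (e j))) = ρ (e j) := Equiv.apply_ofInjective_symm ha _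
      rw [Equiv.permCongr_apply, Equiv.symm_symm, h1]
      rfl
  | succ n ih =>
    intro π hπ hn
    obtain ⟨r, hrA, hr⟩ : {r | r ∉ Set.range a ∧ π r ≠ r}.Nonempty := by
      rw [← Set.ncard_pos (Set.toFinite _)]
      omega
    -- leave out `r`: its preimage is sent to its image, and `r` becomes a fixed point
    set π' : Equiv.Perm α := Equiv.swap r (π r) * π with hπ'
    have hval : ∀ u, π' u = if π u = r then π r else if u = r then r else π u := by
      intro u
      rw [hπ', Equiv.Perm.mul_apply, Equiv.swap_apply_def]
      simp only [π.apply_eq_iff_eq]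
    have hrr : π' r = r := by rw [hval, if_neg hr, if_pos rfl]
    have hmono : ∀ u, π' u ∉ Set.range a → u ≤ π' u := by
      intro u hu
      rw [hval] at hu ⊢
      split_ifs at hu ⊢ with h1 h2
      · have h3 := hπ u (h1 ▸ hrA)
        rw [h1] at h3
        exact h3.trans (hπ r hu)
      · exact h2.le
      · exact hπ u hu
    have hset : {u | u ∉ Set.range a ∧ π' u ≠ u} = {u | u ∉ Set.range a ∧ π u ≠ u} \ {r} := by
      ext u
      simp only [Set.mem_ofPred_eq, Set.mem_sdiff, Set.mem_singleton_iff, and_assoc]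
      refine and_congr_right fun hu => ?_
      rw [hval]
      split_ifs with h1 h2
      · have hur : u ≠ r := fun h => hr (h ▸ h1)
        refine iff_of_true (fun h => hur ?_) ⟨h1 ▸ hur.symm, hur⟩
        refine le_antisymm ?_ ?_
        · have := hπ u (h1 ▸ hrA)
          rwa [h1] at this
        · have := hπ r (h ▸ hu)
          rwa [h] at this
      · simp [h2]
      · simp [h2]
    have hcard : {u | u ∉ Set.range a ∧ π' u ≠ u}.ncard = n := by
      have hmem : r ∈ {u | u ∉ Set.range a ∧ π u ≠ u} := ⟨hrA, hr⟩
      rw [hset, Set.ncard_sdiff_singleton_of_mem hmem, hn, Nat.add_sub_cancel]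
    obtain ⟨σ, hσ, hret⟩ := ih π' hmono hcard
    refine ⟨σ, ?_, fun j => (hret j).of_swap_mul hrA⟩
    rw [hπ', Equiv.Perm.sign_mul, Equiv.Perm.sign_swap hr.symm] at hσ
    rw [pow_succ, ← mul_assoc, ← hσ]
    simp

end FirstReturn

/-! ### Flows and permutations -/

section FlowGeneral

variable {V : Type*} [LinearOrder V] {q : ℕ} {Γ : Finset (V × V)} {a b : Fin q → V}

theorem IsFlow.eq_of_mem_of_mem_left (h : IsFlow Γ a b) {s t t' : V} (ht : (s, t) ∈ Γ)
    (ht' : (s, t') ∈ Γ) : t = t' := by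
  by_cases h1 : s ∈ Set.range a
  · obtain ⟨j, rfl⟩ := h1
    exact (h.source j).1.unique ht ht'
  by_cases h2 : s ∈ Set.range b
  · obtain ⟨j, rfl⟩ := h2
    exact absurd ht ((h.sink j).2 t)
  rcases h.other s h1 h2 with h3 | h3
  · exact absurd ht (h3.2 t)
  · exact h3.2.unique ht ht'

theorem IsFlow.eq_of_mem_of_mem_right (h : IsFlow Γ a b) {s s' t : V} (hs : (s, t) ∈ Γ)
    (hs' : (s', t) ∈ Γ) : s = s' := by
  by_cases h1 : t ∈ Set.range a
  · obtain ⟨j, rfl⟩ := h1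
    exact absurd hs ((h.source j).2 s)
  by_cases h2 : t ∈ Set.range b
  · obtain ⟨j, rfl⟩ := h2
    exact (h.sink j).1.unique hs hs'
  rcases h.other t h1 h2 with h3 | h3
  · exact absurd hs (h3.1 s)
  · exact h3.1.unique hs hs'

/-- Different sinks are not linked: the property of leading to a given sink is constant along the
edges because at most one edge begins at a vertex. -/
theorem IsFlow.sink_eq_of_linked (h : IsFlow Γ a b) {j k : Fin q} (hl : Linked Γ (b j) (b k)) :
    b j = b k := by
  have key : ∀ u v, Linked Γ u v → (Relation.ReflTransGen (fun s t => (s, t) ∈ Γ) u (b j) ↔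
      Relation.ReflTransGen (fun s t => (s, t) ∈ Γ) v (b j)) := by
    intro u v huv
    induction huv with
    | rel s t hst =>
      refine ⟨fun hs => ?_, fun ht => ht.head hst⟩
      rcases hs.cases_head with h1 | ⟨t', h1, h2⟩
      · exact absurd (h1 ▸ hst) ((h.sink j).2 t)
      · rwa [h.eq_of_mem_of_mem_left hst h1]
    | refl => exact Iff.rfl
    | symm _ _ _ ih => exact ih.symm
    | trans _ _ _ _ _ ih1 ih2 => exact ih1.trans ih2
  rcases ((key _ _ hl).1 .refl).cases_head with h1 | ⟨t, h1, -⟩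
  · exact h1.symm
  · exact absurd h1 ((h.sink k).2 t)

theorem IsFlow.linkPerm_eq (h : IsFlow Γ a b) (hb : Function.Injective b)
    (σ : Equiv.Perm (Fin q)) (hσ : ∀ j, Linked Γ (a j) (b (σ j))) : linkPerm Γ a b = σ := by
  have h1 : ∀ j, Linked Γ (a j) (b (linkPerm Γ a b j)) :=
    Classical.epsilon_spec (p := fun σ : Equiv.Perm (Fin q) => ∀ j, Linked Γ (a j) (b (σ j)))
      ⟨σ, hσ⟩
  refine Equiv.ext fun j => hb (h.sink_eq_of_linked ?_)
  exact Relation.EqvGen.trans _ _ _ (Relation.EqvGen.symm _ _ (h1 j)) (hσ j)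

end FlowGeneral

section FlowPerm

variable {ℓ q : ℕ}

/-- The function `f` maps `a_j ≤ i` to `b_j > i` and fixes all other vertices. -/
structure IsColumnMap (i : Fin ℓ) (a b : Fin q → Fin (ℓ + 1)) (f : Fin (ℓ + 1) → Fin (ℓ + 1)) :
    Prop where
  injective_source : Function.Injective a
  injective_sink : Function.Injective b
  source_le : ∀ j, a j ≤ i.castSucc
  lt_sink : ∀ j, i.castSucc < b j
  apply_source : ∀ j, f (a j) = b j
  apply_of_notMem : ∀ r, r ∉ Set.range a → f r = r

open Classical in
/-- A column map with given sources and sinks. -/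
def columnMap (a b : Fin q → Fin (ℓ + 1)) (r : Fin (ℓ + 1)) : Fin (ℓ + 1) :=
  if h : ∃ j, a j = r then b h.choose else r

theorem isColumnMap_columnMap {i : Fin ℓ} {a b : Fin q → Fin (ℓ + 1)} (ha : StrictMono a)
    (hb : StrictAnti b) (hai : ∀ j, a j ≤ i.castSucc) (hib : ∀ j, i.castSucc < b j) :
    IsColumnMap i a b (columnMap a b) where
  injective_source := ha.injective
  injective_sink := hb.injective
  source_le := hai
  lt_sink := hib
  apply_source j := by
    have h : ∃ k, a k = a j := ⟨j, rfl⟩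
    rw [columnMap, dif_pos h]
    exact congrArg b (ha.injective h.choose_spec)
  apply_of_notMem r hr := dif_neg hr

variable {i : Fin ℓ} {a b : Fin q → Fin (ℓ + 1)} {f : Fin (ℓ + 1) → Fin (ℓ + 1)}

theorem IsColumnMap.injOn (hf : IsColumnMap i a b f) {r s : Fin (ℓ + 1)} (hr : r ≤ i.castSucc)
    (hs : s ≤ i.castSucc) (h : f r = f s) : r = s := by
  by_cases h1 : r ∈ Set.range a
  · obtain ⟨j, rfl⟩ := h1
    by_cases h2 : s ∈ Set.range a
    · obtain ⟨k, rfl⟩ := h2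
      rw [hf.apply_source, hf.apply_source] at h
      rw [hf.injective_sink h]
    · rw [hf.apply_source, hf.apply_of_notMem s h2] at h
      exact absurd hs (not_le.2 (h ▸ hf.lt_sink j))
  · by_cases h2 : s ∈ Set.range a
    · obtain ⟨k, rfl⟩ := h2
      rw [hf.apply_source, hf.apply_of_notMem r h1] at h
      exact absurd hr (not_le.2 (h ▸ hf.lt_sink k))
    · rwa [hf.apply_of_notMem r h1, hf.apply_of_notMem s h2] at h

theorem IsColumnMap.apply_ne_source (hf : IsColumnMap i a b f) {r : Fin (ℓ + 1)} (j : Fin q) :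
    f r ≠ a j := by
  by_cases h1 : r ∈ Set.range a
  · obtain ⟨k, rfl⟩ := h1
    rw [hf.apply_source]
    exact ((hf.source_le j).trans_lt (hf.lt_sink k)).ne'
  · rw [hf.apply_of_notMem r h1]
    exact fun h => h1 ⟨j, h.symm⟩

open Classical in
/-- The edges `(r, f (π r))` that belong to a permutation `π` of the vertices `r ≤ i`. -/
def permEdges (i : Fin ℓ) (f : Fin (ℓ + 1) → Fin (ℓ + 1))
    (π : Equiv.Perm {r : Fin (ℓ + 1) // r ≤ i.castSucc}) : Finset (Fin (ℓ + 1) × Fin (ℓ + 1)) :=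
  Finset.univ.filter fun e => e.1 < e.2 ∧ ∃ h : e.1 ≤ i.castSucc, f (π ⟨e.1, h⟩) = e.2

theorem mem_permEdges {π : Equiv.Perm {r : Fin (ℓ + 1) // r ≤ i.castSucc}} {s t : Fin (ℓ + 1)} :
    (s, t) ∈ permEdges i f π ↔ s < t ∧ ∃ h : s ≤ i.castSucc, f (π ⟨s, h⟩) = t := by
  simp [permEdges]

theorem isFlow_permEdges (hf : IsColumnMap i a b f)
    {π : Equiv.Perm {r : Fin (ℓ + 1) // r ≤ i.castSucc}} (hπ : ∀ r, r.1 ≤ f (π r)) :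
    IsFlow (permEdges i f π) a b where
  lt s t h := (mem_permEdges.1 h).1
  source j := by
    refine ⟨⟨f (π ⟨a j, hf.source_le j⟩), mem_permEdges.2
      ⟨(hπ ⟨a j, hf.source_le j⟩).lt_of_ne (hf.apply_ne_source j).symm, hf.source_le j, rfl⟩,
      fun t ht => ?_⟩, fun s hs => ?_⟩
    · obtain ⟨-, _, h⟩ := mem_permEdges.1 ht
      exact h.symm
    · obtain ⟨-, h, h'⟩ := mem_permEdges.1 hs
      exact hf.apply_ne_source j h'
  sink j := by
    refine ⟨⟨(π.symm ⟨a j, hf.source_le j⟩).1, mem_permEdges.2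
      ⟨(π.symm _).2.trans_lt (hf.lt_sink j), (π.symm _).2, ?_⟩, fun s hs => ?_⟩, fun t ht => ?_⟩
    · rw [Subtype.coe_eta, Equiv.apply_symm_apply]
      exact hf.apply_source j
    · obtain ⟨-, h, h'⟩ := mem_permEdges.1 hs
      rw [← hf.apply_source] at h'
      have := Subtype.ext (hf.injOn (π ⟨s, h⟩).2 (hf.source_le j) h' :
        (π ⟨s, h⟩).1 = (⟨a j, hf.source_le j⟩ : {r : Fin (ℓ + 1) // r ≤ i.castSucc}).1)
      rw [← this, Equiv.symm_apply_apply]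
    · obtain ⟨-, h, -⟩ := mem_permEdges.1 ht
      exact absurd h (not_le.2 (hf.lt_sink j))
  other r hra hrb := by
    by_cases hr : r ≤ i.castSucc
    · by_cases hfix : π ⟨r, hr⟩ = ⟨r, hr⟩
      · left
        refine ⟨fun s hs => ?_, fun t ht => ?_⟩
        · obtain ⟨h1, h2, h3⟩ := mem_permEdges.1 hs
          have h4 : π ⟨s, h2⟩ = ⟨r, hr⟩ := Subtype.ext (hf.injOn (π ⟨s, h2⟩).2 hr
            (by rw [h3, hf.apply_of_notMem r hra]))
          rw [← hfix] at h4
          exact h1.ne (congrArg Subtype.val (π.injective h4))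
        · obtain ⟨h1, h2, h3⟩ := mem_permEdges.1 ht
          rw [hfix, hf.apply_of_notMem r hra] at h3
          exact h1.ne h3
      · right
        refine ⟨⟨(π.symm ⟨r, hr⟩).1, mem_permEdges.2 ⟨?_, (π.symm ⟨r, hr⟩).2, ?_⟩, fun s hs => ?_⟩,
          ⟨f (π ⟨r, hr⟩), mem_permEdges.2 ⟨?_, hr, rfl⟩, fun t ht => ?_⟩⟩
        · have h1 := hπ (π.symm ⟨r, hr⟩)
          rw [Equiv.apply_symm_apply, hf.apply_of_notMem r hra] at h1
          refine h1.lt_of_ne fun h => hfix ?_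
          have h2 : π.symm ⟨r, hr⟩ = ⟨r, hr⟩ := Subtype.ext h
          rw [Equiv.symm_apply_eq] at h2
          exact h2.symm
        · rw [Subtype.coe_eta, Equiv.apply_symm_apply]
          exact hf.apply_of_notMem r hra
        · obtain ⟨-, h2, h3⟩ := mem_permEdges.1 hs
          have h4 : π ⟨s, h2⟩ = ⟨r, hr⟩ := Subtype.ext (hf.injOn (π ⟨s, h2⟩).2 hr
            (by rw [h3, hf.apply_of_notMem r hra]))
          rw [← h4, Equiv.symm_apply_apply]
        · refine (hπ ⟨r, hr⟩).lt_of_ne fun h => hfix (Subtype.ext ?_)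
          exact hf.injOn (π ⟨r, hr⟩).2 hr (by rw [← h, hf.apply_of_notMem r hra])
        · obtain ⟨-, h2, h3⟩ := mem_permEdges.1 ht
          exact h3.symm
    · left
      refine ⟨fun s hs => ?_, fun t ht => ?_⟩
      · obtain ⟨-, h2, h3⟩ := mem_permEdges.1 hs
        by_cases h : (π ⟨s, h2⟩).1 ∈ Set.range a
        · obtain ⟨j, hj⟩ := h
          rw [← hj, hf.apply_source] at h3
          exact hrb ⟨j, h3⟩
        · rw [hf.apply_of_notMem _ h] at h3
          exact hr (h3 ▸ (π ⟨s, h2⟩).2)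
      · obtain ⟨-, h2, -⟩ := mem_permEdges.1 ht
        exact hr h2

theorem permEdges_mem_flows (hf : IsColumnMap i a b f)
    {π : Equiv.Perm {r : Fin (ℓ + 1) // r ≤ i.castSucc}} (hπ : ∀ r, r.1 ≤ f (π r)) :
    permEdges i f π ∈ flows i a b := by
  classical
  refine Finset.mem_filter.2 ⟨Finset.mem_univ _, isFlow_permEdges hf hπ, ?_⟩
  rintro r hr ⟨-, -, -, ⟨t, ht, -⟩⟩
  exact absurd (mem_permEdges.1 ht).2.1 (not_le.2 hr)

theorem permEdges_injective (hf : IsColumnMap i a b f)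
    {π π' : Equiv.Perm {r : Fin (ℓ + 1) // r ≤ i.castSucc}} (hπ : ∀ r, r.1 ≤ f (π r))
    (hπ' : ∀ r, r.1 ≤ f (π' r)) (h : permEdges i f π = permEdges i f π') : π = π' := by
  have key : ∀ {π π' : Equiv.Perm {r : Fin (ℓ + 1) // r ≤ i.castSucc}} (r),
      permEdges i f π = permEdges i f π' → r.1 < f (π r) → f (π' r) = f (π r) := by
    intro π π' r h hr
    have : (r.1, f (π r)) ∈ permEdges i f π' := h ▸ mem_permEdges.2 ⟨hr, r.2, rfl⟩
    exact (mem_permEdges.1 this).2.2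
  refine Equiv.ext fun r => Subtype.ext (hf.injOn (π r).2 (π' r).2 ?_)
  rcases (hπ r).lt_or_eq with h1 | h1
  · exact (key r h h1).symm
  · rcases (hπ' r).lt_or_eq with h2 | h2
    · exact key r h.symm h2
    · rw [← h1, ← h2]

/-- Every flow without transit points greater than `i` comes from a permutation: a vertex is sent to
the end of the edge that begins there, a sink `b_j` being identified with the source `a_j`, and the
other vertices are fixed. -/
theorem exists_permEdges_eq (hf : IsColumnMap i a b f)
    {Γ : Finset (Fin (ℓ + 1) × Fin (ℓ + 1))} (hΓ : Γ ∈ flows i a b) :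
    ∃ π : Equiv.Perm {r : Fin (ℓ + 1) // r ≤ i.castSucc}, (∀ r, r.1 ≤ f (π r)) ∧
      permEdges i f π = Γ := by
  classical
  obtain ⟨-, hflow, htr⟩ := Finset.mem_filter.1 hΓ
  -- the end of the edge that begins at `r`, or `r` if there is none
  set ψ : Fin (ℓ + 1) → Fin (ℓ + 1) := fun r => if h : ∃ t, (r, t) ∈ Γ then h.choose else r with hψ
  have hψ1 : ∀ {r t}, (r, t) ∈ Γ → ψ r = t := by
    intro r t h
    have h' : ∃ t, (r, t) ∈ Γ := ⟨t, h⟩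
    rw [hψ]
    simp only [dif_pos h']
    exact hflow.eq_of_mem_of_mem_left h'.choose_spec h
  have hψ2 : ∀ {r}, (∀ t, (r, t) ∉ Γ) → ψ r = r := fun h => dif_neg fun ⟨t, ht⟩ => h t ht
  have hend : ∀ {s t}, (s, t) ∈ Γ → t ≤ i.castSucc → t ∉ Set.range a ∧ ∃ u, (t, u) ∈ Γ := by
    intro s t h ht
    have h1 : t ∉ Set.range a := by
      rintro ⟨j, rfl⟩
      exact (hflow.source j).2 s h
    have h2 : t ∉ Set.range b := by
      rintro ⟨j, rfl⟩
      exact absurd ht (not_le.2 (hf.lt_sink j))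
    refine ⟨h1, ?_⟩
    rcases hflow.other t h1 h2 with h3 | h3
    · exact absurd h (h3.1 s)
    · exact h3.2.exists
  have hbeg : ∀ {s t}, (s, t) ∈ Γ → s ≤ i.castSucc := by
    intro s t h
    by_cases h1 : s ∈ Set.range a
    · obtain ⟨j, rfl⟩ := h1
      exact hf.source_le j
    by_cases h2 : s ∈ Set.range b
    · obtain ⟨j, rfl⟩ := h2
      exact absurd h ((hflow.sink j).2 t)
    rcases hflow.other s h1 h2 with h3 | h3
    · exact absurd h (h3.2 t)
    · by_contra hs
      exact htr s (not_le.1 hs) ⟨h1, h2, h3⟩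
  have hex : ∀ r : {r : Fin (ℓ + 1) // r ≤ i.castSucc},
      ∃ s : {r : Fin (ℓ + 1) // r ≤ i.castSucc}, f s.1 = ψ r.1 := by
    rintro ⟨r, hr⟩
    by_cases h : ∃ t, (r, t) ∈ Γ
    · obtain ⟨t, ht⟩ := h
      simp only [hψ1 ht]
      by_cases htb : t ∈ Set.range b
      · obtain ⟨j, rfl⟩ := htb
        exact ⟨⟨a j, hf.source_le j⟩, hf.apply_source j⟩
      · have hta : t ∉ Set.range a := by
          rintro ⟨j, rfl⟩
          exact (hflow.source j).2 r ht
        have hti : t ≤ i.castSucc := by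
          by_contra hti
          rcases hflow.other t hta htb with h3 | h3
          · exact h3.1 r ht
          · exact htr t (not_le.1 hti) ⟨hta, htb, h3⟩
        exact ⟨⟨t, hti⟩, hf.apply_of_notMem t hta⟩
    · have h' : ∀ t, (r, t) ∉ Γ := fun t ht => h ⟨t, ht⟩
      refine ⟨⟨r, hr⟩, ?_⟩
      simp only [hψ2 h']
      refine hf.apply_of_notMem r ?_
      rintro ⟨j, rfl⟩
      obtain ⟨t, ht, -⟩ := (hflow.source j).1
      exact h' t ht
  -- `p` sends `r` to the place whose column is `ψ r`
  choose p hp using hex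
  have hinj : Function.Injective p := by
    rintro ⟨r, hr⟩ ⟨s, hs⟩ hrs
    have h1 := hp ⟨r, hr⟩
    rw [hrs, hp ⟨s, hs⟩] at h1
    simp only at h1
    refine Subtype.ext ?_
    simp only
    by_cases h2 : ∃ t, (r, t) ∈ Γ
    · obtain ⟨t, ht⟩ := h2
      by_cases h3 : ∃ u, (s, u) ∈ Γ
      · obtain ⟨u, hu⟩ := h3
        rw [hψ1 ht, hψ1 hu] at h1
        subst h1
        exact hflow.eq_of_mem_of_mem_right ht hu
      · rw [hψ1 ht, hψ2 fun u hu => h3 ⟨u, hu⟩] at h1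
        subst h1
        exact absurd (hend ht hs).2 h3
    · by_cases h3 : ∃ u, (s, u) ∈ Γ
      · obtain ⟨u, hu⟩ := h3
        rw [hψ1 hu, hψ2 fun t ht => h2 ⟨t, ht⟩] at h1
        subst h1
        exact absurd (hend hu hr).2 h2
      · rw [hψ2 fun u hu => h3 ⟨u, hu⟩, hψ2 fun t ht => h2 ⟨t, ht⟩] at h1
        exact h1.symm
  refine ⟨Equiv.ofBijective p (Finite.injective_iff_bijective.1 hinj), fun r => ?_, ?_⟩
  · rw [Equiv.ofBijective_apply, hp]
    by_cases h2 : ∃ t, (r.1, t) ∈ Γ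
    · obtain ⟨t, ht⟩ := h2
      rw [hψ1 ht]
      exact (hflow.lt _ _ ht).le
    · rw [hψ2 fun t ht => h2 ⟨t, ht⟩]
  · ext ⟨s, t⟩
    rw [mem_permEdges]
    simp only [Equiv.ofBijective_apply, hp]
    constructor
    · rintro ⟨h1, h2, h3⟩
      by_cases h4 : ∃ u, (s, u) ∈ Γ
      · obtain ⟨u, hu⟩ := h4
        rw [hψ1 hu] at h3
        exact h3 ▸ hu
      · rw [hψ2 fun u hu => h4 ⟨u, hu⟩] at h3
        exact absurd h3 h1.ne
    · exact fun h => ⟨hflow.lt _ _ h, hbeg h, hψ1 h⟩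

theorem linked_of_firstReturn (hf : IsColumnMap i a b f)
    {π : Equiv.Perm {r : Fin (ℓ + 1) // r ≤ i.castSucc}} (hπ : ∀ r, r.1 ≤ f (π r))
    {u v : {r : Fin (ℓ + 1) // r ≤ i.castSucc}}
    (h : FirstReturn (Set.range fun j => (⟨a j, hf.source_le j⟩ : {r // r ≤ i.castSucc})) π u v) :
    Linked (permEdges i f π) u.1 (f v.1) := by
  induction h with
  | @hit u v h hv =>
    obtain ⟨j, rfl⟩ := hv
    refine Relation.EqvGen.rel _ _ (mem_permEdges.2 ⟨?_, u.2, ?_⟩)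
    · simp only [hf.apply_source]
      exact u.2.trans_lt (hf.lt_sink j)
    · rw [Subtype.coe_eta, h]
  | @pass u w v h hw _ ih =>
    have hw' : w.1 ∉ Set.range a := by
      rintro ⟨j, hj⟩
      exact hw ⟨j, Subtype.ext hj⟩
    have h1 := hπ u
    rw [h, hf.apply_of_notMem _ hw'] at h1
    rcases h1.lt_or_eq with h2 | h2
    · refine Relation.EqvGen.trans _ _ _ (Relation.EqvGen.rel _ _ (mem_permEdges.2 ⟨h2, u.2, ?_⟩)) ih
      rw [Subtype.coe_eta, h, hf.apply_of_notMem _ hw']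
    · rw [h2]
      exact ih

theorem isTransit_permEdges_iff (hf : IsColumnMap i a b f)
    {π : Equiv.Perm {r : Fin (ℓ + 1) // r ≤ i.castSucc}} (hπ : ∀ r, r.1 ≤ f (π r))
    (r : Fin (ℓ + 1)) : IsTransit (permEdges i f π) a b r ↔
      ∃ h : r ≤ i.castSucc, r ∉ Set.range a ∧ π ⟨r, h⟩ ≠ ⟨r, h⟩ := by
  constructor
  · rintro ⟨h1, -, -, ⟨t, ht, -⟩⟩
    obtain ⟨h2, h3, h4⟩ := mem_permEdges.1 ht
    refine ⟨h3, h1, fun h => ?_⟩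
    rw [h, hf.apply_of_notMem r h1] at h4
    exact h2.ne h4
  · rintro ⟨h, h1, h2⟩
    have h3 : r ∉ Set.range b := by
      rintro ⟨j, rfl⟩
      exact absurd h (not_le.2 (hf.lt_sink j))
    refine ⟨h1, h3, ((isFlow_permEdges hf hπ).other r h1 h3).resolve_left fun h4 => ?_⟩
    refine h4.2 (f (π ⟨r, h⟩)) (mem_permEdges.2 ⟨(hπ ⟨r, h⟩).lt_of_ne fun h5 => h2 ?_, h, rfl⟩)
    exact Subtype.ext (hf.injOn (π ⟨r, h⟩).2 h (by rw [← h5, hf.apply_of_notMem r h1]))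

/-- The sign of a flow is, up to a factor that depends only on the sinks, the sign of the
permutation. -/
theorem sgn_permEdges (hf : IsColumnMap i a b f)
    {π : Equiv.Perm {r : Fin (ℓ + 1) // r ≤ i.castSucc}} (hπ : ∀ r, r.1 ≤ f (π r)) :
    sgn i a b (permEdges i f π) =
      (-1) ^ (∑ j, ((b j : ℕ) - (i : ℕ))) * Equiv.Perm.sign π := by
  classical
  set a' : Fin q → {r : Fin (ℓ + 1) // r ≤ i.castSucc} := fun j => ⟨a j, hf.source_le j⟩ with ha'
  have hmem : ∀ r : {r : Fin (ℓ + 1) // r ≤ i.castSucc}, r ∈ Set.range a' ↔ r.1 ∈ Set.range a := by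
    intro r
    refine ⟨?_, ?_⟩
    · rintro ⟨j, rfl⟩
      exact ⟨j, rfl⟩
    · rintro ⟨j, hj⟩
      exact ⟨j, Subtype.ext hj⟩
  obtain ⟨σ, hσ, hret⟩ := exists_perm_firstReturn (a := a')
    (fun j k h => hf.injective_source (congrArg Subtype.val h)) _ π (fun r hr => by
      have h1 := hπ r
      rwa [hf.apply_of_notMem _ fun h => hr ((hmem _).2 h)] at h1) rfl
  have hlink : linkPerm (permEdges i f π) a b = σ := by
    refine (isFlow_permEdges hf hπ).linkPerm_eq hf.injective_sink σ fun j => ?_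
    have := linked_of_firstReturn hf hπ (hret j)
    rwa [hf.apply_source] at this
  have hcard : (Finset.univ.filter fun r => IsTransit (permEdges i f π) a b r).card =
      {r | r ∉ Set.range a' ∧ π r ≠ r}.ncard := by
    have h1 : Subtype.val '' {r | r ∉ Set.range a' ∧ π r ≠ r} =
        (Finset.univ.filter fun r => IsTransit (permEdges i f π) a b r : Finset (Fin (ℓ + 1))) := by
      ext r
      rw [Finset.coe_filter]
      simp only [Set.mem_image, Set.mem_ofPred_eq, Finset.mem_univ, true_and,
        isTransit_permEdges_iff hf hπ, hmem]
      constructor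
      · rintro ⟨s, hs, rfl⟩
        exact ⟨s.2, hs⟩
      · rintro ⟨h, hs⟩
        exact ⟨⟨r, h⟩, hs, rfl⟩
    rw [← Set.ncard_image_of_injective _ Subtype.val_injective, h1, Set.ncard_coe_finset]
  have hsum : (∑ j, (((b j : ℕ) : ℤ) - ((i : ℕ) : ℤ))) = ((∑ j, ((b j : ℕ) - (i : ℕ)) : ℕ) : ℤ) := by
    rw [Nat.cast_sum]
    refine Finset.sum_congr rfl fun j _ => ?_
    have := hf.lt_sink j
    rw [Fin.lt_def, Fin.val_castSucc] at this
    rw [Nat.cast_sub this.le]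
  rw [sgn, hlink, hsum, ← Nat.cast_add, zpow_natCast, pow_add, hσ, ← hcard]
  exact mul_left_comm _ _ _

end FlowPerm

section FlowSum

open MvPolynomial

variable (K : Type*) [Field K] {ℓ q : ℕ} {i : Fin ℓ} {a b : Fin q → Fin (ℓ + 1)}
  {f : Fin (ℓ + 1) → Fin (ℓ + 1)}

/-- The fixed points of the permutation that are not sources contribute diagonal entries, and the
other entries are the variables of the edges. -/
theorem prod_uniMat {π : Equiv.Perm {r : Fin (ℓ + 1) // r ≤ i.castSucc}}
    (hπ : ∀ r, r.1 ≤ f (π r)) :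
    ∏ r, uniMat K r.1 (f (π r)) = ∏ e ∈ permEdges i f π, X e := by
  classical
  have h1 : ∏ r, uniMat K r.1 (f (π r)) =
      ∏ r ∈ Finset.univ.filter (fun r : {r : Fin (ℓ + 1) // r ≤ i.castSucc} => r.1 < f (π r)),
        uniMat K r.1 (f (π r)) := by
    refine (Finset.prod_subset (Finset.filter_subset _ _) fun r _ hr => ?_).symm
    have h2 : r.1 = f (π r) := by
      by_contra hne
      exact hr (Finset.mem_filter.2 ⟨Finset.mem_univ _, (hπ r).lt_of_ne hne⟩)
    rw [← h2, uniMat_self]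
  rw [h1]
  refine Finset.prod_bij (fun r _ => (r.1, f (π r))) (fun r hr => ?_) (fun r _ s _ h => ?_)
    (fun e he => ?_) (fun r hr => uniMat_of_lt K (Finset.mem_filter.1 hr).2)
  · exact mem_permEdges.2 ⟨(Finset.mem_filter.1 hr).2, r.2, rfl⟩
  · exact Subtype.ext (Prod.mk.inj h).1
  · obtain ⟨s, t⟩ := e
    obtain ⟨h1, h2, rfl⟩ := mem_permEdges.1 he
    exact ⟨⟨s, h2⟩, Finset.mem_filter.2 ⟨Finset.mem_univ _, h1⟩, rfl⟩

/-- The Leibniz formula for the minor is a sum over flows. -/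
theorem sum_flows_eq_colMinor (hf : IsColumnMap i a b f) :
    (-1) ^ (∑ j, ((b j : ℕ) - (i : ℕ))) * colMinor K i f =
      ∑ Γ ∈ flows i a b, ((sgn i a b Γ : ℤˣ) : ℤ) • ∏ e ∈ Γ, X e := by
  classical
  rw [colMinor, ← Matrix.det_transpose, Matrix.det_apply', Finset.mul_sum]
  rw [← Finset.sum_subset (Finset.filter_subset
    (fun π : Equiv.Perm {r : Fin (ℓ + 1) // r ≤ i.castSucc} => ∀ r, r.1 ≤ f (π r)) _)
    fun π _ hπ => ?_]
  · refine Finset.sum_bij (fun π _ => permEdges i f π) (fun π hπ => ?_) (fun π hπ π' hπ' h => ?_)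
      (fun Γ hΓ => ?_) (fun π hπ => ?_)
    · exact permEdges_mem_flows hf (Finset.mem_filter.1 hπ).2
    · exact permEdges_injective hf (Finset.mem_filter.1 hπ).2 (Finset.mem_filter.1 hπ').2 h
    · obtain ⟨π, h1, h2⟩ := exists_permEdges_eq hf hΓ
      exact ⟨π, Finset.mem_filter.2 ⟨Finset.mem_univ _, h1⟩, h2⟩
    · have hπ := (Finset.mem_filter.1 hπ).2
      rw [sgn_permEdges hf hπ, zsmul_eq_mul, ← prod_uniMat K hπ, ← mul_assoc]
      push_cast
      rfl
  · obtain ⟨r, hr⟩ : ∃ r, ¬ r.1 ≤ f (π r) := by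
      by_contra h
      push Not at h
      exact hπ (Finset.mem_filter.2 ⟨Finset.mem_univ _, h⟩)
    have : ∏ r, (Matrix.of fun r s : {r : Fin (ℓ + 1) // r ≤ i.castSucc} =>
        uniMat K r.1 (f s.1)).transpose (π r) r = 0 :=
      Finset.prod_eq_zero (Finset.mem_univ r) (uniMat_of_gt K (not_le.1 hr))
    rw [this, mul_zero, mul_zero]

theorem wordPoly_fullWord_eq_sum_flows (ha : StrictMono a) (hb : StrictAnti b)
    (hai : ∀ j, a j ≤ i.castSucc) (hib : ∀ j, i.castSucc < b j) (w : Fin q → List (Fin ℓ))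
    (hw : ∀ j, IsShuffle (ascSeq i (a j)) (descSeq i (b j)) (w j)) :
    wordPoly K i (fullWord i w) =
      ∑ Γ ∈ flows i a b, ((sgn i a b Γ : ℤˣ) : ℤ) • ∏ e ∈ Γ, X e := by
  have hf := isColumnMap_columnMap ha hb hai hib
  rw [wordPoly_fullWord K i a b ha hb hai hib w hw _ hf.apply_source hf.apply_of_notMem,
    sum_flows_eq_colMinor K hf]

end FlowSum

/-! ### The action on tableaux -/

section TableauRows

variable {ℓ : ℕ} {lam : Fin (ℓ + 1) → ℕ}

theorem RegTab.mat_of_lt (T : RegTab lam) {r c : Fin (ℓ + 1)} (h : r < c) :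
    T.mat r c = (T.row r).count c := by
  rw [RegTab.mat, if_pos h, RegTab.row, Multiset.count_map]
  simp only [eq_comm (a := c)]
  rfl

theorem RegTab.mat_of_not_lt (T : RegTab lam) {r c : Fin (ℓ + 1)} (h : ¬ r < c) :
    T.mat r c = 0 := if_neg h

theorem RegTab.shape_eq_countP (T : RegTab lam) (m r : Fin (ℓ + 1)) :
    T.shape m r = (T.row r).countP (· ≤ m) := by
  rw [RegTab.shape, RegTab.row, Multiset.countP_map]
  rfl

theorem map_get_cast {α : Type*} (L : List α) {n : ℕ} (h : n = L.length) :
    (Finset.univ : Finset (Fin n)).val.map (fun j => L.get (j.cast h)) = (L : Multiset α) := by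
  subst h
  rw [Fin.univ_val_map]
  exact congrArg _ (List.ofFn_get L)

theorem row_sigma (i : Fin ℓ) (T : RegTab lam) (Γ : Finset (Fin (ℓ + 1) × Fin (ℓ + 1)))
    (h : SigmaDefined T Γ) (r : Fin (ℓ + 1)) : (sigma i T Γ h).row r = sigmaRow i T Γ r := by
  refine (map_get_cast _ _).trans ?_
  exact Multiset.sort_eq _ _

theorem ends_le_row {T : RegTab lam} {Γ : Finset (Fin (ℓ + 1) × Fin (ℓ + 1))}
    (h : SigmaDefined T Γ) (r : Fin (ℓ + 1)) : (ends Γ r).val ≤ T.row r := by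
  rw [Multiset.le_iff_subset (ends Γ r).nodup]
  intro t ht
  obtain ⟨j, hj⟩ := h (r, t) (by simpa [ends] using ht)
  exact Multiset.mem_map.2 ⟨j, Finset.mem_univ j, hj⟩

theorem mat_sigma (i : Fin ℓ) (T : RegTab lam) (Γ : Finset (Fin (ℓ + 1) × Fin (ℓ + 1)))
    (h : SigmaDefined T Γ) (r c : Fin (ℓ + 1)) :
    (sigma i T Γ h).mat r c = T.mat r c - if (r, c) ∈ Γ then 1 else 0 := by
  by_cases hrc : r < c
  · have h1 : (ends Γ r).val.count c = if (r, c) ∈ Γ then 1 else 0 := by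
      rw [Multiset.count_eq_of_nodup (ends Γ r).nodup]
      simp [ends]
    have h2 : (Multiset.replicate (ends Γ r).card r).count c = 0 := by
      rw [Multiset.count_replicate, if_neg hrc.ne]
    have h3 : (if i.castSucc < r then ({r} : Multiset (Fin (ℓ + 1))) else 0).count c = 0 := by
      split_ifs
      · rw [Multiset.count_singleton, if_neg hrc.ne']
      · exact Multiset.count_zero c
    rw [RegTab.mat_of_lt _ hrc, RegTab.mat_of_lt _ hrc, row_sigma, sigmaRow, Multiset.count_add,
      Multiset.count_add, Multiset.count_sub, h1, h2, h3, add_zero, add_zero]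
  · rw [RegTab.mat_of_not_lt _ hrc, RegTab.mat_of_not_lt _ hrc, Nat.zero_sub]

/-- The shape of a truncation of `σ_{Γ,i}(T)`. -/
theorem shape_sigma (i : Fin ℓ) (T : RegTab lam) (Γ : Finset (Fin (ℓ + 1) × Fin (ℓ + 1)))
    (h : SigmaDefined T Γ) (m r : Fin (ℓ + 1)) :
    (sigma i T Γ h).shape m r = T.shape m r +
      ((ends Γ r).filter fun t => r ≤ m ∧ m < t).card + if i.castSucc < r ∧ r ≤ m then 1 else 0 := by
  by_cases hrm : r ≤ m
  · have h1 : (ends Γ r).val.countP (· ≤ m) + ((ends Γ r).filter fun t => r ≤ m ∧ m < t).card =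
        (ends Γ r).card := by
      have e1 : (ends Γ r).val.countP (· ≤ m) = ((ends Γ r).filter (· ≤ m)).card := by
        rw [Multiset.countP_eq_card_filter]
        rfl
      have e2 : ((ends Γ r).filter fun t => r ≤ m ∧ m < t) =
          (ends Γ r).filter fun t => ¬ t ≤ m := by
        refine Finset.filter_congr fun t _ => ?_
        rw [not_le]
        exact and_iff_right hrm
      rw [e1, e2, Finset.card_filter_add_card_filter_not]
    have h2 : (Multiset.replicate (ends Γ r).card r).countP (· ≤ m) = (ends Γ r).card := by
      rw [Multiset.countP_eq_card.2 fun x hx => (Multiset.eq_of_mem_replicate hx).trans_le hrm,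
        Multiset.card_replicate]
    have h3 : (if i.castSucc < r then ({r} : Multiset (Fin (ℓ + 1))) else 0).countP (· ≤ m) =
        if i.castSucc < r ∧ r ≤ m then 1 else 0 := by
      by_cases hir : i.castSucc < r
      · rw [if_pos hir, if_pos ⟨hir, hrm⟩,
          Multiset.countP_eq_card.2 fun x hx => (Multiset.mem_singleton.1 hx).trans_le hrm,
          Multiset.card_singleton]
      · rw [if_neg hir, if_neg fun h => hir h.1, Multiset.countP_zero]
    have h4 := Multiset.countP_le_of_le (· ≤ m) (ends_le_row h r)
    rw [RegTab.shape_eq_countP, RegTab.shape_eq_countP, row_sigma, sigmaRow, Multiset.countP_add,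
      Multiset.countP_add, Multiset.countP_sub (ends_le_row h r), h2, h3]
    omega
  · have h1 : ∀ {mu : Fin (ℓ + 1) → ℕ} (S : RegTab mu), S.shape m r = 0 := by
      intro mu S
      rw [RegTab.shape, Finset.card_eq_zero, Finset.filter_eq_empty_iff]
      exact fun j _ hj => hrm ((S.reg r j).trans hj)
    rw [h1, h1, if_neg fun h => hrm h.2, Finset.filter_false_of_mem fun t _ h => hrm h.1,
      Finset.card_empty]

theorem RegTab.lt_shape_iff (T : RegTab lam) (m r : Fin (ℓ + 1)) (j : Fin (lam r)) :
    (j : ℕ) < T.shape m r ↔ T.entry r j ≤ m := by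
  rw [RegTab.shape]
  constructor
  · intro h
    by_contra hj
    have h1 : (Finset.univ.filter fun j => T.entry r j ≤ m) ⊆ Finset.Iio j := by
      intro k hk
      rw [Finset.mem_Iio]
      by_contra hkj
      exact hj ((T.mono r (not_lt.1 hkj)).trans (Finset.mem_filter.1 hk).2)
    have h2 := Finset.card_le_card h1
    rw [Fin.card_Iio] at h2
    omega
  · intro hj
    have h1 : Finset.Iic j ⊆ Finset.univ.filter fun j => T.entry r j ≤ m := fun k hk =>
      Finset.mem_filter.2 ⟨Finset.mem_univ _, (T.mono r (Finset.mem_Iic.1 hk)).trans hj⟩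
    have h2 := Finset.card_le_card h1
    rw [Fin.card_Iic] at h2
    omega

/-- A tableau is determined by the shapes of its truncations. -/
theorem RegTab.ext_shape {T S : RegTab lam} (h : ∀ m, T.shape m = S.shape m) : T = S := by
  refine RegTab.ext (funext fun r => funext fun j => le_antisymm ?_ ?_)
  · rw [← RegTab.lt_shape_iff, h, RegTab.lt_shape_iff]
  · rw [← RegTab.lt_shape_iff, ← h, RegTab.lt_shape_iff]

end TableauRows

section TableauAction

open MvPolynomial

variable (K : Type*) [Field K] {ℓ q : ℕ} {lam : Fin (ℓ + 1) → ℕ}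

/-- The exponent of the monomial `F_T`. -/
def tabExp (T : RegTab lam) : Fin (ℓ + 1) × Fin (ℓ + 1) →₀ ℕ :=
  Finsupp.equivFunOnFinite.symm fun p => T.mat p.1 p.2

theorem tabExp_apply (T : RegTab lam) (p : Fin (ℓ + 1) × Fin (ℓ + 1)) :
    tabExp T p = T.mat p.1 p.2 := rfl

/-- The exponent of the product of the variables over the edges. -/
def edgeExp (Γ : Finset (Fin (ℓ + 1) × Fin (ℓ + 1))) : Fin (ℓ + 1) × Fin (ℓ + 1) →₀ ℕ :=
  ∑ e ∈ Γ, Finsupp.single e 1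

theorem edgeExp_apply (Γ : Finset (Fin (ℓ + 1) × Fin (ℓ + 1))) (p : Fin (ℓ + 1) × Fin (ℓ + 1)) :
    edgeExp Γ p = if p ∈ Γ then 1 else 0 := by
  rw [edgeExp, Finsupp.finsetSum_apply]
  simp only [Finsupp.single_apply, Finset.sum_ite_eq']

theorem prod_X_eq_monomial (Γ : Finset (Fin (ℓ + 1) × Fin (ℓ + 1))) :
    ∏ e ∈ Γ, (X e : MvPolynomial (Fin (ℓ + 1) × Fin (ℓ + 1)) K) = monomial (edgeExp Γ) 1 := by
  rw [edgeExp, monomial_sum_one]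
  rfl

theorem edgeExp_le_tabExp_iff (T : RegTab lam) {Γ : Finset (Fin (ℓ + 1) × Fin (ℓ + 1))}
    (hΓ : ∀ s t, (s, t) ∈ Γ → s < t) : edgeExp Γ ≤ tabExp T ↔ SigmaDefined T Γ := by
  have hmem : ∀ e ∈ Γ, (1 ≤ T.mat e.1 e.2 ↔ ∃ j, T.entry e.1 j = e.2) := by
    intro e he
    rw [RegTab.mat_of_lt T (hΓ e.1 e.2 he), Multiset.one_le_count_iff_mem, RegTab.row,
      Multiset.mem_map]
    simp
  constructor
  · intro h e he
    have h1 := h e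
    rw [edgeExp_apply, if_pos he, tabExp_apply] at h1
    exact (hmem e he).1 h1
  · intro h e
    rw [edgeExp_apply, tabExp_apply]
    split_ifs with he
    · exact (hmem e he).2 (h e he)
    · exact Nat.zero_le _

theorem tabExp_sub_edgeExp (i : Fin ℓ) (T : RegTab lam)
    (Γ : Finset (Fin (ℓ + 1) × Fin (ℓ + 1))) (h : SigmaDefined T Γ) :
    tabExp T - edgeExp Γ = tabExp (sigma i T Γ h) := by
  ext ⟨r, c⟩
  rw [Finsupp.tsub_apply, tabExp_apply, tabExp_apply, edgeExp_apply, mat_sigma]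

theorem cartMon_zero (δ : Fin ℓ → ℤ) : cartMon K δ 0 = 1 := by
  refine List.prod_eq_one fun x hx => ?_
  obtain ⟨l, -, rfl⟩ := List.mem_map.1 hx
  exact Hbin_zero K l _

theorem toHyper_tabExp (T : RegTab lam) :
    toHyper K (Finsupp.single (tabExp T) 1) = (FTab K T : Hyper K ℓ) := by
  rw [toHyper, Finsupp.linearCombination_single, one_smul]
  rfl

theorem negCart_tabExp (T : RegTab lam) :
    negCart K 0 (Finsupp.single (tabExp T) 1) = FTab K T := by
  refine Subtype.ext ?_
  rw [coe_negCart, cartMon_zero, mul_one, toHyper_tabExp]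

theorem act_prod_X_tabExp (i : Fin ℓ) (T : RegTab lam)
    {Γ : Finset (Fin (ℓ + 1) × Fin (ℓ + 1))} (hΓ : ∀ s t, (s, t) ∈ Γ → s < t) :
    toHyper K (act K ℓ (∏ e ∈ Γ, X e) (Finsupp.single (tabExp T) 1)) =
      ((if h : SigmaDefined T Γ then FTab K (sigma i T Γ h) else 0 : Um0 K ℓ) : Hyper K ℓ) := by
  rw [prod_X_eq_monomial, act_monomial, one_smul, lowerBy_single]
  by_cases h : SigmaDefined T Γ
  · rw [if_pos ((edgeExp_le_tabExp_iff T hΓ).2 h), dif_pos h, tabExp_sub_edgeExp i T Γ h,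
      toHyper_tabExp]
  · rw [if_neg fun h' => h ((edgeExp_le_tabExp_iff T hΓ).1 h'), dif_neg h, map_zero]
    rfl

variable {i : Fin ℓ} {a b : Fin q → Fin (ℓ + 1)}

theorem isFlow_of_mem_flows {Γ : Finset (Fin (ℓ + 1) × Fin (ℓ + 1))} (hΓ : Γ ∈ flows i a b) :
    IsFlow Γ a b := by
  classical
  exact (Finset.mem_filter.1 hΓ).2.1

/-- The action of the commutators on the elements `F_T`. -/
theorem bracket_fullWord_FTab (ha : StrictMono a) (hb : StrictAnti b)
    (hai : ∀ j, a j ≤ i.castSucc) (hib : ∀ j, i.castSucc < b j) (w : Fin q → List (Fin ℓ))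
    (hw : ∀ j, IsShuffle (ascSeq i (a j)) (descSeq i (b j)) (w j)) (T : RegTab lam) :
    bracket K i (fullWord i w) (FTab K T) =
      ∑ Γ ∈ flows i a b, if h : SigmaDefined T Γ then
        ((sgn i a b Γ : ℤˣ) : ℤ) • FTab K (sigma i T Γ h) else 0 := by
  refine Subtype.ext ?_
  rw [← negCart_tabExp, bracket_apply, cartMon_zero, mul_one,
    wordPoly_fullWord_eq_sum_flows K ha hb hai hib w hw, map_sum, LinearMap.sum_apply, map_sum,
    AddSubmonoidClass.coe_finsetSum]
  refine Finset.sum_congr rfl fun Γ hΓ => ?_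
  rw [map_zsmul, LinearMap.smul_apply, map_zsmul,
    act_prod_X_tabExp K i T fun s t => (isFlow_of_mem_flows hΓ).lt s t]
  split_ifs
  · rfl
  · exact smul_zero _

theorem bracket_fullWord_eq_xi (ha : StrictMono a) (hb : StrictAnti b)
    (hai : ∀ j, a j ≤ i.castSucc) (hib : ∀ j, i.castSucc < b j) (w : Fin q → List (Fin ℓ))
    (hw : ∀ j, IsShuffle (ascSeq i (a j)) (descSeq i (b j)) (w j)) :
    bracket K i (fullWord i w) = xi K i a b := by
  refine (basisUm0 K).ext fun x => Subtype.ext ?_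
  have h : basisUm0 K x = negCart K x.2
      (Finsupp.single (Finsupp.equivFunOnFinite.symm fun p => expMat x.1.1 p.1 p.2) 1) := by
    refine Subtype.ext ?_
    rw [basisUm0_apply, coe_negCart, toHyper, Finsupp.linearCombination_single, one_smul]
    rfl
  rw [h, bracket_apply, xi, bracket_apply, wordPoly_fullWord_eq_sum_flows K ha hb hai hib w hw,
    wordPoly_fullWord_eq_sum_flows K ha hb hai hib _ fun j => isShuffle_append _ _]

end TableauAction

/-! ### Minimal tableaux -/

section Minimal

variable {ℓ q : ℕ} {lam : Fin (ℓ + 1) → ℕ} {i : Fin ℓ} {a b : Fin q → Fin (ℓ + 1)}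

/-- A comparison of flows and tableaux: if `σ_{Γ',i}(S) ≤ σ_{Γ,i}(T)` and `Γ < Γ'`, then `S < T`.
The shapes that decide are those of the entries less than the end of the first edge at which the
flows differ. -/
theorem RegTab.lt_of_sigma_le_of_flowLT {S T : RegTab lam}
    {Γ Γ' : Finset (Fin (ℓ + 1) × Fin (ℓ + 1))} (hΓ : IsFlow Γ a b) (hΓ' : IsFlow Γ' a b)
    (hlt : FlowLT Γ Γ') (h : SigmaDefined T Γ) (h' : SigmaDefined S Γ')
    (hle : (sigma i S Γ' h').LT (sigma i T Γ h) ∨ sigma i S Γ' h' = sigma i T Γ h) : S.LT T := by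
  obtain ⟨s, s', t, hst, hst', hss, hagree⟩ := hlt
  have hstlt := hΓ.lt _ _ hst
  obtain ⟨p, rfl⟩ : ∃ p : Fin ℓ, t = p.succ :=
    ⟨t.pred (ne_of_gt ((Fin.zero_le _).trans_lt hstlt)), by simp⟩
  have hp : ∀ x : Fin (ℓ + 1), p.castSucc < x ↔ p.succ ≤ x := fun x => by
    rw [Fin.lt_def, Fin.le_def, Fin.val_castSucc, Fin.val_succ, Nat.succ_le_iff]
  have hp' : ∀ x : Fin (ℓ + 1), x < p.succ ↔ x ≤ p.castSucc := fun x => by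
    rw [Fin.lt_def, Fin.le_def, Fin.val_castSucc, Fin.val_succ, Nat.lt_succ_iff]
  -- beyond the first difference of the flows the shapes change in the same way
  have hsame : ∀ m, p.succ ≤ m → ∀ r, ((ends Γ' r).filter fun t => r ≤ m ∧ m < t).card =
      ((ends Γ r).filter fun t => r ≤ m ∧ m < t).card := by
    intro m hm r
    congr 1
    ext u
    simp only [ends, Finset.mem_filter, Finset.mem_univ, true_and]
    refine and_congr_left fun hu => ?_
    exact (hagree r u (hm.trans_lt hu.2)).symm
  have hshape : ∀ m, p.succ ≤ m → ∀ r, (sigma i S Γ' h').shape m r + T.shape m r =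
      (sigma i T Γ h).shape m r + S.shape m r := by
    intro m hm r
    rw [shape_sigma i S Γ', shape_sigma i T Γ, hsame m hm]
    omega
  have hcount : ∀ {Δ : Finset (Fin (ℓ + 1) × Fin (ℓ + 1))} (_ : IsFlow Δ a b) {x : Fin (ℓ + 1)}
      (_ : (x, p.succ) ∈ Δ) (r : Fin (ℓ + 1)),
      ((ends Δ r).filter fun t => r ≤ p.castSucc ∧ p.castSucc < t).card =
        ((ends Δ r).filter fun t => r ≤ p.castSucc ∧ p.succ < t).card + if r = x then 1 else 0 := by
    intro Δ hΔ x hx r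
    have e1 : ((ends Δ r).filter fun t => r ≤ p.castSucc ∧ p.castSucc < t) =
        ((ends Δ r).filter fun t => r ≤ p.castSucc ∧ p.succ < t) ∪
          if r = x then {p.succ} else ∅ := by
      ext u
      rw [Finset.mem_union]
      simp only [ends, Finset.mem_filter, Finset.mem_univ, true_and, hp]
      constructor
      · rintro ⟨h1, h2, h3⟩
        rcases h3.lt_or_eq with h4 | h4
        · exact Or.inl ⟨h1, h2, h4⟩
        · subst h4
          rw [if_pos (hΔ.eq_of_mem_of_mem_right h1 hx)]
          exact Or.inr (Finset.mem_singleton_self _)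
      · rintro (⟨h1, h2, h3⟩ | h1)
        · exact ⟨h1, h2, h3.le⟩
        · split_ifs at h1 with h2
          · rw [Finset.mem_singleton.1 h1, h2]
            exact ⟨hx, (hp' x).1 (hΔ.lt _ _ hx), le_rfl⟩
          · simp at h1
    rw [e1, Finset.card_union_of_disjoint]
    · split_ifs <;> rfl
    · rw [Finset.disjoint_right]
      intro u hu hu'
      split_ifs at hu with h2
      · rw [Finset.mem_singleton] at hu
        exact absurd (Finset.mem_filter.1 hu').2.2 (hu ▸ lt_irrefl _)
      · simp at hu
  have hshape' : ∀ r, (sigma i S Γ' h').shape p.castSucc r + T.shape p.castSucc r +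
      (if r = s then 1 else 0) =
      (sigma i T Γ h).shape p.castSucc r + S.shape p.castSucc r + if r = s' then 1 else 0 := by
    intro r
    have e1 : ((ends Γ' r).filter fun t => r ≤ p.castSucc ∧ p.succ < t).card =
        ((ends Γ r).filter fun t => r ≤ p.castSucc ∧ p.succ < t).card := by
      congr 1
      ext u
      simp only [ends, Finset.mem_filter, Finset.mem_univ, true_and]
      exact and_congr_left fun hu => (hagree r u hu.2).symm
    rw [shape_sigma i S Γ', shape_sigma i T Γ, hcount hΓ hst, hcount hΓ' hst', e1]
    omega
  have hfun : ∀ m, p.succ ≤ m → (sigma i S Γ' h').shape m = (sigma i T Γ h).shape m →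
      S.shape m = T.shape m := by
    intro m hm heq
    funext r
    have := hshape m hm r
    rw [heq] at this
    omega
  -- the case in which the shapes agree beyond the first difference of the flows
  have hlow : (∀ m, p.succ ≤ m → (sigma i S Γ' h').shape m = (sigma i T Γ h).shape m) →
      DomLE ((sigma i S Γ' h').shape p.castSucc) ((sigma i T Γ h).shape p.castSucc) → S.LT T := by
    intro h1 h2
    have hsum : ∀ k, ∑ r ∈ Finset.Iic k, (sigma i S Γ' h').shape p.castSucc r +
        ∑ r ∈ Finset.Iic k, T.shape p.castSucc r + (if s ≤ k then 1 else 0) =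
        ∑ r ∈ Finset.Iic k, (sigma i T Γ h).shape p.castSucc r +
          ∑ r ∈ Finset.Iic k, S.shape p.castSucc r + if s' ≤ k then 1 else 0 := by
      intro k
      have := Finset.sum_congr (rfl : Finset.Iic k = Finset.Iic k) fun r _ => hshape' r
      simpa only [Finset.sum_add_distrib, Finset.sum_ite_eq', Finset.mem_Iic] using this
    refine ⟨p.castSucc, ⟨fun k => ?_, fun heq => ?_⟩, fun m hm => hfun m ((hp m).1 hm)
      (h1 m ((hp m).1 hm))⟩
    · have e1 := hsum k
      have e2 := h2 k
      by_cases hsk : s ≤ k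
      · rw [if_pos hsk, if_pos (hss.le.trans hsk)] at e1
        omega
      · rw [if_neg hsk] at e1
        omega
    · have e1 := hsum s'
      have e2 := h2 s'
      rw [heq, if_neg (not_le.2 hss), if_pos le_rfl] at e1
      omega
  rcases hle with ⟨m₀, ⟨hdom, hne⟩, habove⟩ | heq
  · rcases lt_trichotomy m₀ p.castSucc with hm | hm | hm
    · refine hlow (fun m hm' => habove m (hm.trans ((hp m).2 hm'))) ?_
      rw [habove _ hm]
      exact fun k => le_rfl
    · subst hm
      exact hlow (fun m hm' => habove m ((hp m).2 hm')) hdom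
    · have hm := (hp _).1 hm
      refine ⟨m₀, ⟨fun k => ?_, fun heq => hne (funext fun r => ?_)⟩, fun m hm' => hfun m
        (hm.trans hm'.le) (habove m hm')⟩
      · have e1 := Finset.sum_congr (rfl : Finset.Iic k = Finset.Iic k) fun r _ => hshape m₀ hm r
        rw [Finset.sum_add_distrib, Finset.sum_add_distrib] at e1
        have e2 := hdom k
        omega
      · have e1 := hshape m₀ hm r
        rw [heq] at e1
        omega
  · refine hlow (fun m _ => by rw [heq]) ?_
    rw [heq]
    exact fun k => le_rfl

/-- The operation `σ_{Γ,i}` reflects the order. -/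
theorem RegTab.le_of_sigma_le {S T : RegTab lam} {Γ : Finset (Fin (ℓ + 1) × Fin (ℓ + 1))}
    (h : SigmaDefined T Γ) (h' : SigmaDefined S Γ)
    (hle : (sigma i S Γ h').LT (sigma i T Γ h) ∨ sigma i S Γ h' = sigma i T Γ h) :
    S.LT T ∨ S = T := by
  have hshape : ∀ m r, (sigma i S Γ h').shape m r + T.shape m r =
      (sigma i T Γ h).shape m r + S.shape m r := by
    intro m r
    rw [shape_sigma i S Γ, shape_sigma i T Γ]
    omega
  have hfun : ∀ m, (sigma i S Γ h').shape m = (sigma i T Γ h).shape m ↔ S.shape m = T.shape m := by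
    intro m
    constructor <;> intro heq <;> funext r <;> have := hshape m r <;> rw [heq] at this <;> omega
  rcases hle with ⟨m, ⟨hdom, hne⟩, habove⟩ | heq
  · left
    refine ⟨m, ⟨fun k => ?_, fun heq => hne ((hfun m).2 heq)⟩, fun m' hm' =>
      (hfun m').1 (habove m' hm')⟩
    have e1 := Finset.sum_congr (rfl : Finset.Iic k = Finset.Iic k) fun r _ => hshape m r
    rw [Finset.sum_add_distrib, Finset.sum_add_distrib] at e1
    have e2 := hdom k
    omega
  · right
    exact RegTab.ext_shape fun m => (hfun m).1 (by rw [heq])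

theorem eq_of_sigma_le {X : Finset (RegTab lam)} {T : RegTab lam} (hT : IsMinimal X T)
    {Γ : Finset (Fin (ℓ + 1) × Fin (ℓ + 1))} (hΓ : Γ ∈ flows i a b)
    (hmin : ∀ Γ' ∈ flows i a b, Γ' ≠ Γ → FlowLT Γ Γ') (h : SigmaDefined T Γ) {S : RegTab lam}
    (hS : S ∈ X) {Γ' : Finset (Fin (ℓ + 1) × Fin (ℓ + 1))} (hΓ' : Γ' ∈ flows i a b)
    (h' : SigmaDefined S Γ')
    (hle : (sigma i S Γ' h').LT (sigma i T Γ h) ∨ sigma i S Γ' h' = sigma i T Γ h) :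
    S = T ∧ Γ' = Γ := by
  by_cases hne : Γ' = Γ
  · subst hne
    exact ⟨(RegTab.le_of_sigma_le h h' hle).resolve_left
      (hT.2 S hS), rfl⟩
  · exact absurd (RegTab.lt_of_sigma_le_of_flowLT (isFlow_of_mem_flows hΓ) (isFlow_of_mem_flows hΓ')
      (hmin Γ' hΓ' hne) h h' hle) (hT.2 S hS)

theorem RegTab.lt_irrefl (T : RegTab lam) : ¬ T.LT T := fun ⟨_, h, _⟩ => h.2 rfl

/-- A linear combination of the elements `F_P` in which a minimal index occurs once is a linear
combination with nonzero coefficients in which this index is minimal. -/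
theorem exists_isMinimal_of_sum {K : Type*} [Field K] {ι : Type*} (J : Finset ι)
    (P : ι → RegTab lam) (c : ι → K) (j₀ : ι) (hj₀ : j₀ ∈ J) (hc : c j₀ ≠ 0)
    (hJ : ∀ j ∈ J, (P j).LT (P j₀) ∨ P j = P j₀ → j = j₀) :
    ∃ (Y : Finset (RegTab lam)) (β : RegTab lam → K), (∀ Q ∈ Y, β Q ≠ 0) ∧
      ∑ j ∈ J, c j • FTab K (P j) = ∑ Q ∈ Y, β Q • FTab K Q ∧ IsMinimal Y (P j₀) := by
  classical
  set β : RegTab lam → K := fun Q => ∑ j ∈ J.filter fun j => P j = Q, c j with hβ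
  have hβ₀ : β (P j₀) = c j₀ := by
    refine Finset.sum_eq_single_of_mem j₀ (Finset.mem_filter.2 ⟨hj₀, rfl⟩) fun j hj hne => ?_
    have hj := Finset.mem_filter.1 hj
    exact absurd (hJ j hj.1 (Or.inr hj.2)) hne
  refine ⟨(J.image P).filter fun Q => β Q ≠ 0, β, fun Q hQ => (Finset.mem_filter.1 hQ).2, ?_,
    Finset.mem_filter.2 ⟨Finset.mem_image_of_mem P hj₀, hβ₀ ▸ hc⟩, fun Q hQ hlt => ?_⟩
  · rw [← Finset.sum_fiberwise_of_maps_to (t := J.image P) (g := P)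
      fun j hj => Finset.mem_image_of_mem P hj]
    rw [Finset.sum_filter_of_ne (p := fun Q => β Q ≠ 0) fun Q _ hQ h0 => hQ (by rw [h0, zero_smul])]
    refine Finset.sum_congr rfl fun Q _ => ?_
    rw [hβ, Finset.sum_smul]
    exact Finset.sum_congr rfl fun j hj => by rw [(Finset.mem_filter.1 hj).2]
  · obtain ⟨j, hj, rfl⟩ := Finset.mem_image.1 (Finset.mem_filter.1 hQ).1
    have := hJ j hj (Or.inl hlt)
    subst this
    exact RegTab.lt_irrefl _ hlt

/-- The value of a linear map on a linear combination as a sum over the pairs with property `p`. -/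
theorem map_sum_smul_ite {K M N ι κ : Type*} [Field K] [AddCommGroup M] [Module K M]
    [AddCommGroup N] [Module K N] (ξ : M →ₗ[K] N) (X : Finset ι) (Y : Finset κ) (α : ι → K)
    (F : ι → M) (p : ι × κ → Prop) [DecidablePred p] (z : κ → ℤ) (G : ι × κ → N)
    (h : ∀ s, ξ (F s) = ∑ g ∈ Y, if p (s, g) then z g • G (s, g) else 0) :
    ξ (∑ s ∈ X, α s • F s) = ∑ j ∈ (X ×ˢ Y).filter p, (z j.2 • α j.1) • G j := by
  rw [Finset.sum_filter, Finset.sum_product, map_sum]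
  refine Finset.sum_congr rfl fun s _ => ?_
  rw [map_smul, h, Finset.smul_sum]
  refine Finset.sum_congr rfl fun g _ => ?_
  split_ifs
  · rw [smul_assoc, smul_comm]
  · rw [smul_zero]

theorem xi_FTab (K : Type*) [Field K] (ha : StrictMono a) (hb : StrictAnti b)
    (hai : ∀ j, a j ≤ i.castSucc) (hib : ∀ j, i.castSucc < b j) (T : RegTab lam) :
    xi K i a b (FTab K T) = ∑ Γ ∈ flows i a b, if h : SigmaDefined T Γ then
      ((sgn i a b Γ : ℤˣ) : ℤ) • FTab K (sigma i T Γ h) else 0 :=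
  bracket_fullWord_FTab K ha hb hai hib _ (fun _ => isShuffle_append _ _) T

theorem exists_isMinimal_xi (K : Type*) [Field K] (ha : StrictMono a) (hb : StrictAnti b)
    (hai : ∀ j, a j ≤ i.castSucc) (hib : ∀ j, i.castSucc < b j) (X : Finset (RegTab lam))
    (α : RegTab lam → K) (hα : ∀ S ∈ X, α S ≠ 0) (T : RegTab lam) (hT : IsMinimal X T)
    (Γ : Finset (Fin (ℓ + 1) × Fin (ℓ + 1))) (hΓ : Γ ∈ flows i a b)
    (hmin : ∀ Γ' ∈ flows i a b, Γ' ≠ Γ → FlowLT Γ Γ') (h : SigmaDefined T Γ) :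
    ∃ (Y : Finset (RegTab (newShape i lam))) (β : RegTab (newShape i lam) → K),
      (∀ P ∈ Y, β P ≠ 0) ∧
      xi K i a b (∑ S ∈ X, α S • FTab K S) = ∑ P ∈ Y, β P • FTab K P ∧
      IsMinimal Y (sigma i T Γ h) := by
  set J := (X ×ˢ flows i a b).filter fun p => SigmaDefined p.1 p.2 with hJ
  -- the value for the pairs outside `J` is irrelevant
  set P : RegTab lam × Finset (Fin (ℓ + 1) × Fin (ℓ + 1)) →
      RegTab (newShape i lam) := fun p =>
    if h' : SigmaDefined p.1 p.2 then sigma i p.1 p.2 h' else sigma i T Γ h with hP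
  have hPT : P (T, Γ) = sigma i T Γ h := dif_pos h
  obtain ⟨Y, β, hβ, hsum, hY⟩ := exists_isMinimal_of_sum J P
    (fun p => ((sgn i a b p.2 : ℤˣ) : ℤ) • α p.1) (T, Γ)
    (Finset.mem_filter.2 ⟨Finset.mem_product.2 ⟨hT.1, hΓ⟩, h⟩)
    (by
      rcases Int.units_eq_one_or (sgn i a b Γ) with h1 | h1 <;>
        simpa [h1] using hα T hT.1)
    (by
      rintro ⟨S, Γ'⟩ hp hle
      obtain ⟨hp, h'⟩ := Finset.mem_filter.1 hp
      obtain ⟨hS, hΓ'⟩ := Finset.mem_product.1 hp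
      have hPS : P (S, Γ') = sigma i S Γ' h' := dif_pos h'
      rw [hPT, hPS] at hle
      obtain ⟨h1, h2⟩ := eq_of_sigma_le hT hΓ hmin h hS hΓ' h' hle
      exact Prod.ext h1 h2)
  refine ⟨Y, β, hβ, ?_, hPT ▸ hY⟩
  rw [← hsum]
  refine map_sum_smul_ite (xi K i a b) X (flows i a b) α (FTab K)
    (fun p => SigmaDefined p.1 p.2) (fun Γ => ((sgn i a b Γ : ℤˣ) : ℤ)) (fun p => FTab K (P p))
    fun S => ?_
  rw [xi_FTab K ha hb hai hib]
  refine Finset.sum_congr rfl fun Γ' _ => ?_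
  by_cases h' : SigmaDefined S Γ'
  · have hPS : P (S, Γ') = sigma i S Γ' h' := dif_pos h'
    rw [dif_pos h', if_pos h', hPS]
  · rw [dif_neg h', if_neg h']

end Minimal

end

end TypeA

theorem corollary30 (K : Type*) [Field K] [IsAlgClosed K] (ℓ q : ℕ) (i : Fin ℓ)
    (a b : Fin q → Fin (ℓ + 1)) (ha : StrictMono a) (hb : StrictAnti b)
    (hai : ∀ j, a j ≤ i.castSucc) (hib : ∀ j, i.castSucc < b j) :
    -- the operator `ξ_i(a; b)` does not depend on the choice of the shuffles
    (∀ w : Fin q → List (Fin ℓ),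
      (∀ j, TypeA.IsShuffle (TypeA.ascSeq i (a j)) (TypeA.descSeq i (b j)) (w j)) →
        TypeA.bracket K i (TypeA.fullWord i w) = TypeA.xi K i a b) ∧
    ∀ lam : Fin (ℓ + 1) → ℕ,
      -- the formula for `ξ_i(a; b)(F_T)`
      (∀ T : TypeA.RegTab lam,
        TypeA.xi K i a b (TypeA.FTab K T) =
          ∑ Γ ∈ TypeA.flows i a b,
            if h : TypeA.SigmaDefined T Γ then
              ((TypeA.sgn i a b Γ : ℤˣ) : ℤ) • TypeA.FTab K (TypeA.sigma i T Γ h)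
            else 0) ∧
      -- minimal elements of the support
      (∀ (X : Finset (TypeA.RegTab lam)) (α : TypeA.RegTab lam → K), (∀ S ∈ X, α S ≠ 0) →
        ∀ T, TypeA.IsMinimal X T →
        ∀ Γ ∈ TypeA.flows i a b, (∀ Γ' ∈ TypeA.flows i a b, Γ' ≠ Γ → TypeA.FlowLT Γ Γ') →
        ∀ h : TypeA.SigmaDefined T Γ,
          ∃ (Y : Finset (TypeA.RegTab (TypeA.newShape i lam)))
            (β : TypeA.RegTab (TypeA.newShape i lam) → K),
            (∀ P ∈ Y, β P ≠ 0) ∧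
            TypeA.xi K i a b (∑ S ∈ X, α S • TypeA.FTab K S) = ∑ P ∈ Y, β P • TypeA.FTab K P ∧
            TypeA.IsMinimal Y (TypeA.sigma i T Γ h)) := by
  exact ⟨fun w hw => TypeA.bracket_fullWord_eq_xi K ha hb hai hib w hw, fun lam =>
    ⟨fun T => TypeA.xi_FTab K ha hb hai hib T, fun X α hα T hT Γ hΓ hmin h =>
      TypeA.exists_isMinimal_xi K ha hb hai hib X α hα T hT Γ hΓ hmin h⟩⟩
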